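/- Let $\Bbbk$ be an algebraically closed field of characteristic $0$ and let $\mathrm{Vect}$ be the category of finite-dimensional $\Bbbk$-vector spaces. Let $\mathcal G$ be a finite 2-group, i.e. a monoidal groupoid in which every object is invertible under $\otimes$, such that the set of isomorphism classes of objects and the set $\mathrm{End}(e)$ of endomorphisms of the tensor unit $e$ are finite. For each object $g$ fix a dual $g^*$ with $\eta_g\colon e\to g\otimes g^*$ and $g^*\otimes g\to e$ satisfying the triangle identities; $g\mapsto g^*$ is a covariant functor on the groupoid $\mathcal G$ (a morphism $a$ is sent to the inverse of its mate). $\mathcal G$ acts on itself by conjugation, $g\odot x=(g\otimes x)\otimes g^*$. Notation. * $\mathcal G/\!/\mathcal G$ is the homotopy quotient of this action: the 2-groupoid whose objects are the objects of $\mathcal G$, whose 1-morphisms $x\to y$ are pairs $(g,\ r\colon g\odot x\to y)$, and whose 2-morphisms $(g,r)\to(h,s)$ are the morphisms $a\colon g\to h$ with $s\circ(a\odot 1_x)=r$; the composite of $(g,r)\colon x\to y$ and then $(h,s)\colon y\to z$ is $h\otimes g$ with $(h\otimes g)\odot x\cong h\odot(g\odot x)\to h\odot y\to z$. * $\mathrm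 L\mathcal G=\mathrm{Fun}(\mathrm B\mathbb Z,\mathrm B\mathcal G)$ is the loop 2-groupoid of 2-functors, 2-natural transformations and modifications. A 1-morphism $\alpha\colon\varphi\to\psi$ has a component $\alpha_*\in\mathcal G$ and an isomorphism $\alpha_*\otimes\varphi(1)\cong\psi(1)\otimes\alpha_*$, hence determines a 1-morphism $\bar\alpha=\bigl(\alpha_*,\ (\alpha_*\otimes\varphi(1))\otimes\alpha_*^{*}\cong(\psi(1)\otimes\alpha_*)\otimes\alpha_*^{*}\cong\psi(1)\bigr)\colon\varphi(1)\to\psi(1)$ of $\mathcal G/\!/\mathcal G$. * For a 2-category $X$, $\mathrm{Fun}(X,\mathrm{Vect})$ is the category of 2-functors from $X$ to $\mathrm{Vect}$ viewed as a 2-category with only identity 2-morphisms, with 2-natural transformations as morphisms. * $\mathrm{Vect}_{\mathcal G}$ is the 2-group algebra: the Karoubi completion (closure under finite direct sums and splitting of idempotents) of the $\Bbbk$-linear category freely generated by $\mathcal G$, with the induced bilinear tensor product; $\mathfrak Z_1(\mathrm{Vect}_{\mathcal G})$ is its Drinfeld center, with objects $(V,\gamma_{-,V}\colon -\otimes V\cong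 V\otimes -)$ and braiding of $V$ and $W$ given by $\gamma_{V,W}$. For $V\in\mathrm{Vect}_{\mathcal G}$ let $\Phi(V)\colon\mathcal G\to\mathrm{Vect}$ be the functor $\mathrm{Hom}_{\mathrm{Vect}_{\mathcal G}}(I(-),V)$, where $I\colon\mathcal G\to\mathcal G^{\mathrm{op}}$ is the identity on objects and inverts morphisms. Then there are equivalences of categories $$E_1\colon \mathrm{Fun}(\mathcal G/\!/\mathcal G,\mathrm{Vect})\simeq\mathfrak Z_1(\mathrm{Vect}_{\mathcal G}),\qquad E_2\colon \mathrm{Fun}(\mathcal G/\!/\mathcal G,\mathrm{Vect})\simeq\mathrm{Fun}(\mathrm L\mathcal G,\mathrm{Vect})$$ such that: 1. $E_1$ is compatible with the Fourier 2-transform: the restriction functor $\mathrm{Fun}(\mathcal G/\!/\mathcal G,\mathrm{Vect})\to\mathrm{Fun}(\mathcal G,\mathrm{Vect})$ along $\mathcal G\to\mathcal G/\!/\mathcal G$, with $\mathrm{Vect}$ included into all $\Bbbk$-vector spaces, is naturally isomorphic to $\Phi\circ U\circ E_1$, where $U\colon\mathfrak Z_1(\mathrm{Vect}_{\mathcal G})\to\mathrm{Vect}_{\mathcal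 G}$ is the forgetful functor. 2. $E_2$ is induced by evaluating loops at $1\in\mathbb Z$: there are isomorphisms $\theta_\varphi\colon E_2(F)(\varphi)\cong F(\varphi(1))$, natural in $F$, for all $\varphi\in\mathrm L\mathcal G$, with $F(\bar\alpha)\circ\theta_\varphi=\theta_\psi\circ E_2(F)(\alpha)$ for every 1-morphism $\alpha\colon\varphi\to\psi$ of $\mathrm L\mathcal G$. 3. $\mathrm{Fun}(\mathrm L\mathcal G,\mathrm{Vect})$ carries a braided monoidal structure for which $E_1\circ E_2^{-1}\colon\mathrm{Fun}(\mathrm L\mathcal G,\mathrm{Vect})\to\mathfrak Z_1(\mathrm{Vect}_{\mathcal G})$ is a braided monoidal equivalence. -/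

import Mathlib

open CategoryTheory MonoidalCategory

universe w v u

namespace TwoGroupFourier

/-! ### Linearization -/

section Linearization

variable (R : Type w) [CommRing R] {C : Type u} [Category.{v} C]

/-- The morphism `r • f` of the linearization of `C`, for a morphism `f` of `C`. -/
noncomputable def freeSingle {X Y : C} (f : X ⟶ Y) (r : R) : Free.of R X ⟶ Free.of R Y :=
  (Finsupp.single f r : (X ⟶ Y) →₀ R)

variable {R}

lemma free_induction {X Y : C} {P : (Free.of R X ⟶ Free.of R Y) → Prop}
    (f : Free.of R X ⟶ Free.of R Y)
    (zero : P 0) (add : ∀ f g, P f → P g → P (f + g))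
    (single : ∀ (a : X ⟶ Y) (r : R), P (freeSingle R a r)) : P f :=
  Finsupp.induction_linear (motive := P) f zero add single

lemma freeSingle_comp {X Y Z : C} (f : X ⟶ Y) (g : Y ⟶ Z) (r s : R) :
    freeSingle R f r ≫ freeSingle R g s = freeSingle R (f ≫ g) (r * s) :=
  Free.single_comp_single R C f g r s

lemma freeSingle_id (X : C) : freeSingle R (𝟙 X) 1 = 𝟙 (Free.of R X) := rfl

/-- An isomorphism of `C` as an isomorphism of the linearization. -/
@[simps]
noncomputable def freeIso {X Y : C} (e : X ≅ Y) : Free.of R X ≅ Free.of R Y where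
  hom := freeSingle R e.hom 1
  inv := freeSingle R e.inv 1
  hom_inv_id := by rw [freeSingle_comp]; simp [freeSingle_id]
  inv_hom_id := by rw [freeSingle_comp]; simp [freeSingle_id]

variable [MonoidalCategory C]

/-- The bilinear extension of the tensor product of morphisms to formal linear combinations. -/
noncomputable def freeTensor (X₁ Y₁ X₂ Y₂ : C) :
    ((X₁ ⟶ Y₁) →₀ R) →ₗ[R] ((X₂ ⟶ Y₂) →₀ R) →ₗ[R] ((X₁ ⊗ X₂ ⟶ Y₁ ⊗ Y₂) →₀ R) :=
  Finsupp.lift _ R _ fun a => Finsupp.lmapDomain R R fun b => a ⊗ₘ b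

/-- The tensor product of morphisms of the linearization. -/
noncomputable def freeTensorHom {X₁ Y₁ X₂ Y₂ : C} (f : Free.of R X₁ ⟶ Free.of R Y₁)
    (g : Free.of R X₂ ⟶ Free.of R Y₂) : Free.of R (X₁ ⊗ X₂) ⟶ Free.of R (Y₁ ⊗ Y₂) :=
  freeTensor X₁ Y₁ X₂ Y₂ f g

section

variable {X₁ Y₁ Z₁ X₂ Y₂ Z₂ X₃ Y₃ : C}

lemma freeTensorHom_single (a : X₁ ⟶ Y₁) (b : X₂ ⟶ Y₂) (r s : R) :
    freeTensorHom (freeSingle R a r) (freeSingle R b s) = freeSingle R (a ⊗ₘ b) (r * s) := by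
  change freeTensor X₁ Y₁ X₂ Y₂ (Finsupp.single a r) (Finsupp.single b s) =
    Finsupp.single (a ⊗ₘ b) (r * s)
  simp only [freeTensor, Finsupp.lift_apply, zero_smul, Finsupp.sum_single_index,
    LinearMap.smul_apply, Finsupp.lmapDomain_apply, Finsupp.mapDomain_single, Finsupp.smul_single,
    smul_eq_mul]

lemma freeTensorHom_add_left (f f' : Free.of R X₁ ⟶ Free.of R Y₁)
    (g : Free.of R X₂ ⟶ Free.of R Y₂) :
    freeTensorHom (f + f') g = freeTensorHom f g + freeTensorHom f' g :=
  LinearMap.map_add₂ (freeTensor X₁ Y₁ X₂ Y₂) f f' g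

lemma freeTensorHom_add_right (f : Free.of R X₁ ⟶ Free.of R Y₁)
    (g g' : Free.of R X₂ ⟶ Free.of R Y₂) :
    freeTensorHom f (g + g') = freeTensorHom f g + freeTensorHom f g' :=
  map_add (freeTensor X₁ Y₁ X₂ Y₂ f) g g'

lemma freeTensorHom_zero_left (g : Free.of R X₂ ⟶ Free.of R Y₂) :
    freeTensorHom (0 : Free.of R X₁ ⟶ Free.of R Y₁) g = 0 :=
  LinearMap.map_zero₂ (freeTensor X₁ Y₁ X₂ Y₂) g

lemma freeTensorHom_zero_right (f : Free.of R X₁ ⟶ Free.of R Y₁) :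
    freeTensorHom f (0 : Free.of R X₂ ⟶ Free.of R Y₂) = 0 :=
  map_zero (freeTensor X₁ Y₁ X₂ Y₂ f)

lemma freeTensorHom_comp (f₁ : Free.of R X₁ ⟶ Free.of R Y₁) (f₂ : Free.of R X₂ ⟶ Free.of R Y₂)
    (g₁ : Free.of R Y₁ ⟶ Free.of R Z₁) (g₂ : Free.of R Y₂ ⟶ Free.of R Z₂) :
    freeTensorHom f₁ f₂ ≫ freeTensorHom g₁ g₂ = freeTensorHom (f₁ ≫ g₁) (f₂ ≫ g₂) := by
  induction f₁ using free_induction with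
  | zero => simp [freeTensorHom_zero_left]
  | add f f' h h' => simp [freeTensorHom_add_left, h, h']
  | single a r =>
  induction f₂ using free_induction with
  | zero => simp [freeTensorHom_zero_right]
  | add f f' h h' => simp [freeTensorHom_add_right, h, h']
  | single b s =>
  induction g₁ using free_induction with
  | zero => simp [freeTensorHom_zero_left]
  | add f f' h h' => simp [freeTensorHom_add_left, h, h']
  | single c t =>
  induction g₂ using free_induction with
  | zero => simp [freeTensorHom_zero_right]
  | add f f' h h' => simp [freeTensorHom_add_right, h, h']
  | single d u =>
    simp only [freeTensorHom_single, freeSingle_comp, tensorHom_comp_tensorHom, mul_mul_mul_comm]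

lemma free_associator_naturality (f₁ : Free.of R X₁ ⟶ Free.of R Y₁)
    (f₂ : Free.of R X₂ ⟶ Free.of R Y₂) (f₃ : Free.of R X₃ ⟶ Free.of R Y₃) :
    freeTensorHom (freeTensorHom f₁ f₂) f₃ ≫ freeSingle R (α_ Y₁ Y₂ Y₃).hom 1 =
      freeSingle R (α_ X₁ X₂ X₃).hom 1 ≫ freeTensorHom f₁ (freeTensorHom f₂ f₃) := by
  induction f₁ using free_induction with
  | zero => simp [freeTensorHom_zero_left]
  | add f f' h h' => simp [freeTensorHom_add_left, h, h']
  | single a r =>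
  induction f₂ using free_induction with
  | zero => simp [freeTensorHom_zero_left, freeTensorHom_zero_right]
  | add f f' h h' => simp [freeTensorHom_add_left, freeTensorHom_add_right, h, h']
  | single b s =>
  induction f₃ using free_induction with
  | zero => simp [freeTensorHom_zero_right]
  | add f f' h h' => simp [freeTensorHom_add_right, h, h']
  | single c t =>
    simp only [freeTensorHom_single, freeSingle_comp, associator_naturality, mul_one, one_mul,
      mul_assoc]

lemma free_leftUnitor_naturality (f : Free.of R X₁ ⟶ Free.of R Y₁) :
    freeTensorHom (𝟙 (Free.of R (𝟙_ C))) f ≫ freeSingle R (λ_ Y₁).hom 1 =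
      freeSingle R (λ_ X₁).hom 1 ≫ f := by
  induction f using free_induction with
  | zero => simp [freeTensorHom_zero_right]
  | add f f' h h' => simp [freeTensorHom_add_right, h, h']
  | single a r =>
    rw [← freeSingle_id, freeTensorHom_single, freeSingle_comp, freeSingle_comp]
    simp

lemma free_rightUnitor_naturality (f : Free.of R X₁ ⟶ Free.of R Y₁) :
    freeTensorHom f (𝟙 (Free.of R (𝟙_ C))) ≫ freeSingle R (ρ_ Y₁).hom 1 =
      freeSingle R (ρ_ X₁).hom 1 ≫ f := by
  induction f using free_induction with
  | zero => simp [freeTensorHom_zero_left]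
  | add f f' h h' => simp [freeTensorHom_add_left, h, h']
  | single a r =>
    rw [← freeSingle_id, freeTensorHom_single, freeSingle_comp, freeSingle_comp]
    simp

lemma freeTensorHom_id (X Y : C) :
    freeTensorHom (𝟙 (Free.of R X)) (𝟙 (Free.of R Y)) = 𝟙 (Free.of R (X ⊗ Y)) := by
  rw [← freeSingle_id, ← freeSingle_id, freeTensorHom_single, id_tensorHom_id, mul_one,
    freeSingle_id]

end

lemma free_pentagon (W X Y Z : C) :
    freeTensorHom (freeSingle R (α_ W X Y).hom 1) (𝟙 (Free.of R Z)) ≫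
        freeSingle R (α_ W (X ⊗ Y) Z).hom 1 ≫
          freeTensorHom (𝟙 (Free.of R W)) (freeSingle R (α_ X Y Z).hom 1) =
      freeSingle R (α_ (W ⊗ X) Y Z).hom 1 ≫ freeSingle R (α_ W X (Y ⊗ Z)).hom 1 := by
  simp only [← freeSingle_id, freeTensorHom_single, freeSingle_comp]
  congr 1 <;> simp

lemma free_triangle (X Y : C) :
    freeSingle R (α_ X (𝟙_ C) Y).hom 1 ≫
        freeTensorHom (𝟙 (Free.of R X)) (freeSingle R (λ_ Y).hom 1) =
      freeTensorHom (freeSingle R (ρ_ X).hom 1) (𝟙 (Free.of R Y)) := by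
  simp only [← freeSingle_id, freeTensorHom_single, freeSingle_comp]
  congr 1 <;> simp

noncomputable instance freeMonoidalStruct : MonoidalCategoryStruct (Free R C) where
  tensorObj X Y := Free.of R (tensorObj (C := C) X Y)
  tensorHom {X₁ Y₁ X₂ Y₂} f g :=
    freeTensorHom (C := C) (X₁ := X₁) (Y₁ := Y₁) (X₂ := X₂) (Y₂ := Y₂) f g
  whiskerLeft X Y₁ Y₂ g :=
    freeTensorHom (C := C) (X₁ := X) (Y₁ := X) (X₂ := Y₁) (Y₂ := Y₂)
      (𝟙 (Free.of (C := C) R X)) g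
  whiskerRight {X₁ X₂} f Y :=
    freeTensorHom (C := C) (X₁ := X₁) (Y₁ := X₂) (X₂ := Y) (Y₂ := Y) f
      (𝟙 (Free.of (C := C) R Y))
  tensorUnit := Free.of R (𝟙_ C)
  associator X Y Z := freeIso (associator (C := C) X Y Z)
  leftUnitor X := freeIso (leftUnitor (C := C) X)
  rightUnitor X := freeIso (rightUnitor (C := C) X)

/-- The tensor product of a monoidal category extends bilinearly to its linearization. -/
noncomputable instance freeMonoidal : MonoidalCategory (Free R C) :=
  MonoidalCategory.ofTensorHom
    (id_tensorHom_id := fun X Y => freeTensorHom_id (C := C) X Y)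
    (id_tensorHom := fun _ _ _ _ => rfl)
    (tensorHom_id := fun _ _ => rfl)
    (tensorHom_comp_tensorHom := fun f₁ f₂ g₁ g₂ => freeTensorHom_comp (C := C) f₁ f₂ g₁ g₂)
    (associator_naturality := fun f₁ f₂ f₃ => free_associator_naturality (C := C) f₁ f₂ f₃)
    (leftUnitor_naturality := fun f => free_leftUnitor_naturality (C := C) f)
    (rightUnitor_naturality := fun f => free_rightUnitor_naturality (C := C) f)
    (pentagon := fun W X Y Z => free_pentagon (C := C) W X Y Z)
    (triangle := fun X Y => free_triangle (C := C) X Y)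

instance freeMonoidalPreadditive : MonoidalPreadditive (Free R C) where
  whiskerLeft_zero := freeTensorHom_zero_right (C := C) _
  zero_whiskerRight := freeTensorHom_zero_left (C := C) _
  whiskerLeft_add := fun f g => freeTensorHom_add_right (C := C) _ f g
  add_whiskerRight := fun f g => freeTensorHom_add_left (C := C) f g _

end Linearization
end TwoGroupFourier
namespace TwoGroupFourier

/-! ### Additive completion -/

section AdditiveCompletion

variable {C : Type u} [Category.{v} C] [Preadditive C]

open Classical in
/-- The monomial matrix with entries `f i` in the positions `(i, e i)` and zeros elsewhere. -/
noncomputable def matDiag {M N : Mat_ C} (e : M.ι ≃ N.ι) (f : ∀ i, M.X i ⟶ N.X (e i)) : M ⟶ N :=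
  fun i j => if h : e i = j then f i ≫ eqToHom (congrArg N.X h) else 0

section

variable {M N K L : Mat_ C}

lemma matDiag_apply_self (e : M.ι ≃ N.ι) (f : ∀ i, M.X i ⟶ N.X (e i)) (i : M.ι) :
    matDiag e f i (e i) = f i := by
  simp [matDiag]

lemma matDiag_apply_ne (e : M.ι ≃ N.ι) (f : ∀ i, M.X i ⟶ N.X (e i)) (i : M.ι) (j : N.ι)
    (h : e i ≠ j) : matDiag e f i j = 0 := by
  simp [matDiag, h]

lemma matDiag_comp_apply (e : M.ι ≃ N.ι) (f : ∀ i, M.X i ⟶ N.X (e i)) (A : N ⟶ K)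
    (i : M.ι) (k : K.ι) : (matDiag e f ≫ A) i k = f i ≫ A (e i) k := by
  rw [Mat_.comp_apply, Finset.sum_eq_single (e i)]
  · rw [matDiag_apply_self]
  · intro j _ hj
    rw [matDiag_apply_ne e f i j (Ne.symm hj), Limits.zero_comp]
  · simp

lemma comp_matDiag_apply (A : M ⟶ N) (e : N.ι ≃ K.ι) (f : ∀ i, N.X i ⟶ K.X (e i))
    (i : M.ι) (j : N.ι) : (A ≫ matDiag e f) i (e j) = A i j ≫ f j := by
  rw [Mat_.comp_apply, Finset.sum_eq_single j]
  · rw [matDiag_apply_self]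
  · intro j' _ hj
    rw [matDiag_apply_ne e f j' (e j) (fun h => hj (e.injective h)), Limits.comp_zero]
  · simp

lemma matDiag_ext {e e' : M.ι ≃ N.ι} {f : ∀ i, M.X i ⟶ N.X (e i)}
    {f' : ∀ i, M.X i ⟶ N.X (e' i)} (h : ∀ i, e i = e' i)
    (h' : ∀ i, f i ≫ eqToHom (congrArg N.X (h i)) = f' i) : matDiag e f = matDiag e' f' := by
  obtain rfl : e = e' := Equiv.ext h
  congr 1
  funext i
  simpa using h' i

lemma matDiag_comp (e : M.ι ≃ N.ι) (f : ∀ i, M.X i ⟶ N.X (e i)) (e' : N.ι ≃ K.ι)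
    (f' : ∀ i, N.X i ⟶ K.X (e' i)) :
    matDiag e f ≫ matDiag e' f' = matDiag (e.trans e') fun i => f i ≫ f' (e i) := by
  ext i k
  rw [matDiag_comp_apply]
  by_cases h : e' (e i) = k
  · subst h
    rw [matDiag_apply_self]
    exact (matDiag_apply_self (e.trans e') (fun i => f i ≫ f' (e i)) i).symm
  · rw [matDiag_apply_ne _ _ _ _ h, Limits.comp_zero]
    exact (matDiag_apply_ne (e.trans e') (fun i => f i ≫ f' (e i)) i k h).symm

lemma matDiag_id (M : Mat_ C) : matDiag (Equiv.refl M.ι) (fun i => 𝟙 (M.X i)) = 𝟙 M := by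
  ext i j
  by_cases h : i = j
  · subst h
    rw [Mat_.id_apply_self]
    exact matDiag_apply_self (Equiv.refl M.ι) (fun i => 𝟙 (M.X i)) i
  · rw [Mat_.id_apply_of_ne _ _ _ h]
    exact matDiag_apply_ne (Equiv.refl M.ι) (fun i => 𝟙 (M.X i)) i j h

/-- A reindexing together with isomorphisms of the entries is an isomorphism of tuples. -/
noncomputable def matIso (e : M.ι ≃ N.ι) (f : ∀ i, M.X i ≅ N.X (e i)) : M ≅ N where
  hom := matDiag e fun i => (f i).hom
  inv := matDiag e.symm fun j =>
    eqToHom (congrArg N.X (e.apply_symm_apply j).symm) ≫ (f (e.symm j)).inv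
  hom_inv_id := by
    rw [matDiag_comp, ← matDiag_id]
    refine matDiag_ext (fun i => by simp) fun i => ?_
    have key : ∀ (i' : M.ι) (h : i' = i), ((f i).hom ≫ eqToHom (by rw [h]) ≫ (f i').inv) ≫
        eqToHom (by rw [h]) = 𝟙 (M.X i) := by
      rintro _ rfl; simp
    exact key (e.symm (e i)) (by simp)
  inv_hom_id := by
    rw [matDiag_comp, ← matDiag_id]
    refine matDiag_ext (fun i => by simp) fun i => ?_
    have key : ((eqToHom (congrArg N.X (e.apply_symm_apply i).symm) ≫ (f (e.symm i)).inv) ≫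
        (f (e.symm i)).hom) ≫ eqToHom (congrArg N.X (e.apply_symm_apply i)) = 𝟙 (N.X i) := by
      simp
    exact key

end

variable [MonoidalCategory C]

/-- The tensor product of two finite tuples. -/
abbrev matTensorObj (M N : Mat_ C) : Mat_ C where
  ι := M.ι × N.ι
  X p := M.X p.1 ⊗ N.X p.2

/-- The Kronecker product of two matrices of morphisms. -/
def matTensorHom {M₁ N₁ M₂ N₂ : Mat_ C} (f : M₁ ⟶ N₁) (g : M₂ ⟶ N₂) :
    matTensorObj M₁ M₂ ⟶ matTensorObj N₁ N₂ :=
  fun p q => f p.1 q.1 ⊗ₘ g p.2 q.2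

lemma mat_aux₁ {C : Type u} [Category.{v} C] [MonoidalCategory C] {X Y : C} (f : X ⟶ Y) : (𝟙 (𝟙_ C) ⊗ₘ f) ≫ (λ_ Y).hom = (λ_ X).hom ≫ f := by
  simp

lemma mat_aux₂ {C : Type u} [Category.{v} C] [MonoidalCategory C] {X Y : C} (f : X ⟶ Y) : (f ⊗ₘ 𝟙 (𝟙_ C)) ≫ (ρ_ Y).hom = (ρ_ X).hom ≫ f := by
  simp

lemma mat_aux₃ {C : Type u} [Category.{v} C] [MonoidalCategory C] (W X Y Z : C) :
    ((α_ W X Y).hom ⊗ₘ 𝟙 Z) ≫ (α_ W (X ⊗ Y) Z).hom ≫ (𝟙 W ⊗ₘ (α_ X Y Z).hom) =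
      (α_ (W ⊗ X) Y Z).hom ≫ (α_ W X (Y ⊗ Z)).hom := by
  simp

lemma mat_aux₄ {C : Type u} [Category.{v} C] [MonoidalCategory C] (X Y : C) :
    (α_ X (𝟙_ C) Y).hom ≫ (𝟙 X ⊗ₘ (λ_ Y).hom) = (ρ_ X).hom ⊗ₘ 𝟙 Y := by
  simp

variable [MonoidalPreadditive C]

lemma matTensorHom_diag {M₁ N₁ M₂ N₂ : Mat_ C} (e₁ : M₁.ι ≃ N₁.ι) (e₂ : M₂.ι ≃ N₂.ι)
    (f₁ : ∀ i, M₁.X i ⟶ N₁.X (e₁ i)) (f₂ : ∀ i, M₂.X i ⟶ N₂.X (e₂ i)) :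
    matTensorHom (matDiag e₁ f₁) (matDiag e₂ f₂) =
      matDiag (M := matTensorObj M₁ M₂) (N := matTensorObj N₁ N₂) (e₁.prodCongr e₂)
        (fun p => f₁ p.1 ⊗ₘ f₂ p.2) := by
  ext ⟨i, j⟩ ⟨k, l⟩
  change matDiag e₁ f₁ i k ⊗ₘ matDiag e₂ f₂ j l = _
  by_cases h : e₁ i = k ∧ e₂ j = l
  · obtain ⟨rfl, rfl⟩ := h
    rw [matDiag_apply_self, matDiag_apply_self]
    exact (matDiag_apply_self (M := matTensorObj M₁ M₂) (N := matTensorObj N₁ N₂)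
      (e₁.prodCongr e₂) (fun p => f₁ p.1 ⊗ₘ f₂ p.2) (i, j)).symm
  · rw [matDiag_apply_ne (M := matTensorObj M₁ M₂) (N := matTensorObj N₁ N₂)
      (e₁.prodCongr e₂) (fun p => f₁ p.1 ⊗ₘ f₂ p.2) (i, j) (k, l)
      (fun h' => h ⟨congrArg Prod.fst h', congrArg Prod.snd h'⟩)]
    by_cases h₁ : e₁ i = k
    · rw [matDiag_apply_ne e₂ f₂ j l (fun h₂ => h ⟨h₁, h₂⟩)]
      exact MonoidalPreadditive.tensor_zero _
    · rw [matDiag_apply_ne e₁ f₁ i k h₁]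
      exact MonoidalPreadditive.zero_tensor _

lemma matTensorHom_id (M N : Mat_ C) :
    matTensorHom (𝟙 M) (𝟙 N) = 𝟙 (matTensorObj M N) := by
  rw [← matDiag_id, ← matDiag_id, ← matDiag_id]
  refine (matTensorHom_diag (Equiv.refl M.ι) (Equiv.refl N.ι) (fun i => 𝟙 (M.X i))
    (fun i => 𝟙 (N.X i))).trans ?_
  refine matDiag_ext (fun _ => rfl) fun p => ?_
  exact (Category.comp_id _).trans (id_tensorHom_id _ _)

lemma matTensorHom_comp {M₁ N₁ K₁ M₂ N₂ K₂ : Mat_ C} (f₁ : M₁ ⟶ N₁) (f₂ : M₂ ⟶ N₂)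
    (g₁ : N₁ ⟶ K₁) (g₂ : N₂ ⟶ K₂) :
    matTensorHom f₁ f₂ ≫ matTensorHom g₁ g₂ = matTensorHom (f₁ ≫ g₁) (f₂ ≫ g₂) := by
  ext ⟨i, j⟩ ⟨k, l⟩
  refine (Mat_.comp_apply _ _ _ _).trans ?_
  change ∑ p : N₁.ι × N₂.ι, (f₁ i p.1 ⊗ₘ f₂ j p.2) ≫ (g₁ p.1 k ⊗ₘ g₂ p.2 l) =
    (f₁ ≫ g₁) i k ⊗ₘ (f₂ ≫ g₂) j l
  rw [Mat_.comp_apply, Mat_.comp_apply, sum_tensor, Fintype.sum_prod_type]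
  simp [tensor_sum]

/-- The associator of the additive completion. -/
noncomputable def matAssociator (M N K : Mat_ C) :
    matTensorObj (matTensorObj M N) K ≅ matTensorObj M (matTensorObj N K) :=
  matIso (M := matTensorObj (matTensorObj M N) K) (N := matTensorObj M (matTensorObj N K))
    (Equiv.prodAssoc M.ι N.ι K.ι) fun p => α_ (M.X p.1.1) (N.X p.1.2) (K.X p.2)

/-- The left unitor of the additive completion. -/
noncomputable def matLeftUnitor (M : Mat_ C) :
    matTensorObj ((Mat_.embedding C).obj (𝟙_ C)) M ≅ M :=
  matIso (M := matTensorObj ((Mat_.embedding C).obj (𝟙_ C)) M) (N := M)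
    (Equiv.punitProd M.ι) fun p => λ_ (M.X p.2)

/-- The right unitor of the additive completion. -/
noncomputable def matRightUnitor (M : Mat_ C) :
    matTensorObj M ((Mat_.embedding C).obj (𝟙_ C)) ≅ M :=
  matIso (M := matTensorObj M ((Mat_.embedding C).obj (𝟙_ C))) (N := M)
    (Equiv.prodPUnit M.ι) fun p => ρ_ (M.X p.1)

lemma mat_pentagon (W X Y Z : Mat_ C) :
    matTensorHom (matAssociator W X Y).hom (𝟙 Z) ≫ (matAssociator W (matTensorObj X Y) Z).hom ≫
        matTensorHom (𝟙 W) (matAssociator X Y Z).hom =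
      (matAssociator (matTensorObj W X) Y Z).hom ≫ (matAssociator W X (matTensorObj Y Z)).hom := by
  rw [← matDiag_id, ← matDiag_id]
  refine (congrArg₂ (· ≫ ·) (matTensorHom_diag ..)
    (congrArg₂ (· ≫ ·) rfl (matTensorHom_diag ..))).trans ?_
  refine (congrArg₂ (· ≫ ·) rfl (matDiag_comp ..)).trans ?_
  refine (matDiag_comp ..).trans (Eq.trans ?_ (matDiag_comp ..).symm)
  refine matDiag_ext (fun _ => rfl) fun p => ?_
  exact (Category.comp_id _).trans
    (mat_aux₃ (W.X p.1.1.1) (X.X p.1.1.2) (Y.X p.1.2) (Z.X p.2))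

lemma mat_triangle (X Y : Mat_ C) :
    (matAssociator X ((Mat_.embedding C).obj (𝟙_ C)) Y).hom ≫
        matTensorHom (𝟙 X) (matLeftUnitor Y).hom =
      matTensorHom (matRightUnitor X).hom (𝟙 Y) := by
  rw [← matDiag_id, ← matDiag_id]
  refine (congrArg₂ (· ≫ ·) rfl (matTensorHom_diag ..)).trans ?_
  refine (matDiag_comp ..).trans (Eq.trans ?_ (matTensorHom_diag ..).symm)
  refine matDiag_ext (fun _ => rfl) fun p => ?_
  exact (Category.comp_id _).trans (mat_aux₄ (X.X p.1.1) (Y.X p.2))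

/-- The tensor product of a preadditive monoidal category extends to finite formal direct sums. -/
noncomputable instance matMonoidal : MonoidalCategory (Mat_ C) :=
  letI : MonoidalCategoryStruct (Mat_ C) :=
    { tensorObj := matTensorObj
      tensorHom := matTensorHom
      whiskerLeft := fun M _ _ g => matTensorHom (𝟙 M) g
      whiskerRight := fun f N => matTensorHom f (𝟙 N)
      tensorUnit := (Mat_.embedding C).obj (𝟙_ C)
      associator := matAssociator
      leftUnitor := matLeftUnitor
      rightUnitor := matRightUnitor }
  MonoidalCategory.ofTensorHom
    (id_tensorHom_id := matTensorHom_id)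
    (id_tensorHom := fun _ _ _ _ => rfl)
    (tensorHom_id := fun _ _ => rfl)
    (tensorHom_comp_tensorHom := matTensorHom_comp)
    (associator_naturality := by
      intro X₁ X₂ X₃ Y₁ Y₂ Y₃ f₁ f₂ f₃
      ext ⟨⟨i₁, i₂⟩, i₃⟩ ⟨j₁, j₂, j₃⟩
      refine (comp_matDiag_apply (N := matTensorObj (matTensorObj Y₁ Y₂) Y₃)
        (K := matTensorObj Y₁ (matTensorObj Y₂ Y₃)) _ (Equiv.prodAssoc Y₁.ι Y₂.ι Y₃.ι) _ _
        ((j₁, j₂), j₃)).trans ?_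
      refine Eq.trans ?_ (matDiag_comp_apply (M := matTensorObj (matTensorObj X₁ X₂) X₃)
        (N := matTensorObj X₁ (matTensorObj X₂ X₃)) (Equiv.prodAssoc X₁.ι X₂.ι X₃.ι) _ _ _ _).symm
      exact associator_naturality (f₁ i₁ j₁) (f₂ i₂ j₂) (f₃ i₃ j₃))
    (leftUnitor_naturality := by
      intro X Y f
      ext ⟨⟨⟩, i⟩ j
      refine (comp_matDiag_apply (N := matTensorObj ((Mat_.embedding C).obj (𝟙_ C)) Y)
        _ (Equiv.punitProd Y.ι) _ _ (PUnit.unit, j)).trans ?_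
      refine Eq.trans ?_ (matDiag_comp_apply
        (M := matTensorObj ((Mat_.embedding C).obj (𝟙_ C)) X) (Equiv.punitProd X.ι) _ _ _ _).symm
      change ((𝟙 ((Mat_.embedding C).obj (𝟙_ C)) : (Mat_.embedding C).obj (𝟙_ C) ⟶ _)
        PUnit.unit PUnit.unit ⊗ₘ f i j) ≫ (λ_ _).hom = (λ_ _).hom ≫ f i j
      refine (congrArg (fun t => (t ⊗ₘ f i j) ≫ (λ_ _).hom)
        (Mat_.id_apply_self ((Mat_.embedding C).obj (𝟙_ C)) PUnit.unit)).trans ?_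
      exact mat_aux₁ (f i j))
    (rightUnitor_naturality := by
      intro X Y f
      ext ⟨i, ⟨⟩⟩ j
      refine (comp_matDiag_apply (N := matTensorObj Y ((Mat_.embedding C).obj (𝟙_ C)))
        _ (Equiv.prodPUnit Y.ι) _ _ (j, PUnit.unit)).trans ?_
      refine Eq.trans ?_ (matDiag_comp_apply
        (M := matTensorObj X ((Mat_.embedding C).obj (𝟙_ C))) (Equiv.prodPUnit X.ι) _ _ _ _).symm
      change (f i j ⊗ₘ (𝟙 ((Mat_.embedding C).obj (𝟙_ C)) : (Mat_.embedding C).obj (𝟙_ C) ⟶ _)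
        PUnit.unit PUnit.unit) ≫ (ρ_ _).hom = (ρ_ _).hom ≫ f i j
      refine (congrArg (fun t => (f i j ⊗ₘ t) ≫ (ρ_ _).hom)
        (Mat_.id_apply_self ((Mat_.embedding C).obj (𝟙_ C)) PUnit.unit)).trans ?_
      exact mat_aux₂ (f i j))
    (pentagon := mat_pentagon)
    (triangle := mat_triangle)

end AdditiveCompletion
end TwoGroupFourier
namespace TwoGroupFourier

open Idempotents

/-! ### Idempotent completion -/

section IdempotentCompletion

variable {C : Type u} [Category.{v} C] [MonoidalCategory C]

lemma kar_associator_naturality {X₁ X₂ X₃ Y₁ Y₂ Y₃ : C} {p₁ : X₁ ⟶ X₁} {p₂ : X₂ ⟶ X₂}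
    {p₃ : X₃ ⟶ X₃} {q₁ : Y₁ ⟶ Y₁} {q₂ : Y₂ ⟶ Y₂} {q₃ : Y₃ ⟶ Y₃} {f₁ : X₁ ⟶ Y₁} {f₂ : X₂ ⟶ Y₂}
    {f₃ : X₃ ⟶ Y₃} (h₁ : f₁ ≫ q₁ = f₁) (h₂ : f₂ ≫ q₂ = f₂) (h₃ : f₃ ≫ q₃ = f₃)
    (k₁ : p₁ ≫ f₁ = f₁) (k₂ : p₂ ≫ f₂ = f₂) (k₃ : p₃ ≫ f₃ = f₃) :
    ((f₁ ⊗ₘ f₂) ⊗ₘ f₃) ≫ ((q₁ ⊗ₘ q₂) ⊗ₘ q₃) ≫ (α_ Y₁ Y₂ Y₃).hom =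
      (((p₁ ⊗ₘ p₂) ⊗ₘ p₃) ≫ (α_ X₁ X₂ X₃).hom) ≫ (f₁ ⊗ₘ (f₂ ⊗ₘ f₃)) := by
  rw [Category.assoc, ← associator_naturality, tensorHom_comp_tensorHom_assoc,
    tensorHom_comp_tensorHom_assoc, tensorHom_comp_tensorHom, tensorHom_comp_tensorHom,
    h₁, h₂, h₃, k₁, k₂, k₃]

lemma kar_pentagon {W X Y Z : C} {p : W ⟶ W} {q : X ⟶ X} {r : Y ⟶ Y} {s : Z ⟶ Z}
    (hp : p ≫ p = p) (hq : q ≫ q = q) (hr : r ≫ r = r) (hs : s ≫ s = s) :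
    ((((p ⊗ₘ q) ⊗ₘ r) ≫ (α_ _ _ _).hom) ⊗ₘ s) ≫
        (((p ⊗ₘ (q ⊗ₘ r)) ⊗ₘ s) ≫ (α_ _ _ _).hom) ≫
          (p ⊗ₘ (((q ⊗ₘ r) ⊗ₘ s) ≫ (α_ _ _ _).hom)) =
      ((((p ⊗ₘ q) ⊗ₘ r) ⊗ₘ s) ≫ (α_ _ _ _).hom) ≫
        ((p ⊗ₘ q) ⊗ₘ (r ⊗ₘ s)) ≫ (α_ _ _ _).hom := by
  have h₁ : (((p ⊗ₘ q) ⊗ₘ r) ≫ (α_ _ _ _).hom) ⊗ₘ s =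
      (((p ⊗ₘ q) ⊗ₘ r) ⊗ₘ s) ≫ ((α_ _ _ _).hom ⊗ₘ 𝟙 Z) := by
    rw [tensorHom_comp_tensorHom, Category.comp_id]
  have h₂ : p ⊗ₘ (((q ⊗ₘ r) ⊗ₘ s) ≫ (α_ _ _ _).hom) =
      (p ⊗ₘ ((q ⊗ₘ r) ⊗ₘ s)) ≫ (𝟙 W ⊗ₘ (α_ _ _ _).hom) := by
    rw [tensorHom_comp_tensorHom, Category.comp_id]
  have h₃ : ((α_ W X Y).hom ⊗ₘ 𝟙 Z) ≫ ((p ⊗ₘ (q ⊗ₘ r)) ⊗ₘ s) =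
      (((p ⊗ₘ q) ⊗ₘ r) ⊗ₘ s) ≫ ((α_ W X Y).hom ⊗ₘ 𝟙 Z) := by
    rw [tensorHom_comp_tensorHom, tensorHom_comp_tensorHom, associator_naturality,
      Category.comp_id, Category.id_comp]
  have h₄ : (((p ⊗ₘ q) ⊗ₘ r) ⊗ₘ s) ≫ (((p ⊗ₘ q) ⊗ₘ r) ⊗ₘ s) = ((p ⊗ₘ q) ⊗ₘ r) ⊗ₘ s := by
    simp only [tensorHom_comp_tensorHom, hp, hq, hr, hs]
  rw [h₁, h₂]
  simp only [Category.assoc]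
  rw [reassoc_of% h₃, reassoc_of% h₄, ← associator_naturality_assoc, ← associator_naturality_assoc,
    reassoc_of% h₃, reassoc_of% h₄, reassoc_of% h₄]
  simp

lemma kar_triangle {X Y : C} {p : X ⟶ X} {q : Y ⟶ Y} (hp : p ≫ p = p) (hq : q ≫ q = q) :
    (((p ⊗ₘ 𝟙 (𝟙_ C)) ⊗ₘ q) ≫ (α_ _ _ _).hom) ≫ (p ⊗ₘ ((𝟙 (𝟙_ C) ⊗ₘ q) ≫ (λ_ _).hom)) =
      ((p ⊗ₘ 𝟙 (𝟙_ C)) ≫ (ρ_ _).hom) ⊗ₘ q := by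
  have h₂ : p ⊗ₘ ((𝟙 (𝟙_ C) ⊗ₘ q) ≫ (λ_ _).hom) =
      (p ⊗ₘ (𝟙 (𝟙_ C) ⊗ₘ q)) ≫ (𝟙 X ⊗ₘ (λ_ _).hom) := by
    rw [tensorHom_comp_tensorHom, Category.comp_id]
  have h₁ : ((p ⊗ₘ 𝟙 (𝟙_ C)) ≫ (ρ_ _).hom) ⊗ₘ q =
      ((p ⊗ₘ 𝟙 (𝟙_ C)) ⊗ₘ q) ≫ ((ρ_ _).hom ⊗ₘ 𝟙 Y) := by
    rw [tensorHom_comp_tensorHom, Category.comp_id]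
  have h₄ : ((p ⊗ₘ 𝟙 (𝟙_ C)) ⊗ₘ q) ≫ ((p ⊗ₘ 𝟙 (𝟙_ C)) ⊗ₘ q) = (p ⊗ₘ 𝟙 (𝟙_ C)) ⊗ₘ q := by
    simp only [tensorHom_comp_tensorHom, hp, hq, Category.comp_id]
  rw [h₁, h₂, Category.assoc, ← associator_naturality_assoc, reassoc_of% h₄]
  simp

/-- The tensor product of two formal retracts. -/
@[simps]
def karTensorObj (P Q : Karoubi C) : Karoubi C where
  X := P.X ⊗ Q.X
  p := P.p ⊗ₘ Q.p
  idem := by rw [tensorHom_comp_tensorHom, P.idem, Q.idem]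

/-- The tensor product of morphisms of formal retracts. -/
@[simps]
def karTensorHom {P₁ Q₁ P₂ Q₂ : Karoubi C} (f : P₁ ⟶ Q₁) (g : P₂ ⟶ Q₂) :
    karTensorObj P₁ P₂ ⟶ karTensorObj Q₁ Q₂ where
  f := f.f ⊗ₘ g.f
  comm := by
    change (P₁.p ⊗ₘ P₂.p) ≫ (f.f ⊗ₘ g.f) ≫ (Q₁.p ⊗ₘ Q₂.p) = f.f ⊗ₘ g.f
    rw [tensorHom_comp_tensorHom, tensorHom_comp_tensorHom, f.comm, g.comm]

/-- An isomorphism of `C` that intertwines two idempotents induces an isomorphism of the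
formal retracts. -/
@[simps]
def karIso {P Q : Karoubi C} (e : P.X ≅ Q.X) (h : P.p ≫ e.hom = e.hom ≫ Q.p) : P ≅ Q where
  hom := ⟨P.p ≫ e.hom, by rw [Category.assoc, ← h]; simp⟩
  inv := ⟨e.inv ≫ P.p, by
    have h' : Q.p ≫ e.inv = e.inv ≫ P.p := by
      rw [Iso.eq_inv_comp, ← Category.assoc, ← h, Category.assoc, e.hom_inv_id, Category.comp_id]
    simp [reassoc_of% h']⟩
  hom_inv_id := by ext; simp
  inv_hom_id := by
    refine Karoubi.hom_ext _ _ ?_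
    change (e.inv ≫ P.p) ≫ P.p ≫ e.hom = Q.p
    rw [Category.assoc, P.idem_assoc, h, e.inv_hom_id_assoc]

/-- The tensor product of a monoidal category extends to its idempotent completion. -/
instance karMonoidal : MonoidalCategory (Karoubi C) :=
  letI : MonoidalCategoryStruct (Karoubi C) :=
    { tensorObj := karTensorObj
      tensorHom := karTensorHom
      whiskerLeft := fun M _ _ g => karTensorHom (𝟙 M) g
      whiskerRight := fun f N => karTensorHom f (𝟙 N)
      tensorUnit := (toKaroubi C).obj (𝟙_ C)
      associator := fun P Q R => karIso
        (P := karTensorObj (karTensorObj P Q) R) (Q := karTensorObj P (karTensorObj Q R))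
        (α_ P.X Q.X R.X) (associator_naturality P.p Q.p R.p)
      leftUnitor := fun P => karIso (P := karTensorObj ((toKaroubi C).obj (𝟙_ C)) P) (Q := P)
        (λ_ P.X) (by
          change (𝟙 (𝟙_ C) ⊗ₘ P.p) ≫ (λ_ P.X).hom = (λ_ P.X).hom ≫ P.p
          simp)
      rightUnitor := fun P => karIso (P := karTensorObj P ((toKaroubi C).obj (𝟙_ C))) (Q := P)
        (ρ_ P.X) (by
          change (P.p ⊗ₘ 𝟙 (𝟙_ C)) ≫ (ρ_ P.X).hom = (ρ_ P.X).hom ≫ P.p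
          simp) }
  MonoidalCategory.ofTensorHom
    (id_tensorHom_id := by intros; rfl)
    (id_tensorHom := fun _ _ _ _ => rfl)
    (tensorHom_id := fun _ _ => rfl)
    (tensorHom_comp_tensorHom := by
      intros
      exact Karoubi.hom_ext _ _ (tensorHom_comp_tensorHom _ _ _ _))
    (associator_naturality := by
      intro X₁ X₂ X₃ Y₁ Y₂ Y₃ f₁ f₂ f₃
      refine Karoubi.hom_ext _ _ ?_
      change ((f₁.f ⊗ₘ f₂.f) ⊗ₘ f₃.f) ≫ ((Y₁.p ⊗ₘ Y₂.p) ⊗ₘ Y₃.p) ≫ (α_ _ _ _).hom =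
        (((X₁.p ⊗ₘ X₂.p) ⊗ₘ X₃.p) ≫ (α_ _ _ _).hom) ≫ (f₁.f ⊗ₘ (f₂.f ⊗ₘ f₃.f))
      exact kar_associator_naturality (Karoubi.comp_p f₁) (Karoubi.comp_p f₂) (Karoubi.comp_p f₃)
        (Karoubi.p_comp f₁) (Karoubi.p_comp f₂) (Karoubi.p_comp f₃))
    (leftUnitor_naturality := by
      intro X Y f
      refine Karoubi.hom_ext _ _ ?_
      change (𝟙 (𝟙_ C) ⊗ₘ f.f) ≫ (𝟙 (𝟙_ C) ⊗ₘ Y.p) ≫ (λ_ _).hom =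
        ((𝟙 (𝟙_ C) ⊗ₘ X.p) ≫ (λ_ _).hom) ≫ f.f
      simp)
    (rightUnitor_naturality := by
      intro X Y f
      refine Karoubi.hom_ext _ _ ?_
      change (f.f ⊗ₘ 𝟙 (𝟙_ C)) ≫ (Y.p ⊗ₘ 𝟙 (𝟙_ C)) ≫ (ρ_ _).hom =
        ((X.p ⊗ₘ 𝟙 (𝟙_ C)) ≫ (ρ_ _).hom) ≫ f.f
      simp)
    (pentagon := by
      intro W X Y Z
      refine Karoubi.hom_ext _ _ ?_
      change ((((W.p ⊗ₘ X.p) ⊗ₘ Y.p) ≫ (α_ _ _ _).hom) ⊗ₘ Z.p) ≫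
        (((W.p ⊗ₘ (X.p ⊗ₘ Y.p)) ⊗ₘ Z.p) ≫ (α_ _ _ _).hom) ≫
          (W.p ⊗ₘ (((X.p ⊗ₘ Y.p) ⊗ₘ Z.p) ≫ (α_ _ _ _).hom)) =
        ((((W.p ⊗ₘ X.p) ⊗ₘ Y.p) ⊗ₘ Z.p) ≫ (α_ _ _ _).hom) ≫
          ((W.p ⊗ₘ X.p) ⊗ₘ (Y.p ⊗ₘ Z.p)) ≫ (α_ _ _ _).hom
      exact kar_pentagon W.idem X.idem Y.idem Z.idem)
    (triangle := by
      intro X Y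
      refine Karoubi.hom_ext _ _ ?_
      change (((X.p ⊗ₘ 𝟙 (𝟙_ C)) ⊗ₘ Y.p) ≫ (α_ _ _ _).hom) ≫
          (X.p ⊗ₘ ((𝟙 (𝟙_ C) ⊗ₘ Y.p) ≫ (λ_ _).hom)) =
        ((X.p ⊗ₘ 𝟙 (𝟙_ C)) ≫ (ρ_ _).hom) ⊗ₘ Y.p
      exact kar_triangle X.idem Y.idem)

end IdempotentCompletion

/-! ### Linear structures -/

section Linear

variable (R : Type w) [Semiring R] (C : Type u) [Category.{v} C] [Preadditive C] [Linear R C]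

instance matLinear : Linear R (Mat_ C) where
  homModule M N := inferInstanceAs (Module R (∀ i j, M.X i ⟶ N.X j))
  smul_comp := by
    intro M N K r f g
    ext i k
    change ∑ j, (r • f i j) ≫ g j k = r • ∑ j, f i j ≫ g j k
    simp [Finset.smul_sum]
  comp_smul := by
    intro M N K f r g
    ext i k
    change ∑ j, f i j ≫ (r • g j k) = r • ∑ j, f i j ≫ g j k
    simp [Finset.smul_sum]

instance karSMul (P Q : Karoubi C) : SMul R (P ⟶ Q) where
  smul r f := ⟨r • f.f, by simp⟩

instance karModule (P Q : Karoubi C) : Module R (P ⟶ Q) :=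
  Function.Injective.module R (Karoubi.inclusionHom P Q)
    (fun _ _ h => Karoubi.hom_ext _ _ h) (fun _ _ => rfl)

instance karLinear : Linear R (Karoubi C) where
  smul_comp := by
    intro P Q S r f g
    exact Karoubi.hom_ext _ _ (Linear.smul_comp _ _ _ r f.f g.f)
  comp_smul := by
    intro P Q S f r g
    exact Karoubi.hom_ext _ _ (Linear.comp_smul _ _ _ f.f r g.f)

end Linear
end TwoGroupFourier
namespace TwoGroupFourier

open ExactPairing

/-! ### 2-groups -/

/-- A groupoid with a monoidal structure is a 2-group if every object is invertible. -/
class TwoGroup (G : Type u) [Groupoid.{v} G] [MonoidalCategory G] : Prop where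
  exists_inverse : ∀ x : G, ∃ y : G, Nonempty (x ⊗ y ≅ 𝟙_ G) ∧ Nonempty (y ⊗ x ≅ 𝟙_ G)

/-- A 2-group is finite if the set of isomorphism classes of objects and the set of
endomorphisms of the tensor unit are finite. -/
class TwoGroup.IsFinite (G : Type u) [Groupoid.{v} G] [MonoidalCategory G] : Prop where
  finite_pi₁ : Finite (Quotient (isIsomorphicSetoid G))
  finite_pi₂ : Finite (𝟙_ G ⟶ 𝟙_ G)

lemma exists_adjunction {B : Type*} [Bicategory B] {a b : B} {f : a ⟶ b} {g : b ⟶ a}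
    (e : 𝟙 a ≅ f ≫ g) (e' : g ≫ f ≅ 𝟙 b) : ∃ (η : 𝟙 a ⟶ f ≫ g) (ε : g ≫ f ⟶ 𝟙 b),
      Bicategory.whiskerLeft g η ≫ (Bicategory.associator g f g).inv ≫ Bicategory.whiskerRight ε g =
        (Bicategory.rightUnitor g).hom ≫ (Bicategory.leftUnitor g).inv ∧
      Bicategory.whiskerRight η f ≫ (Bicategory.associator f g f).hom ≫ Bicategory.whiskerLeft f ε =
        (Bicategory.leftUnitor f).hom ≫ (Bicategory.rightUnitor f).inv := by
  let E := Bicategory.Equivalence.mkOfAdjointifyCounit e e'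
  refine ⟨E.unit.hom, E.counit.hom, Eq.trans ?_ E.right_triangle_hom,
    Eq.trans ?_ E.left_triangle_hom⟩
  · simp only [Bicategory.rightZigzag]; bicategory
  · simp only [Bicategory.leftZigzag]; bicategory

/-- Inverse objects are dual objects. -/
lemma nonempty_exactPairing {C : Type u} [Category.{v} C] [MonoidalCategory C] {x y : C}
    (e : x ⊗ y ≅ 𝟙_ C) (e' : y ⊗ x ≅ 𝟙_ C) : Nonempty (ExactPairing x y) := by
  obtain ⟨η, ε, h₁, h₂⟩ := exists_adjunction (B := MonoidalSingleObj C)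
    (a := MonoidalSingleObj.star C) (b := MonoidalSingleObj.star C) (f := x) (g := y) e.symm e'
  exact ⟨⟨η, ε, h₁, h₂⟩⟩

variable {C : Type u} [Category.{v} C] [MonoidalCategory C]

lemma dual_hom_ext {X Y Z : C} [ExactPairing X Y] {f g : Y ⟶ Z}
    (h : η_ X Y ≫ X ◁ f = η_ X Y ≫ X ◁ g) : f = g := by
  have h' := congrArg (tensorLeftHomEquiv (𝟙_ C) X Y Z).symm h
  rw [tensorLeftHomEquiv_symm_coevaluation_comp_whiskerLeft,
    tensorLeftHomEquiv_symm_coevaluation_comp_whiskerLeft] at h'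
  exact (cancel_epi _).mp h'

lemma coevaluation_rightDualIso {X Y₁ Y₂ : C} (p₁ : ExactPairing X Y₁) (p₂ : ExactPairing X Y₂) :
    @coevaluation _ _ _ X Y₁ p₁ ≫ X ◁ (rightDualIso p₁ p₂).hom = @coevaluation _ _ _ X Y₂ p₂ := by
  have h := @coevaluation_comp_rightAdjointMate C _ _ X X ⟨Y₂⟩ ⟨Y₁⟩ (𝟙 X)
  rw [id_whiskerRight, Category.comp_id] at h
  exact h

namespace TwoGroup

variable {G : Type u} [Groupoid.{v} G] [MonoidalCategory G] [TwoGroup G]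

lemma exists_dual (g : G) : ∃ y : G, Nonempty (ExactPairing g y) := by
  obtain ⟨y, ⟨e⟩, ⟨e'⟩⟩ := exists_inverse g
  exact ⟨y, nonempty_exactPairing e e'⟩

/-- A chosen dual object `g*` of an object `g` of a 2-group. -/
noncomputable def dual (g : G) : G := (exists_dual g).choose

/-- The coevaluation `e ⟶ g ⊗ g*` and the evaluation `g* ⊗ g ⟶ e`. -/
noncomputable instance pairing (g : G) : ExactPairing g (dual g) :=
  (exists_dual g).choose_spec.some

/-- The inverse functor on morphisms: `a* : g* ⟶ h*` is the inverse of the dual (mate)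
`h* ⟶ g*` of `a : g ⟶ h`. -/
noncomputable def dualMap {g h : G} (a : g ⟶ h) : dual g ⟶ dual h :=
  Groupoid.inv (@rightAdjointMate G _ _ g h ⟨dual g⟩ ⟨dual h⟩ a)

/-- The canonical isomorphism `(g ⊗ h)* ≅ h* ⊗ g*`. -/
noncomputable def dualTensor (g h : G) : dual (g ⊗ h) ≅ dual h ⊗ dual g :=
  rightDualIso (pairing (g ⊗ h)) ExactPairing.tensor

variable (G) in
/-- The canonical isomorphism `e* ≅ e`. -/
noncomputable def dualUnit : dual (𝟙_ G) ≅ 𝟙_ G :=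
  rightDualIso (pairing (𝟙_ G)) exactPairingUnit


lemma coev_dualMap {g h : G} (a : g ⟶ h) :
    η_ g (dual g) ≫ a ▷ dual g ≫ h ◁ dualMap a = η_ h (dual h) := by
  have h₁ := @coevaluation_comp_rightAdjointMate G _ _ g h ⟨dual g⟩ ⟨dual h⟩ a
  have h₂ : @rightAdjointMate G _ _ g h ⟨dual g⟩ ⟨dual h⟩ a ≫ dualMap a = 𝟙 _ :=
    Groupoid.comp_inv _
  have h₃ := congrArg (· ≫ h ◁ dualMap a) h₁
  simp only [Category.assoc] at h₃
  refine h₃.symm.trans ?_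
  refine (congrArg (η_ h (dual h) ≫ ·) ((whiskerLeft_comp h _ _).symm.trans
    (congrArg (h ◁ ·) h₂))).trans ?_
  exact (congrArg (η_ h (dual h) ≫ ·) (MonoidalCategory.whiskerLeft_id h (dual h))).trans
    (Category.comp_id _)


lemma coev_dualTensor (g h : G) :
    η_ (g ⊗ h) (dual (g ⊗ h)) ≫ (g ⊗ h) ◁ (dualTensor g h).hom =
      η_ g (dual g) ⊗≫ (g ◁ η_ h (dual h)) ▷ dual g ⊗≫ 𝟙 _ :=
  coevaluation_rightDualIso _ _

variable (G) in

lemma coev_dualUnit :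
    η_ (𝟙_ G) (dual (𝟙_ G)) ≫ (𝟙_ G) ◁ (dualUnit G).hom = (ρ_ (𝟙_ G)).inv :=
  coevaluation_rightDualIso _ _

lemma dualMap_unique {g h : G} (a : g ⟶ h) (b : dual g ⟶ dual h)
    (hb : η_ g (dual g) ≫ a ▷ dual g ≫ h ◁ b = η_ h (dual h)) : b = dualMap a := by
  apply dual_hom_ext (X := g)
  rw [← cancel_mono (a ▷ dual h), Category.assoc, Category.assoc, whisker_exchange,
    whisker_exchange, hb, coev_dualMap]

lemma dualMap_id (g : G) : dualMap (𝟙 g) = 𝟙 (dual g) :=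
  (dualMap_unique _ _ (by simp)).symm

lemma dualMap_comp {g h k : G} (a : g ⟶ h) (b : h ⟶ k) :
    dualMap (a ≫ b) = dualMap a ≫ dualMap b := by
  refine (dualMap_unique _ _ ?_).symm
  rw [MonoidalCategory.whiskerLeft_comp, comp_whiskerRight, Category.assoc,
    ← whisker_exchange_assoc, reassoc_of% (coev_dualMap a), coev_dualMap]

lemma dual_hom_ext_of_hom {g h : G} (a : g ⟶ h) {Z : G} {f f' : dual g ⟶ Z}
    (w : η_ g (dual g) ≫ a ▷ dual g ≫ h ◁ f = η_ g (dual g) ≫ a ▷ dual g ≫ h ◁ f') :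
    f = f' := by
  apply dual_hom_ext (X := g)
  rw [← cancel_mono (a ▷ Z), Category.assoc, Category.assoc, whisker_exchange,
    whisker_exchange, w]

lemma dualTensor_naturality {g g' h h' : G} (a : g ⟶ g') (b : h ⟶ h') :
    dualMap (a ⊗ₘ b) ≫ (dualTensor g' h').hom =
      (dualTensor g h).hom ≫ (dualMap b ⊗ₘ dualMap a) := by
  apply dual_hom_ext_of_hom (a ⊗ₘ b)
  have hb := coev_dualMap b
  have ha := coev_dualMap a
  calc
    _ = η_ (g' ⊗ h') (dual (g' ⊗ h')) ≫ (g' ⊗ h') ◁ (dualTensor g' h').hom := by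
      rw [MonoidalCategory.whiskerLeft_comp, reassoc_of% (coev_dualMap (a ⊗ₘ b))]
    _ = η_ g' (dual g') ⊗≫ (g' ◁ η_ h' (dual h')) ▷ dual g' ⊗≫ 𝟙 _ := coev_dualTensor _ _
    _ = (η_ g (dual g) ≫ a ▷ dual g ≫ g' ◁ dualMap a) ⊗≫
          (g' ◁ η_ h' (dual h')) ▷ dual g' ⊗≫ 𝟙 _ := by rw [ha]
    _ = η_ g (dual g) ⊗≫ a ▷ dual g ⊗≫
          ((g' ⊗ 𝟙_ G) ◁ dualMap a ≫ (g' ◁ η_ h' (dual h')) ▷ dual g') ⊗≫ 𝟙 _ := by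
      monoidal
    _ = η_ g (dual g) ⊗≫ (a ▷ 𝟙_ G ≫ g' ◁ η_ h' (dual h')) ▷ dual g ⊗≫
          (g' ⊗ (h' ⊗ dual h')) ◁ dualMap a ⊗≫ 𝟙 _ := by
      rw [whisker_exchange]; monoidal
    _ = η_ g (dual g) ⊗≫ (g ◁ η_ h' (dual h')) ▷ dual g ⊗≫ a ▷ (h' ⊗ dual h') ▷ dual g ⊗≫
          (g' ⊗ (h' ⊗ dual h')) ◁ dualMap a ⊗≫ 𝟙 _ := by
      rw [← whisker_exchange]; monoidal
    _ = η_ g (dual g) ⊗≫ (g ◁ (η_ h (dual h) ≫ b ▷ dual h ≫ h' ◁ dualMap b)) ▷ dual g ⊗≫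
          a ▷ (h' ⊗ dual h') ▷ dual g ⊗≫
          (g' ⊗ (h' ⊗ dual h')) ◁ dualMap a ⊗≫ 𝟙 _ := by
      rw [hb]
    _ = η_ g (dual g) ⊗≫ (g ◁ (η_ h (dual h) ≫ b ▷ dual h)) ▷ dual g ⊗≫
          (g ◁ (h' ◁ dualMap b) ≫ a ▷ (h' ⊗ dual h')) ▷ dual g ⊗≫
          (g' ⊗ (h' ⊗ dual h')) ◁ dualMap a ⊗≫ 𝟙 _ := by
      monoidal
    _ = (η_ g (dual g) ⊗≫ (g ◁ η_ h (dual h)) ▷ dual g ⊗≫ 𝟙 _) ≫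
          (a ⊗ₘ b) ▷ _ ≫ (g' ⊗ h') ◁ (dualMap b ⊗ₘ dualMap a) := by
      rw [whisker_exchange, MonoidalCategory.tensorHom_def' a b,
        MonoidalCategory.tensorHom_def (dualMap b) (dualMap a)]; monoidal
    _ = (η_ (g ⊗ h) (dual (g ⊗ h)) ≫ (g ⊗ h) ◁ (dualTensor g h).hom) ≫
          (a ⊗ₘ b) ▷ _ ≫ (g' ⊗ h') ◁ (dualMap b ⊗ₘ dualMap a) := by
      rw [coev_dualTensor]
    _ = _ := by
      rw [MonoidalCategory.whiskerLeft_comp, Category.assoc, ← whisker_exchange_assoc]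

lemma dualMap_associator (g h k : G) :
    dualMap (α_ g h k).hom ≫ (dualTensor g (h ⊗ k)).hom ≫ (dualTensor h k).hom ▷ dual g =
      (dualTensor (g ⊗ h) k).hom ≫ dual k ◁ (dualTensor g h).hom ≫
        (α_ (dual k) (dual h) (dual g)).inv := by
  apply dual_hom_ext_of_hom (α_ g h k).hom
  have h₁ := coev_dualTensor h k
  calc
    _ = (η_ (g ⊗ h ⊗ k) (dual (g ⊗ h ⊗ k)) ≫ (g ⊗ h ⊗ k) ◁ (dualTensor g (h ⊗ k)).hom) ≫
          (g ⊗ h ⊗ k) ◁ ((dualTensor h k).hom ▷ dual g) := by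
      rw [MonoidalCategory.whiskerLeft_comp, reassoc_of% (coev_dualMap (α_ g h k).hom),
        MonoidalCategory.whiskerLeft_comp, Category.assoc]
    _ = η_ g (dual g) ⊗≫ (g ◁ (η_ (h ⊗ k) (dual (h ⊗ k)) ≫
          (h ⊗ k) ◁ (dualTensor h k).hom)) ▷ dual g ⊗≫
          𝟙 ((g ⊗ h ⊗ k) ⊗ (dual k ⊗ dual h) ⊗ dual g) := by
      rw [coev_dualTensor]; monoidal
    _ = (η_ g (dual g) ⊗≫ (g ◁ η_ h (dual h)) ▷ dual g ⊗≫
            𝟙 ((g ⊗ h) ⊗ (dual h ⊗ dual g))) ⊗≫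
          ((g ⊗ h) ◁ η_ k (dual k)) ▷ (dual h ⊗ dual g) ⊗≫
          𝟙 ((g ⊗ h ⊗ k) ⊗ (dual k ⊗ dual h) ⊗ dual g) := by
      rw [h₁]; monoidal
    _ = η_ (g ⊗ h) (dual (g ⊗ h)) ⊗≫ (((g ⊗ h) ⊗ 𝟙_ G) ◁ (dualTensor g h).hom ≫
          ((g ⊗ h) ◁ η_ k (dual k)) ▷ (dual h ⊗ dual g)) ⊗≫
          𝟙 ((g ⊗ h ⊗ k) ⊗ (dual k ⊗ dual h) ⊗ dual g) := by
      rw [← coev_dualTensor g h]; monoidal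
    _ = (η_ (g ⊗ h) (dual (g ⊗ h)) ⊗≫ ((g ⊗ h) ◁ η_ k (dual k)) ▷ dual (g ⊗ h) ⊗≫
            𝟙 (((g ⊗ h) ⊗ k) ⊗ dual k ⊗ dual (g ⊗ h))) ⊗≫
          ((g ⊗ h) ⊗ k ⊗ dual k) ◁ (dualTensor g h).hom ⊗≫ 𝟙 _ := by
      rw [whisker_exchange]; monoidal
    _ = (η_ ((g ⊗ h) ⊗ k) (dual ((g ⊗ h) ⊗ k)) ≫
          ((g ⊗ h) ⊗ k) ◁ (dualTensor (g ⊗ h) k).hom) ⊗≫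
          ((g ⊗ h) ⊗ k ⊗ dual k) ◁ (dualTensor g h).hom ⊗≫ 𝟙 _ := by
      rw [coev_dualTensor (g ⊗ h) k]; monoidal
    _ = (η_ ((g ⊗ h) ⊗ k) (dual ((g ⊗ h) ⊗ k)) ≫
          ((g ⊗ h) ⊗ k) ◁ (dualTensor (g ⊗ h) k).hom) ≫ (α_ g h k).hom ▷ _ ≫
          (g ⊗ h ⊗ k) ◁ (dual k ◁ (dualTensor g h).hom ≫
            (α_ (dual k) (dual h) (dual g)).inv) := by
      monoidal
    _ = _ := by
      rw [Category.assoc, whisker_exchange_assoc, ← MonoidalCategory.whiskerLeft_comp]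

lemma dualMap_leftUnitor (g : G) :
    dualMap (λ_ g).hom =
      (dualTensor (𝟙_ G) g).hom ≫ dual g ◁ (dualUnit G).hom ≫ (ρ_ (dual g)).hom := by
  refine (dualMap_unique _ _ ?_).symm
  calc
    _ = (η_ (𝟙_ G ⊗ g) (dual (𝟙_ G ⊗ g)) ≫ (𝟙_ G ⊗ g) ◁ (dualTensor (𝟙_ G) g).hom) ≫
          (λ_ g).hom ▷ _ ≫ g ◁ (dual g ◁ (dualUnit G).hom ≫ (ρ_ (dual g)).hom) := by
      rw [Category.assoc, whisker_exchange_assoc, ← MonoidalCategory.whiskerLeft_comp]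
    _ = η_ (𝟙_ G) (dual (𝟙_ G)) ⊗≫ ((𝟙_ G ◁ η_ g (dual g)) ▷ dual (𝟙_ G) ≫
          (𝟙_ G ⊗ g ⊗ dual g) ◁ (dualUnit G).hom) ⊗≫ 𝟙 _ := by
      rw [coev_dualTensor]; monoidal
    _ = (η_ (𝟙_ G) (dual (𝟙_ G)) ≫ 𝟙_ G ◁ (dualUnit G).hom) ⊗≫ η_ g (dual g) ⊗≫ 𝟙 _ := by
      rw [← whisker_exchange]; monoidal
    _ = _ := by
      rw [coev_dualUnit]; monoidal

lemma dualMap_rightUnitor (g : G) :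
    dualMap (ρ_ g).hom =
      (dualTensor g (𝟙_ G)).hom ≫ (dualUnit G).hom ▷ dual g ≫ (λ_ (dual g)).hom := by
  refine (dualMap_unique _ _ ?_).symm
  calc
    _ = (η_ (g ⊗ 𝟙_ G) (dual (g ⊗ 𝟙_ G)) ≫ (g ⊗ 𝟙_ G) ◁ (dualTensor g (𝟙_ G)).hom) ≫
          (ρ_ g).hom ▷ _ ≫ g ◁ ((dualUnit G).hom ▷ dual g ≫ (λ_ (dual g)).hom) := by
      rw [Category.assoc, whisker_exchange_assoc, ← MonoidalCategory.whiskerLeft_comp]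
    _ = η_ g (dual g) ⊗≫
          (g ◁ (η_ (𝟙_ G) (dual (𝟙_ G)) ≫ 𝟙_ G ◁ (dualUnit G).hom)) ▷ dual g ⊗≫ 𝟙 _ := by
      rw [coev_dualTensor]; monoidal
    _ = _ := by
      rw [coev_dualUnit]; monoidal

end TwoGroup
end TwoGroupFourier
namespace TwoGroupFourier

open TwoGroup

/-! ### The conjugation action -/

section Conjugation

variable {G : Type u} [Groupoid.{v} G] [MonoidalCategory G] [TwoGroup G]

/-- The isomorphism `(g ⊗ h) ⊙ x ≅ g ⊙ (h ⊙ x)`, where `g ⊙ x = (g ⊗ x) ⊗ g*`. -/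
noncomputable def conjAssoc (g h x : G) :
    ((g ⊗ h) ⊗ x) ⊗ dual (g ⊗ h) ≅ (g ⊗ ((h ⊗ x) ⊗ dual h)) ⊗ dual g :=
  whiskerLeftIso ((g ⊗ h) ⊗ x) (dualTensor g h) ≪⊗≫ Iso.refl _

/-- The isomorphism `e ⊙ x ≅ x`, where `g ⊙ x = (g ⊗ x) ⊗ g*`. -/
noncomputable def conjUnit (x : G) : (𝟙_ G ⊗ x) ⊗ dual (𝟙_ G) ≅ x :=
  whiskerLeftIso (𝟙_ G ⊗ x) (dualUnit G) ≪⊗≫ Iso.refl _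

lemma conjAssoc_hom (g h x : G) :
    (conjAssoc g h x).hom = ((g ⊗ h) ⊗ x) ◁ (dualTensor g h).hom ⊗≫ 𝟙 _ := rfl

lemma conjUnit_hom (x : G) :
    (conjUnit x).hom = (𝟙_ G ⊗ x) ◁ (dualUnit G).hom ⊗≫ 𝟙 _ := rfl

lemma conjAssoc_naturality {g g' h h' x x' : G} (a : g ⟶ g') (b : h ⟶ h') (f : x ⟶ x') :
    (((a ⊗ₘ b) ⊗ₘ f) ⊗ₘ dualMap (a ⊗ₘ b)) ≫ (conjAssoc g' h' x').hom =
      (conjAssoc g h x).hom ≫ ((a ⊗ₘ ((b ⊗ₘ f) ⊗ₘ dualMap b)) ⊗ₘ dualMap a) := by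
  rw [conjAssoc_hom, conjAssoc_hom]
  calc
    _ = (((a ⊗ₘ b) ⊗ₘ f) ⊗ₘ (dualMap (a ⊗ₘ b) ≫ (dualTensor g' h').hom)) ⊗≫
          𝟙 ((g' ⊗ ((h' ⊗ x') ⊗ dual h')) ⊗ dual g') := by
      monoidal
    _ = (((g ⊗ h) ⊗ x) ◁ (dualTensor g h).hom ≫
          (((a ⊗ₘ b) ⊗ₘ f) ⊗ₘ (dualMap b ⊗ₘ dualMap a))) ⊗≫
          𝟙 ((g' ⊗ ((h' ⊗ x') ⊗ dual h')) ⊗ dual g') := by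
      rw [dualTensor_naturality, ← id_tensorHom, tensorHom_comp_tensorHom, Category.id_comp]
    _ = _ := by
      monoidal

lemma conjUnit_naturality {x x' : G} (f : x ⟶ x') :
    (conjUnit x).hom ≫ f = (𝟙_ G ◁ f) ▷ dual (𝟙_ G) ≫ (conjUnit x').hom := by
  rw [conjUnit_hom, conjUnit_hom]
  calc
    _ = ((𝟙_ G ⊗ x) ◁ (dualUnit G).hom ≫ (𝟙_ G ◁ f) ▷ 𝟙_ G) ⊗≫ 𝟙 x' := by monoidal
    _ = _ := by rw [whisker_exchange]; monoidal

lemma conj_associator (g h k x : G) :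
    (((α_ g h k).hom ▷ x) ⊗ₘ dualMap (α_ g h k).hom) ≫ (conjAssoc g (h ⊗ k) x).hom ≫
        (g ◁ (conjAssoc h k x).hom) ▷ dual g =
      (conjAssoc (g ⊗ h) k x).hom ≫ (conjAssoc g h ((k ⊗ x) ⊗ dual k)).hom := by
  simp only [conjAssoc_hom]
  calc
    _ = 𝟙 _ ⊗≫ (g ⊗ h ⊗ k ⊗ x) ◁ (dualMap (α_ g h k).hom ≫ (dualTensor g (h ⊗ k)).hom ≫
          (dualTensor h k).hom ▷ dual g) ⊗≫
          𝟙 ((g ⊗ ((h ⊗ ((k ⊗ x) ⊗ dual k)) ⊗ dual h)) ⊗ dual g) := by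
      monoidal
    _ = _ := by
      rw [dualMap_associator]; monoidal

lemma conj_leftUnitor (g x : G) :
    ((λ_ g).hom ▷ x) ⊗ₘ dualMap (λ_ g).hom =
      (conjAssoc (𝟙_ G) g x).hom ≫ (conjUnit ((g ⊗ x) ⊗ dual g)).hom := by
  rw [dualMap_leftUnitor, conjAssoc_hom, conjUnit_hom]
  monoidal

lemma conj_rightUnitor (g x : G) :
    ((ρ_ g).hom ▷ x) ⊗ₘ dualMap (ρ_ g).hom =
      (conjAssoc g (𝟙_ G) x).hom ≫ (g ◁ (conjUnit x).hom) ▷ dual g := by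
  rw [dualMap_rightUnitor, conjAssoc_hom, conjUnit_hom]
  monoidal

variable (G) in
/-- The conjugation action of a 2-group on itself, `g ⊙ x = (g ⊗ x) ⊗ g*`. -/
noncomputable abbrev conjugation : MonoidalLeftAction G G where
  actionObj g x := (g ⊗ x) ⊗ dual g
  actionHomLeft a x := (a ▷ x) ⊗ₘ dualMap a
  actionHomRight g _ _ f := (g ◁ f) ▷ dual g
  actionHom a f := (a ⊗ₘ f) ⊗ₘ dualMap a
  actionAssocIso g h x := conjAssoc g h x
  actionUnitIso x := conjUnit x
  actionHom_def a f := by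
    rw [MonoidalCategory.tensorHom_def _ (dualMap a), MonoidalCategory.tensorHom_def a f,
      MonoidalCategory.tensorHom_def _ (dualMap a), Category.assoc, whisker_exchange,
      comp_whiskerRight, Category.assoc]
  actionHomRight_id c d := by simp
  id_actionHomLeft c d := by simp [dualMap_id]
  actionHom_comp f₁ f₂ g₁ g₂ := by simp [dualMap_comp]
  actionAssocIso_hom_naturality f g h := conjAssoc_naturality f g h
  actionUnitIso_hom_naturality f := conjUnit_naturality f
  whiskerLeft_actionHomLeft c _ _ f d := by
    rw [← Category.assoc, Iso.eq_comp_inv]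
    have h := conjAssoc_naturality (𝟙 c) f (𝟙 d)
    simpa only [dualMap_id, id_tensorHom, tensorHom_id] using h
  whiskerRight_actionHomLeft c f d := by
    rw [← Category.assoc, Iso.eq_comp_inv]
    have h := conjAssoc_naturality f (𝟙 c) (𝟙 d)
    simpa only [dualMap_id, id_tensorHom, tensorHom_id, id_whiskerRight] using h
  associator_actionHom g h k x := conj_associator g h k x
  leftUnitor_actionHom g x := conj_leftUnitor g x
  rightUnitor_actionHom g x := conj_rightUnitor g x

variable (G) in
/-- A copy of the category `G`, on which the 2-group `G` acts by conjugation. -/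
def Conj : Type u := G

instance : Groupoid.{v} (Conj G) := inferInstanceAs (Groupoid.{v} G)

noncomputable instance : MonoidalLeftAction G (Conj G) := conjugation G

end Conjugation

end TwoGroupFourier
namespace TwoGroupFourier

/-! ### Homotopy quotients -/

section HomotopyQuotient

open MonoidalLeftAction

/-- The homotopy quotient `C // M` of an action of a monoidal category `M` on a category `C`. Its
objects are the objects of `C`. -/
@[ext]
structure HomotopyQuotient (M C : Type u) : Type u where
  /-- The underlying object. -/
  as : C

variable {M : Type u} [Category.{v} M] [MonoidalCategory M]
  {C : Type u} [Category.{v} C] [MonoidalLeftAction M C]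

namespace HomotopyQuotient

/-- A 1-morphism `x ⟶ y` in `C // M`: an object `g` of `M` and a morphism `g ⊙ x ⟶ y` of `C`. -/
structure Hom (x y : HomotopyQuotient M C) : Type (max u v) where
  /-- The object of `M`. -/
  obj : M
  /-- The morphism of `C`. -/
  hom : obj ⊙ₗ x.as ⟶ y.as

instance : CategoryStruct (HomotopyQuotient M C) where
  Hom x y := Hom x y
  id x := ⟨𝟙_ M, (λₗ x.as).hom⟩
  comp f g := ⟨g.obj ⊗ f.obj, (αₗ g.obj f.obj _).hom ≫ g.obj ⊴ₗ f.hom ≫ g.hom⟩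

/-- A 2-morphism `(g, r) ⟶ (h, s)` in `C // M`: a morphism `a : g ⟶ h` of `M` with
`(a ⊙ x) ≫ s = r`. -/
@[ext]
structure Hom₂ {x y : HomotopyQuotient M C} (p q : x ⟶ y) : Type v where
  /-- The morphism of `M`. -/
  hom : p.obj ⟶ q.obj
  /-- The compatibility. -/
  w : hom ⊵ₗ x.as ≫ q.hom = p.hom

instance (x y : HomotopyQuotient M C) : Category.{v} (x ⟶ y) where
  Hom p q := Hom₂ p q
  id p := ⟨𝟙 p.obj, by simp⟩
  comp a b := ⟨a.hom ≫ b.hom, by simp [b.w, a.w]⟩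

@[ext]
lemma hom₂_ext {x y : HomotopyQuotient M C} {p q : x ⟶ y} {a b : p ⟶ q} (h : a.hom = b.hom) :
    a = b := Hom₂.ext h

@[simp] lemma id_obj (x : HomotopyQuotient M C) : (𝟙 x : x ⟶ x).obj = 𝟙_ M := rfl
@[simp] lemma id_hom (x : HomotopyQuotient M C) : (𝟙 x : x ⟶ x).hom = (λₗ x.as).hom := rfl
@[simp] lemma comp_obj {x y z : HomotopyQuotient M C} (f : x ⟶ y) (g : y ⟶ z) :
    (f ≫ g).obj = g.obj ⊗ f.obj := rfl
@[simp] lemma comp_hom {x y z : HomotopyQuotient M C} (f : x ⟶ y) (g : y ⟶ z) :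
    (f ≫ g).hom = (αₗ g.obj f.obj _).hom ≫ g.obj ⊴ₗ f.hom ≫ g.hom := rfl
@[simp] lemma id₂_hom {x y : HomotopyQuotient M C} (p : x ⟶ y) :
    (𝟙 p : p ⟶ p).hom = 𝟙 p.obj := rfl
@[simp] lemma comp₂_hom {x y : HomotopyQuotient M C} {p q r : x ⟶ y} (a : p ⟶ q) (b : q ⟶ r) :
    (a ≫ b).hom = a.hom ≫ b.hom := rfl

/-- Invertible 2-morphisms. -/
@[simps]
def isoMk {x y : HomotopyQuotient M C} {p q : x ⟶ y} (e : p.obj ≅ q.obj)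
    (w : e.hom ⊵ₗ x.as ≫ q.hom = p.hom) : p ≅ q where
  hom := ⟨e.hom, w⟩
  inv := ⟨e.inv, by rw [← w]; simp [← Category.assoc, ← comp_actionHomLeft]⟩

/-- Left whiskering in `C // M`. -/
@[simps]
def whiskerLeft {x y z : HomotopyQuotient M C} (f : x ⟶ y) {g h : y ⟶ z} (a : g ⟶ h) :
    f ≫ g ⟶ f ≫ h :=
  Hom₂.mk (a.hom ▷ f.obj) (by
    rw [comp_hom, comp_hom, ← a.w]
    simp [action_exchange_assoc])

/-- Right whiskering in `C // M`. -/
@[simps]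
def whiskerRight {x y z : HomotopyQuotient M C} {f g : x ⟶ y} (a : f ⟶ g) (h : y ⟶ z) :
    f ≫ h ⟶ g ≫ h :=
  Hom₂.mk (h.obj ◁ a.hom) (by
    rw [comp_hom, comp_hom, ← a.w]
    simp)

/-- The associator of `C // M`. -/
@[simps!]
def associator {x y z t : HomotopyQuotient M C} (f : x ⟶ y) (g : y ⟶ z) (h : z ⟶ t) :
    (f ≫ g) ≫ h ≅ f ≫ g ≫ h :=
  isoMk (α_ h.obj g.obj f.obj).symm (by
    have h₁ := associator_actionHom h.obj g.obj f.obj x.as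
    rw [← cancel_epi ((α_ h.obj g.obj f.obj).hom ⊵ₗ x.as)]
    simp only [Iso.symm_hom, comp_hom, comp_obj, hom_inv_actionHomLeft_assoc]
    simp [reassoc_of% h₁])

/-- The left unitor of `C // M`. -/
@[simps!]
def leftUnitor {x y : HomotopyQuotient M C} (f : x ⟶ y) : 𝟙 x ≫ f ≅ f :=
  isoMk (ρ_ f.obj) (by simp)

/-- The right unitor of `C // M`. -/
@[simps!]
def rightUnitor {x y : HomotopyQuotient M C} (f : x ⟶ y) : f ≫ 𝟙 y ≅ f :=
  isoMk (λ_ f.obj) (by simp)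

instance : Bicategory.{v} (HomotopyQuotient M C) where
  whiskerLeft f _ _ a := whiskerLeft f a
  whiskerRight a h := whiskerRight a h
  associator f g h := associator f g h
  leftUnitor f := leftUnitor f
  rightUnitor f := rightUnitor f
  whisker_exchange a b := by
    apply hom₂_ext
    exact (whisker_exchange _ _).symm

/-- A morphism `f` of `C` as the 1-morphism `(e, e ⊙ x ≅ x ⟶ y)`. -/
def ofHom {x y : C} (f : x ⟶ y) : (⟨x⟩ : HomotopyQuotient M C) ⟶ ⟨y⟩ :=
  ⟨𝟙_ M, (λₗ x).hom ≫ f⟩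

end HomotopyQuotient

end HomotopyQuotient

end TwoGroupFourier
namespace TwoGroupFourier

/-! ### 2-functors into a category -/

section TwoFun

variable (X : Type*) [Bicategory X] (D : Type*) [Category D]

/-- The category `Fun(X, D)` of 2-functors from a 2-category `X` to a category `D`, regarded as a
2-category with only identity 2-morphisms. -/
def TwoFun := Pseudofunctor X (LocallyDiscrete D)

namespace TwoFun

variable {X D}

lemma strongTrans_ext {F G : Pseudofunctor X (LocallyDiscrete D)}
    {α β : Pseudofunctor.StrongTrans F G} (h : ∀ x, α.app x = β.app x) : α = β := by
  obtain ⟨a, n, _, _, _⟩ := α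
  obtain ⟨b, m, _, _, _⟩ := β
  obtain rfl : a = b := funext h
  obtain rfl : @n = @m := by
    funext x y f
    exact Iso.ext (Subsingleton.elim _ _)
  rfl

instance : Category (TwoFun X D) where
  Hom F G := Pseudofunctor.StrongTrans F G
  id F := Pseudofunctor.StrongTrans.id F
  comp α β := Pseudofunctor.StrongTrans.vcomp α β
  id_comp _ := strongTrans_ext fun _ => Bicategory.Strict.id_comp _
  comp_id _ := strongTrans_ext fun _ => Bicategory.Strict.comp_id _
  assoc _ _ _ := strongTrans_ext fun _ => Bicategory.Strict.assoc _ _ _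

/-- The underlying pseudofunctor. -/
abbrev toPseudofunctor (F : TwoFun X D) : Pseudofunctor X (LocallyDiscrete D) := F

/-- The underlying pseudonatural transformation of a morphism of `Fun(X, D)`. -/
abbrev toStrongTrans {F G : TwoFun X D} (α : F ⟶ G) :
    Pseudofunctor.StrongTrans F.toPseudofunctor G.toPseudofunctor := α

/-- The object `F(x)` of `D`. -/
def obj (F : TwoFun X D) (x : X) : D := (F.toPseudofunctor.obj x).as

/-- The morphism `F(f) : F(x) ⟶ F(y)` of `D`. -/
def map (F : TwoFun X D) {x y : X} (f : x ⟶ y) : F.obj x ⟶ F.obj y :=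
  (F.toPseudofunctor.map f).as

/-- The component `F(x) ⟶ G(x)` of a morphism of `Fun(X, D)`. -/
def app {F G : TwoFun X D} (α : F ⟶ G) (x : X) : F.obj x ⟶ G.obj x :=
  ((toStrongTrans α).app x).as

lemma map_eq (F : TwoFun X D) {x y : X} {f g : x ⟶ y} (a : f ⟶ g) : F.map f = F.map g :=
  congrArg Discrete.as (LocallyDiscrete.eq_of_hom (F.toPseudofunctor.map₂ a))

lemma map_id (F : TwoFun X D) (x : X) : F.map (𝟙 x) = 𝟙 (F.obj x) :=
  congrArg Discrete.as (LocallyDiscrete.eq_of_hom (F.toPseudofunctor.mapId x).hom)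

lemma map_comp (F : TwoFun X D) {x y z : X} (f : x ⟶ y) (g : y ⟶ z) :
    F.map (f ≫ g) = F.map f ≫ F.map g :=
  congrArg Discrete.as (LocallyDiscrete.eq_of_hom (F.toPseudofunctor.mapComp f g).hom)

lemma naturality {F G : TwoFun X D} (α : F ⟶ G) {x y : X} (f : x ⟶ y) :
    F.map f ≫ app α y = app α x ≫ G.map f :=
  congrArg Discrete.as (LocallyDiscrete.eq_of_hom ((toStrongTrans α).naturality f).hom)

variable (D) in
/-- Evaluation at an object `x`, as a functor `Fun(X, D) ⥤ D`. -/
@[simps]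
def evalAt (x : X) : TwoFun X D ⥤ D where
  obj F := F.obj x
  map α := app α x
  map_id _ := rfl
  map_comp _ _ := rfl

variable (D) in
/-- Evaluation at a 1-morphism `f : x ⟶ y`, as a natural transformation. -/
@[simps]
def evalMap {x y : X} (f : x ⟶ y) : evalAt D x ⟶ evalAt D y where
  app F := F.map f
  naturality _ _ α := (naturality α f).symm

end TwoFun

end TwoFun

namespace HomotopyQuotient

variable {M : Type u} [Category.{v} M] [MonoidalCategory M]
  {C : Type u} [Category.{v} C] [MonoidalLeftAction M C]

/-- The 2-morphism from the identity to the 1-morphism of an identity. -/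
def ofHomId (x : C) : 𝟙 (⟨x⟩ : HomotopyQuotient M C) ⟶ ofHom (𝟙 x) :=
  Hom₂.mk (𝟙 (𝟙_ M)) (by simp [ofHom])

/-- The 2-morphism comparing a composite with the 1-morphism of a composite. -/
def ofHomComp {x y z : C} (f : x ⟶ y) (g : y ⟶ z) :
    (ofHom f ≫ ofHom g : (⟨x⟩ : HomotopyQuotient M C) ⟶ ⟨z⟩) ⟶ ofHom (f ≫ g) :=
  Hom₂.mk (λ_ (𝟙_ M)).hom (by simp [ofHom])

variable (M C) in
/-- Restriction of 2-functors along `C ⟶ C // M`. -/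
@[simps]
def restrict (D : Type*) [Category D] : TwoFun (HomotopyQuotient M C) D ⥤ C ⥤ D where
  obj F :=
    { obj := fun x => F.obj ⟨x⟩
      map := fun f => F.map (ofHom f)
      map_id := fun x => (F.map_eq (ofHomId x)).symm.trans (F.map_id _)
      map_comp := fun f g => (F.map_eq (ofHomComp f g)).symm.trans (F.map_comp _ _) }
  map α :=
    { app := fun x => TwoFun.app α ⟨x⟩
      naturality := fun _ _ f => TwoFun.naturality α (ofHom f) }
  map_id _ := rfl
  map_comp _ _ := rfl

end HomotopyQuotient

/-! ### The loop 2-groupoid -/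

section Loop

open TwoGroup

variable (G : Type u) [Groupoid.{v} G] [MonoidalCategory G]

/-- The delooping `BG`: one object, the objects of `G` as 1-morphisms, with composite of `g` and
then `h` equal to `h ⊗ g`, and the morphisms of `G` as 2-morphisms. -/
abbrev Deloop (A : Type*) [Category A] [MonoidalCategory A] := MonoidalSingleObj Aᴹᵒᵖ

/-- The loop 2-groupoid `LG = Fun(Bℤ, BG)` of 2-functors, 2-natural transformations and
modifications. -/
def Loop := Pseudofunctor (MonoidalSingleObj (Discrete ℤ)) (Deloop G)

open scoped Pseudofunctor.StrongTrans in
instance : Bicategory (Loop G) :=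
  inferInstanceAs (Bicategory (Pseudofunctor (MonoidalSingleObj (Discrete ℤ)) (Deloop G)))

variable {G}

/-- The underlying pseudofunctor of a loop. -/
abbrev Loop.toPseudofunctor (φ : Loop G) :
    Pseudofunctor (MonoidalSingleObj (Discrete ℤ)) (Deloop G) := φ

/-- The underlying pseudonatural transformation of a 1-morphism of loops. -/
abbrev Loop.toStrongTrans {φ ψ : Loop G} (α : φ ⟶ ψ) :
    Pseudofunctor.StrongTrans φ.toPseudofunctor ψ.toPseudofunctor := α

/-- The value `φ(1)` of a loop `φ` on the generator of `ℤ`. -/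
def Loop.base (φ : Loop G) : G :=
  MonoidalOpposite.unmop (C := G) (φ.toPseudofunctor.map
    (X := MonoidalSingleObj.star _) (Y := MonoidalSingleObj.star _) (Discrete.mk (1 : ℤ)))

/-- The component `α_*` of a 1-morphism of loops at the unique object of `Bℤ`. -/
def Loop.component {φ ψ : Loop G} (α : φ ⟶ ψ) : G :=
  MonoidalOpposite.unmop (C := G)
    ((toStrongTrans α).app (MonoidalSingleObj.star _))

/-- The structure isomorphism `α_* ⊗ φ(1) ≅ ψ(1) ⊗ α_*` of a 1-morphism of loops. -/
def Loop.structureHom {φ ψ : Loop G} (α : φ ⟶ ψ) :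
    Loop.component α ⊗ φ.base ⟶ ψ.base ⊗ Loop.component α :=
  MonoidalOpposite.unmop ((toStrongTrans α).naturality
    (a := MonoidalSingleObj.star _) (b := MonoidalSingleObj.star _) (Discrete.mk (1 : ℤ))).hom

variable [TwoGroup G]

open ExactPairing in
/-- The 1-morphism `φ(1) ⟶ ψ(1)` of `G // G` given by `α_*` and
`(α_* ⊗ φ(1)) ⊗ α_** ≅ (ψ(1) ⊗ α_*) ⊗ α_** ≅ ψ(1)`, where `α_**` is the dual of `α_*`. -/
noncomputable def Loop.toConj {φ ψ : Loop G} (α : φ ⟶ ψ) :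
    (⟨φ.base⟩ : HomotopyQuotient G (Conj G)) ⟶ ⟨ψ.base⟩ :=
  HomotopyQuotient.Hom.mk (Loop.component α)
    ((Loop.structureHom α ▷ dual (Loop.component α) ≫ (α_ _ _ _).hom ≫
      ψ.base ◁ Groupoid.inv (η_ (Loop.component α) (dual (Loop.component α))) ≫ (ρ_ _).hom :
      (Loop.component α ⊗ φ.base) ⊗ dual (Loop.component α) ⟶ ψ.base))

end Loop

end TwoGroupFourier
namespace TwoGroupFourier

/-! ### The 2-group algebra, its Drinfeld center and the Fourier 2-transform -/

section Algebra

variable (𝕜 : Type w) [Field 𝕜] (G : Type u) [Groupoid.{v} G] [MonoidalCategory G]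

/-- The 2-group algebra `Vect_G`: the idempotent completion of the additive completion of the
`𝕜`-linear category freely generated by `G`. -/
noncomputable abbrev VectG := Idempotents.Karoubi (Mat_ (Free 𝕜 G))

/-- The canonical functor `G ⥤ Vect_G`. -/
noncomputable abbrev VectG.of : G ⥤ VectG 𝕜 G :=
  Free.embedding 𝕜 G ⋙ Mat_.embedding (Free 𝕜 G) ⋙ Idempotents.toKaroubi (Mat_ (Free 𝕜 G))

/-- The functor `V ↦ (g ↦ Hom(g, V))` from `Vect_G` to functors on `G`; a morphism `a : g ⟶ h` of
`G` acts by precomposition with its inverse. -/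
noncomputable def fourier : VectG 𝕜 G ⥤ G ⥤ ModuleCat.{max v w} 𝕜 :=
  linearYoneda 𝕜 (VectG 𝕜 G) ⋙ (Functor.whiskeringLeft _ _ _).obj
    ((Groupoid.invEquivalence (C := G)).functor ⋙ (VectG.of 𝕜 G).op)

/-- The Drinfeld center of a monoidal category. -/
def DrinfeldCenter (A : Type*) [Category A] [MonoidalCategory A] := Center A

variable {A : Type*} [Category A] [MonoidalCategory A]

instance : Category (DrinfeldCenter A) := inferInstanceAs (Category (Center A))

noncomputable instance : MonoidalCategory (DrinfeldCenter A) := inferInstanceAs (MonoidalCategory (Center A))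

/-- An object of the center is an object `X` with half-braidings `X ⊗ Y ≅ Y ⊗ X`. The braiding
`X ⊗ Y ≅ Y ⊗ X` is the inverse of the half-braiding `Y ⊗ X ≅ X ⊗ Y` of `Y`. -/
noncomputable instance : BraidedCategory (DrinfeldCenter A) := reverseBraiding (Center A)

variable (A) in
/-- The forgetful functor from the Drinfeld center. -/
abbrev DrinfeldCenter.forget : DrinfeldCenter A ⥤ A := Center.forget A

end Algebra

end TwoGroupFourier

/-! All three categories of the theorem are compared with the category of functors from one ordinary
category, the inertia category of `G`, to `FGModuleCat 𝕜`. The objects of the inertia category are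
those of `G`; a morphism `x ⟶ y` is a class of pairs of an object `g` and a morphism `g ⊗ x ⟶ y ⊗
g`, where a morphism `g ⟶ h` that intertwines two such pairs identifies them.

2-functors. A target with only identity 2-morphisms cannot distinguish 1-morphisms joined by a
2-morphism, so a 2-functor to it is a functor on the homotopy category of the source. For `G // G`
this homotopy category is the inertia category because `g*` is invertible: morphisms `(g ⊗ x) ⊗ g* ⟶
y` correspond to morphisms `g ⊗ x ⟶ y ⊗ g` (`toConjHom_bijective`,
`conjToInertia_isHomotopyEquivalence`). For loops it is the inertia category, up to equivalence,
because `ℤ` is free on `1`: every object has coherent integer powers (`exists_intPow`), a structure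
morphism at `1` extends to all exponents (`IntPow.exists_isTrans`), and an intertwiner at `1` is one
at every exponent (`IntPow.IsTrans.naturality`). Both comparisons send `α` and its image in `G // G`
to the same class, so `E₂` is evaluation at `1`.

The center. Let `J` be the inclusion of `G` in the 2-group algebra. An object `V` with a
half-braiding is sent to the multiplicity spaces `Hom(J x, V)`. A morphism `c : g ⊗ x ⟶ y ⊗ g` acts
on `f : J x ⟶ V` by tensoring with `J g`, applying the half-braiding and cancelling the invertible
object `J g` on the right. Naturality, unit and multiplicativity of the half-braiding say exactly
that this is a functor on the inertia category (`centerRep`).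

`centerRep` is an equivalence because `J` generates: every object is a retract of a finite sum of
objects `J x`, and the morphisms of `G` are bases of the morphism spaces (`IsLinearization`). Thus
morphisms, and then half-braidings, are determined by and can be built from their restriction to the
`J x` (`hom_ext`, `exists_extension`). For essential surjectivity, a representation of `G` is first
realized as `Hom(J -, V)` by averaging over finite morphism sets in characteristic zero
(`exists_homFunctor_iso`); the remaining action then gives a half-braiding with the `J g`
(`exists_relHalfBraiding`), which extends to all objects (`exists_halfBraiding`).

Restricting `centerRep` to `G` leaves just the multiplicity spaces, which is the Fourier
compatibility. The braided structure on functors on loops is transported from the center. -/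

namespace TwoGroupFourier

/-! ### 2-functors into a category as functors on the homotopy category -/

section

variable {X : Type*} [Bicategory X] {D : Type*} [Category D]

namespace TwoFun

/-- A 2-functor into a category from its values on objects and 1-morphisms. -/
def mk' (o : X → D) (m : ∀ {x y : X}, (x ⟶ y) → (o x ⟶ o y))
    (m_eq : ∀ {x y : X} {f g : x ⟶ y}, (f ⟶ g) → m f = m g)
    (m_id : ∀ x : X, m (𝟙 x) = 𝟙 (o x))
    (m_comp : ∀ {x y z : X} (f : x ⟶ y) (g : y ⟶ z), m (f ≫ g) = m f ≫ m g) : TwoFun X D :=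
  show Pseudofunctor X (LocallyDiscrete D) from
  { obj := fun x => ⟨o x⟩
    map := fun f => ⟨m f⟩
    map₂ := fun a => Discrete.eqToHom (m_eq a)
    mapId := fun x => Discrete.eqToIso (m_id x)
    mapComp := fun f g => Discrete.eqToIso (m_comp f g)
    -- Parallel 2-morphisms of `LocallyDiscrete D` are equal, so all coherence laws are automatic.
    map₂_id := fun _ => Subsingleton.elim _ _
    map₂_comp := fun _ _ => Subsingleton.elim _ _
    map₂_whisker_left := fun _ _ _ _ => Subsingleton.elim _ _
    map₂_whisker_right := fun _ _ => Subsingleton.elim _ _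
    map₂_associator := fun _ _ _ => Subsingleton.elim _ _
    map₂_left_unitor := fun _ => Subsingleton.elim _ _
    map₂_right_unitor := fun _ => Subsingleton.elim _ _ }

/-- A morphism of `Fun(X, D)` from its components. -/
def homMk {F G : TwoFun X D} (a : ∀ x, F.obj x ⟶ G.obj x)
    (h : ∀ {x y : X} (f : x ⟶ y), F.map f ≫ a y = a x ≫ G.map f) : F ⟶ G :=
  show Pseudofunctor.StrongTrans F.toPseudofunctor G.toPseudofunctor from
  { app := fun x => ⟨a x⟩
    naturality := fun f => Discrete.eqToIso (h f)
    naturality_naturality := fun _ => Subsingleton.elim _ _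
    naturality_id := fun _ => Subsingleton.elim _ _
    naturality_comp := fun _ _ => Subsingleton.elim _ _ }

lemma hom_ext {F G : TwoFun X D} {α β : F ⟶ G} (h : ∀ x, app α x = app β x) : α = β :=
  strongTrans_ext fun x => congrArg (fun f => (⟨f⟩ : F.toPseudofunctor.obj x ⟶ _)) (h x)

/-- An isomorphism of `Fun(X, D)` from its components. -/
def isoMk {F G : TwoFun X D} (a : ∀ x, F.obj x ≅ G.obj x)
    (h : ∀ {x y : X} (f : x ⟶ y), F.map f ≫ (a y).hom = (a x).hom ≫ G.map f) : F ≅ G where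
  hom := homMk (fun x => (a x).hom) h
  inv := homMk (fun x => (a x).inv) fun {x y} f => by
    rw [Iso.eq_inv_comp, ← Category.assoc, ← h, Category.assoc, Iso.hom_inv_id, Category.comp_id]
  hom_inv_id := hom_ext fun x => (a x).hom_inv_id
  inv_hom_id := hom_ext fun x => (a x).inv_hom_id

end TwoFun

variable (X) in
/-- The homotopy category of a 2-category: 1-morphisms are identified if they are connected by
2-morphisms. -/
structure HomotopyCat where
  /-- The underlying object. -/
  as : X

/-- The relation of being connected by a 2-morphism. -/
def HomotopyCat.Rel (x y : X) (f g : x ⟶ y) : Prop := Nonempty (f ⟶ g)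

lemma HomotopyCat.Rel.mk {x y : X} {f g : x ⟶ y} (a : f ⟶ g) : Rel x y f g := ⟨a⟩

/-- `Quot` passes to the equivalence relation generated by `Rel`, so 2-morphisms need not be
invertible here. Unitors and associators become the category laws. -/
instance : Category (HomotopyCat X) where
  Hom x y := Quot (HomotopyCat.Rel x.as y.as)
  id x := Quot.mk _ (𝟙 x.as)
  comp := Quot.map₂ (fun f g => f ≫ g)
    (fun f _ _ ⟨a⟩ => ⟨Bicategory.whiskerLeft f a⟩)
    (fun _ _ g ⟨a⟩ => ⟨Bicategory.whiskerRight a g⟩)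
  id_comp := by
    rintro _ _ ⟨f⟩
    exact Quot.sound (HomotopyCat.Rel.mk (Bicategory.leftUnitor f).hom)
  comp_id := by
    rintro _ _ ⟨f⟩
    exact Quot.sound (HomotopyCat.Rel.mk (Bicategory.rightUnitor f).hom)
  assoc := by
    rintro _ _ _ _ ⟨f⟩ ⟨g⟩ ⟨h⟩
    exact Quot.sound (HomotopyCat.Rel.mk (Bicategory.associator f g h).hom)

namespace HomotopyCat

/-- An object of a 2-category as an object of its homotopy category. -/
def of (x : X) : HomotopyCat X := ⟨x⟩

/-- The class of a 1-morphism. -/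
def homMk {x y : X} (f : x ⟶ y) : of x ⟶ of y := Quot.mk _ f

lemma homMk_eq {x y : X} {f g : x ⟶ y} (a : f ⟶ g) : homMk f = homMk g :=
  Quot.sound (Rel.mk a)

lemma homMk_id (x : X) : homMk (𝟙 x) = 𝟙 (of x) := rfl

lemma homMk_comp {x y z : X} (f : x ⟶ y) (g : y ⟶ z) : homMk (f ≫ g) = homMk f ≫ homMk g := rfl

/-- The functor on the homotopy category induced by a 2-functor. -/
def lift (P : TwoFun X D) : HomotopyCat X ⥤ D where
  obj x := P.obj x.as
  map := Quot.lift (fun f => P.map f) fun _ _ ⟨a⟩ => P.map_eq a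
  map_id x := TwoFun.map_id P x.as
  map_comp := by
    rintro _ _ _ ⟨f⟩ ⟨g⟩
    exact P.map_comp f g

/-- The 2-functor induced by a functor on the homotopy category. -/
def desc (L : HomotopyCat X ⥤ D) : TwoFun X D :=
  TwoFun.mk' (fun x => L.obj (of x)) (fun f => L.map (homMk f))
    (fun a => by rw [homMk_eq a]) (fun x => by rw [homMk_id, L.map_id])
    (fun f g => by rw [homMk_comp, L.map_comp])

variable (X D) in
/-- 2-functors from `X` to a category are functors on the homotopy category of `X`. -/
def equivalence : (HomotopyCat X ⥤ D) ≌ TwoFun X D where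
  functor :=
    { obj := desc
      map := fun α => TwoFun.homMk (F := desc _) (G := desc _) (fun x => α.app (of x))
        fun f => α.naturality (homMk f)
      map_id := fun _ => TwoFun.hom_ext fun _ => rfl
      map_comp := fun _ _ => TwoFun.hom_ext fun _ => rfl }
  inverse :=
    { obj := lift
      map := fun α =>
        { app := fun x => TwoFun.app α x.as
          naturality := by
            rintro _ _ ⟨f⟩
            exact TwoFun.naturality α f }
      map_id := fun _ => rfl
      map_comp := fun _ _ => rfl }
  unitIso := NatIso.ofComponents
    (fun L => NatIso.ofComponents (F := L) (G := lift (desc L)) (fun x => Iso.refl (L.obj x)) (by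
      rintro _ _ ⟨f⟩
      exact (Category.comp_id _).trans (Category.id_comp _).symm))
    (fun α => by
      ext x
      exact (Category.comp_id _).trans (Category.id_comp _).symm)
  counitIso := NatIso.ofComponents
    (fun F => TwoFun.isoMk (F := desc (lift F)) (G := F) (fun x => Iso.refl (F.obj x))
      (fun f => (Category.comp_id (F.map f)).trans (Category.id_comp (F.map f)).symm))
    (fun {F F'} α => TwoFun.hom_ext fun x =>
      (Category.comp_id (TwoFun.app α x)).trans (Category.id_comp (TwoFun.app α x)).symm)
  functor_unitIso_comp L := TwoFun.hom_ext fun x => Category.id_comp (𝟙 (L.obj (of x)))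

end HomotopyCat

/-- A 2-functor to a category is a localization at the 2-morphisms if it is essentially
surjective, full, and identifies only 1-morphisms that are connected by a 2-morphism. -/
structure TwoFun.IsHomotopyEquivalence {H : Type*} [Category H] (P : TwoFun X H) : Prop where
  essSurj : ∀ h : H, ∃ x : X, Nonempty (P.obj x ≅ h)
  full : ∀ {x y : X} (m : P.obj x ⟶ P.obj y), ∃ f : x ⟶ y, P.map f = m
  faithful : ∀ {x y : X} (f g : x ⟶ y), P.map f = P.map g → Nonempty (f ⟶ g)

namespace TwoFun.IsHomotopyEquivalence

variable {H : Type*} [Category H] {P : TwoFun X H}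

lemma isEquivalence (hP : P.IsHomotopyEquivalence) : (HomotopyCat.lift P).IsEquivalence where
  faithful := ⟨by
    rintro _ _ ⟨f⟩ ⟨g⟩ h
    exact Quot.sound (hP.faithful f g h)⟩
  full := ⟨by
    intro x y m
    obtain ⟨f, hf⟩ := hP.full m
    exact ⟨HomotopyCat.homMk f, hf⟩⟩
  essSurj := ⟨fun h => let ⟨x, hx⟩ := hP.essSurj h; ⟨⟨x⟩, hx⟩⟩

variable (D) in
/-- Precomposition with a 2-functor `P : X ⥤ H` that is an equivalence on homotopy categories. -/
noncomputable def precomp (hP : P.IsHomotopyEquivalence) : (H ⥤ D) ≌ TwoFun X D :=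
  haveI := hP.isEquivalence
  (HomotopyCat.lift P).asEquivalence.symm.congrLeft.trans (HomotopyCat.equivalence X D)

/-- Although `precomp` is obtained from a chosen inverse equivalence, its forward functor is literal
precomposition with `P`. This definitional fact lets later comparisons use identity isomorphisms. -/
lemma precomp_obj_obj (hP : P.IsHomotopyEquivalence) (L : H ⥤ D) (x : X) :
    ((hP.precomp D).functor.obj L).obj x = L.obj (P.obj x) := rfl

lemma precomp_obj_map (hP : P.IsHomotopyEquivalence) (L : H ⥤ D) {x y : X} (f : x ⟶ y) :
    ((hP.precomp D).functor.obj L).map f = L.map (P.map f) := rfl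

lemma precomp_map_app (hP : P.IsHomotopyEquivalence) {L L' : H ⥤ D} (a : L ⟶ L') (x : X) :
    TwoFun.app ((hP.precomp D).functor.map a) x = a.app (P.obj x) := rfl

end TwoFun.IsHomotopyEquivalence

/-- Structures of a braided monoidal category can be transported along equivalences. -/
lemma exists_braided_of_equivalence {A B : Type*} [Category A] [Category B] [MonoidalCategory B]
    [BraidedCategory B] (e : A ≌ B) : ∃ (_ : MonoidalCategory A) (_ : BraidedCategory A),
      Nonempty e.functor.Braided :=
  -- `Monoidal.Transported e.symm` is a synonym of `A`, and the inverse of the transported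
  -- equivalence is `e.functor`.
  ⟨inferInstanceAs (MonoidalCategory (Monoidal.Transported e.symm)),
    inferInstanceAs (BraidedCategory (Monoidal.Transported e.symm)),
    ⟨inferInstanceAs (Monoidal.equivalenceTransported e.symm).inverse.Braided⟩⟩

end

end TwoGroupFourier

namespace TwoGroupFourier

/-! ### The inertia category of a monoidal category -/

section

variable (A : Type u) [Category.{v} A] [MonoidalCategory A]

/-- The inertia category of a monoidal category `A`. Its objects are those of `A`; a morphism from
`x` to `y` is represented by an object `g` and a morphism `g ⊗ x ⟶ y ⊗ g`. -/
structure Inertia where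
  /-- The underlying object. -/
  as : A

variable {A}

namespace Inertia

/-- A representative of a morphism of the inertia category. -/
structure PreHom (x y : A) where
  /-- The conjugating object. -/
  obj : A
  /-- The morphism. -/
  hom : obj ⊗ x ⟶ y ⊗ obj

/-- Representatives are related if a morphism of the conjugating objects intertwines them. -/
def Rel (x y : A) (p q : PreHom x y) : Prop :=
  ∃ a : p.obj ⟶ q.obj, a ▷ x ≫ q.hom = p.hom ≫ y ◁ a

/-- The composite `(h ⊗ g) ⊗ x ⟶ h ⊗ (y ⊗ g) ⟶ z ⊗ (h ⊗ g)`. -/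
abbrev compHom {x y z g h : A} (c : g ⊗ x ⟶ y ⊗ g) (d : h ⊗ y ⟶ z ⊗ h) :
    (h ⊗ g) ⊗ x ⟶ z ⊗ (h ⊗ g) :=
  (α_ _ _ _).hom ≫ h ◁ c ≫ (α_ _ _ _).inv ≫ d ▷ g ≫ (α_ _ _ _).hom

/-- With `compHom_left`, this makes composition independent of representatives; the only input
besides coherence is interchange. -/
lemma compHom_right {x y z g h h' : A} (c : g ⊗ x ⟶ y ⊗ g) {d : h ⊗ y ⟶ z ⊗ h}
    {d' : h' ⊗ y ⟶ z ⊗ h'} {a : h ⟶ h'} (w : a ▷ y ≫ d' = d ≫ z ◁ a) :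
    (a ▷ g) ▷ x ≫ compHom c d' = compHom c d ≫ z ◁ (a ▷ g) := by
  calc
    _ = 𝟙 _ ⊗≫ (a ▷ (g ⊗ _) ≫ h' ◁ c) ⊗≫ d' ▷ g ⊗≫ 𝟙 _ := by monoidal
    _ = 𝟙 _ ⊗≫ h ◁ c ⊗≫ (a ▷ _ ≫ d') ▷ g ⊗≫ 𝟙 _ := by
      rw [← whisker_exchange]; monoidal
    _ = _ := by rw [w]; monoidal

lemma compHom_left {x y z g g' h : A} {c : g ⊗ x ⟶ y ⊗ g} {c' : g' ⊗ x ⟶ y ⊗ g'}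
    (d : h ⊗ y ⟶ z ⊗ h) {a : g ⟶ g'} (w : a ▷ x ≫ c' = c ≫ y ◁ a) :
    (h ◁ a) ▷ x ≫ compHom c' d = compHom c d ≫ z ◁ (h ◁ a) := by
  calc
    _ = 𝟙 _ ⊗≫ h ◁ (a ▷ _ ≫ c') ⊗≫ d ▷ g' ⊗≫ 𝟙 _ := by monoidal
    _ = 𝟙 _ ⊗≫ h ◁ c ⊗≫ ((h ⊗ _) ◁ a ≫ d ▷ g') ⊗≫ 𝟙 _ := by
      rw [w]; monoidal
    _ = _ := by rw [whisker_exchange]; monoidal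

/-- The category laws hold for representatives only up to unitors and associators of the conjugating
objects; these are the intertwiners that make them hold for classes. -/
lemma compHom_id {x y g : A} (c : g ⊗ x ⟶ y ⊗ g) :
    (ρ_ g).hom ▷ x ≫ c = compHom ((λ_ x).hom ≫ (ρ_ x).inv) c ≫ y ◁ (ρ_ g).hom := by
  dsimp only [compHom]; monoidal

lemma id_compHom {x y g : A} (c : g ⊗ x ⟶ y ⊗ g) :
    (λ_ g).hom ▷ x ≫ c = compHom c ((λ_ y).hom ≫ (ρ_ y).inv) ≫ y ◁ (λ_ g).hom := by
  dsimp only [compHom]; monoidal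

lemma compHom_assoc {x y z t g h k : A} (c : g ⊗ x ⟶ y ⊗ g) (d : h ⊗ y ⟶ z ⊗ h)
    (e : k ⊗ z ⟶ t ⊗ k) :
    (α_ k h g).inv ▷ x ≫ compHom c (compHom d e) =
      compHom (compHom c d) e ≫ t ◁ (α_ k h g).inv := by
  dsimp only [compHom]; monoidal

instance : Category (Inertia A) where
  Hom x y := Quot (Rel x.as y.as)
  id x := Quot.mk _ ⟨𝟙_ A, (λ_ x.as).hom ≫ (ρ_ x.as).inv⟩
  comp := Quot.map₂ (fun p q => ⟨q.obj ⊗ p.obj, compHom p.hom q.hom⟩)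
    (fun p _ _ ⟨_, w⟩ => ⟨_, compHom_right p.hom w⟩)
    (fun _ _ q ⟨_, w⟩ => ⟨_, compHom_left q.hom w⟩)
  id_comp := by
    rintro _ _ ⟨p⟩
    exact Quot.sound ⟨_, compHom_id p.hom⟩
  comp_id := by
    rintro _ _ ⟨p⟩
    exact Quot.sound ⟨_, id_compHom p.hom⟩
  assoc := by
    rintro _ _ _ _ ⟨p⟩ ⟨q⟩ ⟨r⟩
    exact Quot.sound ⟨_, (compHom_assoc p.hom q.hom r.hom)⟩

/-- The class of a representative. -/
def homMk {x y : A} (g : A) (c : g ⊗ x ⟶ y ⊗ g) : (⟨x⟩ : Inertia A) ⟶ ⟨y⟩ := Quot.mk _ ⟨g, c⟩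

lemma homMk_surjective {x y : A} (f : (⟨x⟩ : Inertia A) ⟶ ⟨y⟩) :
    ∃ (g : A) (c : g ⊗ x ⟶ y ⊗ g), homMk g c = f := by
  obtain ⟨p, rfl⟩ := Quot.exists_rep f
  exact ⟨p.obj, p.hom, rfl⟩

lemma homMk_eq {x y g h : A} {c : g ⊗ x ⟶ y ⊗ g} {d : h ⊗ x ⟶ y ⊗ h} (a : g ⟶ h)
    (w : a ▷ x ≫ d = c ≫ y ◁ a) : homMk g c = homMk h d := Quot.sound ⟨a, w⟩

lemma homMk_id (x : A) : homMk (𝟙_ A) ((λ_ x).hom ≫ (ρ_ x).inv) = 𝟙 (⟨x⟩ : Inertia A) := rfl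

lemma homMk_comp {x y z g h : A} (c : g ⊗ x ⟶ y ⊗ g) (d : h ⊗ y ⟶ z ⊗ h) :
    homMk g c ≫ homMk h d = homMk (h ⊗ g) (compHom c d) := rfl

variable {D : Type*} [Category D]

/-- A functor on the inertia category from its values on representatives. -/
@[simps obj]
def lift (o : A → D) (m : ∀ {x y : A} (g : A), (g ⊗ x ⟶ y ⊗ g) → (o x ⟶ o y))
    (m_eq : ∀ {x y g h : A} {c : g ⊗ x ⟶ y ⊗ g} {d : h ⊗ x ⟶ y ⊗ h} (a : g ⟶ h),
      a ▷ x ≫ d = c ≫ y ◁ a → m g c = m h d)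
    (m_id : ∀ x : A, m (𝟙_ A) ((λ_ x).hom ≫ (ρ_ x).inv) = 𝟙 (o x))
    (m_comp : ∀ {x y z g h : A} (c : g ⊗ x ⟶ y ⊗ g) (d : h ⊗ y ⟶ z ⊗ h),
      m (h ⊗ g) (compHom c d) = m g c ≫ m h d) : Inertia A ⥤ D where
  obj x := o x.as
  map := Quot.lift (fun p => m p.obj p.hom) fun _ _ ⟨a, w⟩ => m_eq a w
  map_id x := m_id x.as
  map_comp := by
    rintro _ _ _ ⟨p⟩ ⟨q⟩
    exact m_comp p.hom q.hom

end Inertia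

end

section

variable {G : Type u} [Groupoid.{v} G] [MonoidalCategory G]

namespace Inertia

/-- In a groupoid `Rel` is already an equivalence relation, so equal classes are related by a single
intertwiner instead of a zigzag. Faithfulness of both comparisons with the inertia category rests on
this. -/
lemma exists_of_homMk_eq {x y g h : G} {c : g ⊗ x ⟶ y ⊗ g} {d : h ⊗ x ⟶ y ⊗ h}
    (w : homMk g c = homMk h d) : ∃ a : g ⟶ h, a ▷ x ≫ d = c ≫ y ◁ a := by
  have e : Equivalence (Rel x y) :=
    { refl := fun p => ⟨𝟙 _, by simp⟩
      symm := by
        rintro p q ⟨a, h⟩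
        refine ⟨inv a, ?_⟩
        rw [← cancel_epi (a ▷ x), ← cancel_mono (y ◁ a)]
        simp [h, ← comp_whiskerRight_assoc, ← MonoidalCategory.whiskerLeft_comp]
      trans := by
        rintro p q r ⟨a, h⟩ ⟨b, k⟩
        refine ⟨a ≫ b, ?_⟩
        rw [comp_whiskerRight, MonoidalCategory.whiskerLeft_comp, Category.assoc, k,
          reassoc_of% h] }
  have h := Quot.eqvGen_exact w
  rwa [e.eqvGen_eq] at h

lemma exists_iso {x y : G} (f : x ⟶ y) : Nonempty ((⟨x⟩ : Inertia G) ≅ ⟨y⟩) := by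
  have key : ∀ {x y : G} (f : x ⟶ y), homMk (𝟙_ G) (𝟙_ G ◁ f ≫ (λ_ y).hom ≫ (ρ_ y).inv) ≫
      homMk (𝟙_ G) (𝟙_ G ◁ inv f ≫ (λ_ x).hom ≫ (ρ_ x).inv) = 𝟙 (⟨x⟩ : Inertia G) := by
    intro x y f
    rw [homMk_comp, ← homMk_id]
    refine homMk_eq (λ_ (𝟙_ G)).hom ?_
    calc
      _ = 𝟙 _ ⊗≫ (f ≫ inv f) ⊗≫ 𝟙 _ := by rw [IsIso.hom_inv_id]; monoidal
      _ = _ := by monoidal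
  refine ⟨⟨_, _, key f, ?_⟩⟩
  simpa using key (inv f)

end Inertia

end

end TwoGroupFourier

namespace TwoGroupFourier

open TwoGroup ExactPairing

/-! ### Whiskering with invertible objects -/

section

variable {A : Type*} [Category A] [MonoidalCategory A] {B B' : A}

/-- Tensoring with an invertible object is an equivalence, with tensoring by the inverse object as
quasi-inverse; hence it is fully faithful. -/
lemma whiskerLeft_bijective (e : B' ⊗ B ≅ 𝟙_ A) (e' : B ⊗ B' ≅ 𝟙_ A) (X Y : A) :
    Function.Bijective fun f : X ⟶ Y => B ◁ f := by
  let i₁ : tensorLeft B ⋙ tensorLeft B' ≅ 𝟭 A :=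
    (tensorLeftTensor B' B).symm ≪≫ (curriedTensor A).mapIso e ≪≫
      NatIso.ofComponents (fun X => λ_ X) (by intros; simp)
  let i₂ : tensorLeft B' ⋙ tensorLeft B ≅ 𝟭 A :=
    (tensorLeftTensor B B').symm ≪≫ (curriedTensor A).mapIso e' ≪≫
      NatIso.ofComponents (fun X => λ_ X) (by intros; simp)
  let E := CategoryTheory.Equivalence.mk (tensorLeft B) (tensorLeft B') i₁.symm i₂
  exact E.fullyFaithfulFunctor.map_bijective X Y

lemma whiskerRight_bijective (e : B ⊗ B' ≅ 𝟙_ A) (e' : B' ⊗ B ≅ 𝟙_ A) (X Y : A) :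
    Function.Bijective fun f : X ⟶ Y => f ▷ B := by
  let i₁ : tensorRight B ⋙ tensorRight B' ≅ 𝟭 A :=
    (tensorRightTensor B B').symm ≪≫ (curriedTensor A).flip.mapIso e ≪≫
      NatIso.ofComponents (fun X => ρ_ X) (by intros; simp)
  let i₂ : tensorRight B' ⋙ tensorRight B ≅ 𝟭 A :=
    (tensorRightTensor B' B).symm ≪≫ (curriedTensor A).flip.mapIso e' ≪≫
      NatIso.ofComponents (fun X => ρ_ X) (by intros; simp)
  let E := CategoryTheory.Equivalence.mk (tensorRight B) (tensorRight B') i₁.symm i₂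
  exact E.fullyFaithfulFunctor.map_bijective X Y

end

/-! ### The homotopy quotient of the conjugation action and the inertia category -/

section

variable {G : Type u} [Groupoid.{v} G] [MonoidalCategory G] [TwoGroup G]

lemma TwoGroup.whiskerRight_bijective (g x y : G) : Function.Bijective fun f : x ⟶ y => f ▷ g := by
  obtain ⟨h, ⟨e⟩, ⟨e'⟩⟩ := TwoGroup.exists_inverse g
  exact TwoGroupFourier.whiskerRight_bijective e e' x y

lemma TwoGroup.whiskerLeft_bijective (g x y : G) : Function.Bijective fun f : x ⟶ y => g ◁ f := by
  obtain ⟨h, ⟨e⟩, ⟨e'⟩⟩ := TwoGroup.exists_inverse g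
  exact TwoGroupFourier.whiskerLeft_bijective e' e x y

/-- The inverse `g ⊗ g* ⟶ e` of the coevaluation. -/
noncomputable abbrev coevInv (g : G) : g ⊗ dual g ⟶ 𝟙_ G := Groupoid.inv (η_ g (dual g))

/-- The morphism `(g ⊗ x) ⊗ g* ⟶ y` corresponding to `g ⊗ x ⟶ y ⊗ g`. -/
noncomputable abbrev toConjHom {x y g : G} (c : g ⊗ x ⟶ y ⊗ g) : (g ⊗ x) ⊗ dual g ⟶ y :=
  c ▷ dual g ≫ (α_ _ _ _).hom ≫ y ◁ coevInv g ≫ (ρ_ _).hom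

/-- `toConjHom` whiskers with the invertible object `g*` and then composes with an isomorphism. -/
lemma toConjHom_bijective (g x y : G) :
    Function.Bijective (toConjHom : (g ⊗ x ⟶ y ⊗ g) → ((g ⊗ x) ⊗ dual g ⟶ y)) := by
  have h : Function.Bijective
      fun f : (g ⊗ x) ⊗ dual g ⟶ (y ⊗ g) ⊗ dual g =>
        f ≫ (α_ _ _ _).hom ≫ y ◁ coevInv g ≫ (ρ_ _).hom :=
    ⟨fun a b h => by simpa [cancel_mono] using h, fun b =>
      ⟨b ≫ inv ((α_ _ _ _).hom ≫ y ◁ coevInv g ≫ (ρ_ _).hom), by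
        simp only [Category.assoc, IsIso.inv_hom_id, Category.comp_id]⟩⟩
  exact h.comp (TwoGroup.whiskerRight_bijective (dual g) (g ⊗ x) (y ⊗ g))

/-- This and the next two lemmas mirror `coev_dualMap`, `coev_dualUnit` and `coev_dualTensor`: after
precomposing with the invertible coevaluation, both sides become identities or coevaluations. -/
lemma coevInv_dualMap {g h : G} (a : g ⟶ h) :
    a ▷ dual g ≫ h ◁ dualMap a ≫ coevInv h = coevInv g := by
  rw [← cancel_epi (η_ g (dual g)), Groupoid.comp_inv, reassoc_of% (coev_dualMap a),
    Groupoid.comp_inv]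

lemma coevInv_unit : coevInv (𝟙_ G) = 𝟙_ G ◁ (dualUnit G).hom ≫ (ρ_ (𝟙_ G)).hom := by
  rw [← cancel_epi (η_ (𝟙_ G) (dual (𝟙_ G))), Groupoid.comp_inv, reassoc_of% (coev_dualUnit G),
    Iso.inv_hom_id]

lemma coevInv_tensor (g h : G) : coevInv (g ⊗ h) = (g ⊗ h) ◁ (dualTensor g h).hom ⊗≫
    (g ◁ coevInv h) ▷ dual g ⊗≫ coevInv g := by
  rw [← cancel_epi (η_ (g ⊗ h) (dual (g ⊗ h))), Groupoid.comp_inv]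
  symm
  calc
    _ = (η_ (g ⊗ h) (dual (g ⊗ h)) ≫ (g ⊗ h) ◁ (dualTensor g h).hom) ⊗≫
      (g ◁ coevInv h) ▷ dual g ⊗≫ coevInv g := by monoidal
    _ = η_ g (dual g) ⊗≫ (g ◁ (η_ h (dual h) ≫ coevInv h)) ▷ dual g ⊗≫ coevInv g := by
      rw [coev_dualTensor]; monoidal
    _ = η_ g (dual g) ≫ coevInv g := by rw [Groupoid.comp_inv]; monoidal
    _ = _ := Groupoid.comp_inv _

lemma toConjHom_naturality {x y g h : G} {c : g ⊗ x ⟶ y ⊗ g} {d : h ⊗ x ⟶ y ⊗ h} {a : g ⟶ h}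
    (w : a ▷ x ≫ d = c ≫ y ◁ a) : ((a ▷ x) ⊗ₘ dualMap a) ≫ toConjHom d = toConjHom c := by
  calc
    _ = (g ⊗ x) ◁ dualMap a ≫ (a ▷ x ≫ d) ▷ dual h ≫ (α_ _ _ _).hom ≫ y ◁ coevInv h ≫
        (ρ_ _).hom := by
      rw [MonoidalCategory.tensorHom_def']; simp [toConjHom]
    _ = ((g ⊗ x) ◁ dualMap a ≫ c ▷ dual h) ⊗≫ y ◁ (a ▷ dual h ≫ coevInv h) ⊗≫ 𝟙 _ := by
      rw [w]; monoidal
    _ = c ▷ dual g ⊗≫ y ◁ ((g ◁ dualMap a ≫ a ▷ dual h) ≫ coevInv h) ⊗≫ 𝟙 _ := by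
      rw [whisker_exchange]; monoidal
    _ = c ▷ dual g ⊗≫ y ◁ (a ▷ dual g ≫ h ◁ dualMap a ≫ coevInv h) ⊗≫ 𝟙 _ := by
      rw [whisker_exchange]; monoidal
    _ = _ := by rw [coevInv_dualMap]; monoidal

/-- The morphism `a ▷ x ≫ d ≫ y ◁ inv a` is intertwined with `d` by construction. The forward
direction gives it the same image as `c`, and injectivity of `toConjHom` identifies the two. -/
lemma naturality_of_toConjHom {x y g h : G} {c : g ⊗ x ⟶ y ⊗ g} {d : h ⊗ x ⟶ y ⊗ h} {a : g ⟶ h}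
    (w : ((a ▷ x) ⊗ₘ dualMap a) ≫ toConjHom d = toConjHom c) : a ▷ x ≫ d = c ≫ y ◁ a := by
  have h : (a ▷ x ≫ d ≫ y ◁ inv a) ≫ y ◁ a = a ▷ x ≫ d := by
    simp [← MonoidalCategory.whiskerLeft_comp]
  rw [← (toConjHom_bijective g x y).1 ((toConjHom_naturality h.symm).symm.trans w), h]

lemma toConjHom_id (x : G) : toConjHom ((λ_ x).hom ≫ (ρ_ x).inv) = (conjUnit x).hom := by
  rw [conjUnit_hom, toConjHom, coevInv_unit]
  calc
    _ = (((λ_ x).hom ≫ (ρ_ x).inv) ▷ dual (𝟙_ G) ≫ (x ⊗ 𝟙_ G) ◁ (dualUnit G).hom) ⊗≫ 𝟙 _ := by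
      monoidal
    _ = _ := by rw [← whisker_exchange]; monoidal

/-- By `coevInv_tensor`, cancelling `h ⊗ g` against its dual amounts to cancelling `g` inside and
then `h` outside. Interchange moves the inner cancellation in front of `d`. -/
lemma toConjHom_comp {x y z g h : G} (c : g ⊗ x ⟶ y ⊗ g) (d : h ⊗ y ⟶ z ⊗ h) :
    toConjHom (Inertia.compHom c d) =
      (conjAssoc h g x).hom ≫ (h ◁ toConjHom c) ▷ dual h ≫ toConjHom d := by
  rw [conjAssoc_hom, toConjHom, coevInv_tensor]
  calc
    _ = (Inertia.compHom c d ▷ dual (h ⊗ g) ≫ (z ⊗ (h ⊗ g)) ◁ (dualTensor h g).hom) ⊗≫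
        z ◁ ((h ◁ coevInv g) ▷ dual h ⊗≫ coevInv h) ⊗≫ 𝟙 _ := by
      dsimp only [Inertia.compHom]; monoidal
    _ = ((h ⊗ g) ⊗ x) ◁ (dualTensor h g).hom ⊗≫ h ◁ c ▷ (dual g ⊗ dual h) ⊗≫
        (d ▷ (g ⊗ dual g) ≫ (z ⊗ h) ◁ coevInv g) ▷ dual h ⊗≫ z ◁ coevInv h ⊗≫ 𝟙 _ := by
      rw [← whisker_exchange]; dsimp only [Inertia.compHom]; monoidal
    _ = _ := by
      rw [← whisker_exchange]; dsimp only [toConjHom]; monoidal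

/-- The morphism `g ⊗ x ⟶ y ⊗ g` corresponding to `(g ⊗ x) ⊗ g* ⟶ y`. -/
noncomputable def ofConjHom {x y g : G} (r : (g ⊗ x) ⊗ dual g ⟶ y) : g ⊗ x ⟶ y ⊗ g :=
  ((toConjHom_bijective g x y).2 r).choose

lemma toConjHom_ofConjHom {x y g : G} (r : (g ⊗ x) ⊗ dual g ⟶ y) :
    toConjHom (ofConjHom r) = r :=
  ((toConjHom_bijective g x y).2 r).choose_spec

lemma ofConjHom_toConjHom {x y g : G} (c : g ⊗ x ⟶ y ⊗ g) : ofConjHom (toConjHom c) = c :=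
  (toConjHom_bijective g x y).1 (toConjHom_ofConjHom _)

lemma ofConjHom_naturality {x y g h : G} {r : (g ⊗ x) ⊗ dual g ⟶ y} {s : (h ⊗ x) ⊗ dual h ⟶ y}
    {a : g ⟶ h} (w : ((a ▷ x) ⊗ₘ dualMap a) ≫ s = r) :
    a ▷ x ≫ ofConjHom s = ofConjHom r ≫ y ◁ a :=
  naturality_of_toConjHom (by rw [toConjHom_ofConjHom, toConjHom_ofConjHom, w])

lemma ofConjHom_id (x : G) : ofConjHom (conjUnit x).hom = (λ_ x).hom ≫ (ρ_ x).inv := by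
  rw [← toConjHom_id, ofConjHom_toConjHom]

lemma ofConjHom_comp {x y z g h : G} (r : (g ⊗ x) ⊗ dual g ⟶ y) (s : (h ⊗ y) ⊗ dual h ⟶ z) :
    ofConjHom ((conjAssoc h g x).hom ≫ (h ◁ r) ▷ dual h ≫ s) =
      Inertia.compHom (ofConjHom r) (ofConjHom s) := by
  apply (toConjHom_bijective _ _ _).1
  rw [toConjHom_ofConjHom, toConjHom_comp, toConjHom_ofConjHom, toConjHom_ofConjHom]

/-- A 1-morphism of `G // G` as a morphism of the inertia category. -/
noncomputable def conjToInertiaMap {x y : HomotopyQuotient G (Conj G)} (p : x ⟶ y) :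
    (⟨x.as⟩ : Inertia G) ⟶ ⟨y.as⟩ :=
  Inertia.homMk (A := G) p.obj (ofConjHom p.hom)

variable (G) in
/-- The 2-functor from `G // G` to the inertia category of `G`. -/
noncomputable def conjToInertia : TwoFun (HomotopyQuotient G (Conj G)) (Inertia G) :=
  TwoFun.mk' (fun x => ⟨x.as⟩) conjToInertiaMap
    (fun a => Inertia.homMk_eq (A := G) a.hom (ofConjHom_naturality (G := G) a.w))
    (fun x => congrArg (Inertia.homMk (A := G) (𝟙_ G)) (ofConjHom_id (G := G) x.as))
    (fun p q => congrArg (Inertia.homMk (A := G) (q.obj ⊗ p.obj))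
      (ofConjHom_comp (G := G) p.hom q.hom))

/-- The 1-morphism of `G // G` corresponding to a morphism `g ⊗ x ⟶ y ⊗ g`. -/
noncomputable def conjMk {x y g : G} (c : g ⊗ x ⟶ y ⊗ g) :
    (⟨x⟩ : HomotopyQuotient G (Conj G)) ⟶ ⟨y⟩ :=
  HomotopyQuotient.Hom.mk g (toConjHom (G := G) (x := x) (y := y) c)

lemma conjToInertia_map_conjMk {x y g : G} (c : g ⊗ x ⟶ y ⊗ g) :
    (conjToInertia G).map (conjMk c) = Inertia.homMk g c :=
  congrArg (Inertia.homMk g) (ofConjHom_toConjHom c)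

lemma exists_conjMk {x y : G} (p : (⟨x⟩ : HomotopyQuotient G (Conj G)) ⟶ ⟨y⟩) :
    ∃ (g : G) (c : g ⊗ x ⟶ y ⊗ g), p = conjMk c :=
  ⟨p.obj, ofConjHom (G := G) p.hom,
    congrArg (HomotopyQuotient.Hom.mk p.obj) (toConjHom_ofConjHom (G := G) p.hom).symm⟩

-- Only faithfulness needs an argument: equal classes give an intertwiner, and
-- `toConjHom_naturality` makes it a 2-morphism of `G // G`.
variable (G) in
lemma conjToInertia_isHomotopyEquivalence : (conjToInertia G).IsHomotopyEquivalence where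
  essSurj h := ⟨⟨h.as⟩, ⟨Iso.refl _⟩⟩
  full {x y} m := by
    obtain ⟨g, c, rfl⟩ := Inertia.homMk_surjective (A := G) m
    exact ⟨_, conjToInertia_map_conjMk c⟩
  faithful {x y} p q w := by
    obtain ⟨g, c, rfl⟩ := exists_conjMk p
    obtain ⟨h, d, rfl⟩ := exists_conjMk q
    obtain ⟨a, ha⟩ := Inertia.exists_of_homMk_eq
      ((conjToInertia_map_conjMk c).symm.trans (w.trans (conjToInertia_map_conjMk d)))
    exact ⟨HomotopyQuotient.Hom₂.mk a (toConjHom_naturality (G := G) ha)⟩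

end

end TwoGroupFourier

namespace TwoGroupFourier

open TwoGroup

/-! ### Coherent integer powers in a 2-group -/

section

/-- The step is an equivalence so that it also reaches negative exponents. Below it comes from
injectivity of whiskering with an invertible object. -/
lemma int_induction {p : ℤ → Prop} (zero : p 0) (step : ∀ n, p n ↔ p (n + 1)) (n : ℤ) : p n := by
  induction n with
  | zero => exact zero
  | succ n h => exact (step n).1 h
  | pred n h => exact (step _).2 (by simpa using h)

/-- Bijectivity of the steps allows the recursion to run backwards from `0` as well. -/
lemma exists_int_rec {H : ℤ → Type*} (s : ∀ n, H n → H (n + 1))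
    (bij : ∀ n, Function.Bijective (s n)) (a : H 0) :
    ∃ h : ∀ n, H n, h 0 = a ∧ ∀ n, h (n + 1) = s n (h n) := by
  let e : ∀ n, H n ≃ H (n + 1) := fun n => Equiv.ofBijective (s n) (bij n)
  let f : ∀ n : ℕ, H n := fun n => Nat.rec (motive := fun n : ℕ => H n) a (fun n x => s n x) n
  let c : ∀ {m n : ℤ}, m = n → H m → H n := fun h x => h ▸ x
  let b : ∀ n : ℕ, H (-(n : ℤ)) := fun n => Nat.rec (motive := fun n : ℕ => H (-(n : ℤ))) a
    (fun n x => (e _).symm (c (show -(n : ℤ) = -((n + 1 : ℕ) : ℤ) + 1 by push_cast; ring) x)) n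
  -- The recursion equation at negative integers, stated for any `m` with `m + 1 = -n` so that the
  -- transport `c` disappears by substitution.
  have hb : ∀ (n : ℕ) (m : ℤ) (hm : m + 1 = -(n : ℤ)),
      s m (c (show -((n + 1 : ℕ) : ℤ) = m by push_cast; omega) (b (n + 1))) =
        c hm.symm (b n) := by
    intro n m hm
    obtain rfl : m = -((n + 1 : ℕ) : ℤ) := by push_cast; omega
    exact (e _).apply_symm_apply _
  refine ⟨fun n => match n with
    | Int.ofNat n => f n
    | Int.negSucc n => b (n + 1), rfl, fun n => ?_⟩
  match n with
  | Int.ofNat n => rfl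
  | Int.negSucc 0 => exact (hb 0 (Int.negSucc 0) rfl).symm
  | Int.negSucc (n + 1) => exact (hb (n + 1) (Int.negSucc (n + 1)) rfl).symm

variable (G : Type u) [Groupoid.{v} G] [MonoidalCategory G]

/-- Coherent integer powers in a monoidal groupoid. -/
structure IntPow where
  /-- The powers. -/
  pow : ℤ → G
  /-- The comparison for the exponent zero. -/
  unit : pow 0 ⟶ 𝟙_ G
  /-- The comparison for sums of exponents. -/
  mul : ∀ {m n k : ℤ}, m + n = k → (pow k ⟶ pow n ⊗ pow m)
  mul_mul : ∀ {l m n lm mn k : ℤ} (h₁ : l + m = lm) (h₂ : m + n = mn) (h₃ : lm + n = k)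
    (h₄ : l + mn = k),
    mul h₃ ≫ pow n ◁ mul h₁ = mul h₄ ≫ mul h₂ ▷ pow l ≫ (α_ _ _ _).hom
  mul_zero : ∀ m : ℤ, mul (add_zero m) ≫ unit ▷ pow m = (λ_ _).inv
  zero_mul : ∀ m : ℤ, mul (zero_add m) ≫ pow m ◁ unit = (ρ_ _).inv

variable {G}

/-- Powers are iterated left multiplications by `x`, or by an inverse `y` for negative exponents.
The isomorphisms are arbitrary; coherence is obtained in `exists_intPow`. -/
lemma exists_int_sequence [TwoGroup G] (x : G) :
    ∃ (P : ℤ → G) (_ : ∀ n, P (n + 1) ≅ x ⊗ P n), Nonempty (P 0 ≅ 𝟙_ G) := by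
  obtain ⟨y, ⟨e⟩, -⟩ := TwoGroup.exists_inverse x
  let P : ℤ → G
    | Int.ofNat n => (fun z => x ⊗ z)^[n] (𝟙_ G)
    | Int.negSucc n => (fun z => y ⊗ z)^[n + 1] (𝟙_ G)
  have key : ∀ z : G, z ≅ x ⊗ (y ⊗ z) := fun z =>
    (λ_ z).symm ≪≫ whiskerRightIso e.symm z ≪≫ α_ x y z
  refine ⟨P, fun n => Nonempty.some ?_, ⟨Iso.refl _⟩⟩
  match n with
  | Int.ofNat n => exact ⟨eqToIso (Function.iterate_succ_apply' (fun z => x ⊗ z) n (𝟙_ G))⟩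
  | Int.negSucc 0 => exact ⟨key (𝟙_ G)⟩
  | Int.negSucc (n + 1) =>
    refine ⟨?_ ≪≫ eqToIso (congrArg (x ⊗ ·)
      (Function.iterate_succ_apply' (fun z => y ⊗ z) (n + 1) (𝟙_ G)).symm)⟩
    exact key _

/-- Every recursion over `ℤ` below has a step of this shape. Bijectivity gives existence of the
recursive families; injectivity makes identities at `n` and `n + 1` equivalent. -/
lemma conj_whiskerLeft_bijective [TwoGroup G] {x y z a b : G} (f : a ⟶ x ⊗ y) (g : x ⊗ z ⟶ b) :
    Function.Bijective fun h : y ⟶ z => f ≫ x ◁ h ≫ g := by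
  refine ⟨fun h h' w => (TwoGroup.whiskerLeft_bijective x y z).1 ?_, fun h => ?_⟩
  · simpa [cancel_epi, cancel_mono] using w
  · obtain ⟨h', w⟩ := (TwoGroup.whiskerLeft_bijective x y z).2 (inv f ≫ h ≫ inv g)
    refine ⟨h', ?_⟩
    dsimp only at w ⊢
    rw [w]
    simp

lemma conj_whiskerLeft_inj [TwoGroup G] {x y z a b : G} (f : a ⟶ x ⊗ y) (g : x ⊗ z ⟶ b)
    {h h' : y ⟶ z} : f ≫ x ◁ h ≫ g = f ≫ x ◁ h' ≫ g ↔ h = h' :=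
  (conj_whiskerLeft_bijective f g).1.eq_iff

/-- The comparison for `m + n` is built by recursion on `n`, starting from the value forced by one
unit law. Associativity and the other unit law then propagate in both directions along the last
exponent. -/
lemma exists_intPow [TwoGroup G] (x : G) : ∃ p : IntPow G, Nonempty (p.pow 1 ≅ x) := by
  obtain ⟨P, s, ⟨u⟩⟩ := exists_int_sequence x
  have hD : ∀ m : ℤ, ∃ D : ∀ n : ℤ, P (m + n) ⟶ P n ⊗ P m,
      D 0 = eqToHom (by rw [add_zero]) ≫ (λ_ _).inv ≫ u.inv ▷ P m ∧
      ∀ n, D (n + 1) = eqToHom (by rw [add_assoc]) ≫ (s (m + n)).hom ≫ x ◁ D n ≫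
        (α_ _ _ _).inv ≫ (s n).inv ▷ P m := by
    intro m
    exact exists_int_rec (H := fun n => P (m + n) ⟶ P n ⊗ P m)
      (fun n f => eqToHom (by rw [add_assoc]) ≫ (s (m + n)).hom ≫ x ◁ f ≫
        (α_ _ _ _).inv ≫ (s n).inv ▷ P m)
      (fun n => by
        simp only [← Category.assoc (eqToHom _)]
        exact conj_whiskerLeft_bijective _ _) _
  choose D hD₀ hD₁ using hD
  -- Absorbing the equality of exponents into the comparison avoids casts in the identities that
  -- follow.
  let M : ∀ {m n k : ℤ}, m + n = k → (P k ⟶ P n ⊗ P m) :=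
    fun {m n k} h => eqToHom (by rw [h]) ≫ D m n
  have M₀ : ∀ m : ℤ, M (add_zero m) = (λ_ _).inv ≫ u.inv ▷ P m := by
    intro m
    simp [M, hD₀]
  have M₁ : ∀ {m n k : ℤ} (h : m + n = k) (h' : m + (n + 1) = k + 1),
      M h' = (s k).hom ≫ x ◁ M h ≫ (α_ _ _ _).inv ≫ (s n).inv ▷ P m := by
    rintro m n _ rfl h'
    simp [M, hD₁]
  refine ⟨⟨P, u.hom, M, ?_, ?_, ?_⟩,
    ⟨eqToIso (by simp) ≪≫ s 0 ≪≫ whiskerLeftIso x u ≪≫ ρ_ x⟩⟩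
  · intro l m n lm mn k h₁ h₂ h₃ h₄
    induction n using int_induction generalizing mn k with
    | zero =>
      obtain rfl : m = mn := by simpa using h₂
      obtain rfl : k = lm := by simpa using h₃.symm
      obtain rfl : h₃ = add_zero _ := rfl
      rw [M₀ k, show M h₂ = _ from M₀ m]
      calc
        _ = (λ_ _).inv ≫ (u.inv ▷ P k ≫ P 0 ◁ M h₁) := by monoidal
        _ = _ := by rw [← whisker_exchange]; monoidal
    | step n =>
      -- Raising the last exponent by one puts both sides of the associativity law into the same
      -- sandwich around `x ◁ -`, so the laws at `n` and `n + 1` are equivalent.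
      have key : ∀ {mn k : ℤ} (h₂ : m + n = mn) (h₃ : lm + n = k) (h₄ : l + mn = k)
          (h₂' : m + (n + 1) = mn + 1) (h₃' : lm + (n + 1) = k + 1) (h₄' : l + (mn + 1) = k + 1),
          M h₃ ≫ P n ◁ M h₁ = M h₄ ≫ M h₂ ▷ P l ≫ (α_ _ _ _).hom ↔
          M h₃' ≫ P (n + 1) ◁ M h₁ = M h₄' ≫ M h₂' ▷ P l ≫ (α_ _ _ _).hom := by
        intro mn k h₂ h₃ h₄ h₂' h₃' h₄'
        have e₁ : M h₃' ≫ P (n + 1) ◁ M h₁ = (s k).hom ≫ x ◁ (M h₃ ≫ P n ◁ M h₁) ≫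
            (α_ _ _ _).inv ≫ (s n).inv ▷ _ := by
          rw [M₁ h₃ h₃']
          calc
            _ = (s k).hom ≫ x ◁ M h₃ ≫ (α_ _ _ _).inv ≫
              ((s n).inv ▷ _ ≫ P (n + 1) ◁ M h₁) := by monoidal
            _ = _ := by rw [← whisker_exchange]; monoidal
        have e₂ : M h₄' ≫ M h₂' ▷ P l ≫ (α_ _ _ _).hom = (s k).hom ≫
            x ◁ (M h₄ ≫ M h₂ ▷ P l ≫ (α_ _ _ _).hom) ≫ (α_ _ _ _).inv ≫ (s n).inv ▷ _ := by
          rw [M₁ h₄ h₄', M₁ h₂ h₂']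
          calc
            _ = (s k).hom ≫ x ◁ M h₄ ≫ (α_ _ _ _).inv ≫ ((s mn).inv ≫ (s mn).hom) ▷ P l ≫
              (x ◁ M h₂ ≫ (α_ _ _ _).inv ≫ (s n).inv ▷ P m) ▷ P l ≫ (α_ _ _ _).hom := by
                monoidal
            _ = _ := by rw [Iso.inv_hom_id]; monoidal
        rw [e₁, e₂, conj_whiskerLeft_inj]
      constructor
      · intro ih mn k h₂ h₃ h₄
        obtain ⟨mn, rfl⟩ : ∃ t, mn = t + 1 := ⟨mn - 1, by ring⟩
        obtain ⟨k, rfl⟩ : ∃ t, k = t + 1 := ⟨k - 1, by ring⟩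
        have h₂' : m + n = mn := by omega
        have h₃' : lm + n = k := by omega
        have h₄' : l + mn = k := by omega
        exact (key h₂' h₃' h₄' h₂ h₃ h₄).1 (ih h₂' h₃' h₄')
      · intro ih mn k h₂ h₃ h₄
        have h₂' : m + (n + 1) = mn + 1 := by omega
        have h₃' : lm + (n + 1) = k + 1 := by omega
        have h₄' : l + (mn + 1) = k + 1 := by omega
        exact (key h₂ h₃ h₄ h₂' h₃' h₄').2 (ih h₂' h₃' h₄')
  · intro m
    rw [M₀]
    simp [← comp_whiskerRight]
  -- This unit law is not built into the recursion. At `0` it follows from the agreement of the two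
  -- unitors on the unit object.
  · intro m
    induction m using int_induction with
    | zero =>
      rw [show M (zero_add 0) = _ from M₀ 0, Category.assoc, ← whisker_exchange,
        ← leftUnitor_inv_naturality_assoc, unitors_inv_equal, ← rightUnitor_inv_naturality,
        Iso.hom_inv_id_assoc]
    | step n =>
      rw [M₁ (zero_add n) (zero_add (n + 1))]
      have e : ((s n).hom ≫ x ◁ M (zero_add n) ≫ (α_ _ _ _).inv ≫ (s n).inv ▷ P 0) ≫
          P (n + 1) ◁ u.hom = (s n).hom ≫ x ◁ (M (zero_add n) ≫ P n ◁ u.hom) ≫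
          (α_ _ _ _).inv ≫ (s n).inv ▷ 𝟙_ G := by
        calc
          _ = (s n).hom ≫ x ◁ M (zero_add n) ≫ (α_ _ _ _).inv ≫ ((s n).inv ▷ P 0 ≫
            P (n + 1) ◁ u.hom) := by monoidal
          _ = _ := by rw [← whisker_exchange]; monoidal
      have e' : (ρ_ (P (n + 1))).inv = (s n).hom ≫ x ◁ (ρ_ (P n)).inv ≫
          (α_ _ _ _).inv ≫ (s n).inv ▷ 𝟙_ G := by
        rw [← cancel_epi (s n).inv, Iso.inv_hom_id_assoc]
        monoidal
      rw [e, e', conj_whiskerLeft_inj]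

end

end TwoGroupFourier

namespace TwoGroupFourier

open TwoGroup

/-! ### Transformations between coherent powers are determined at exponent one -/

section

variable {G : Type u} [Groupoid.{v} G] [MonoidalCategory G]

namespace IntPow

/-- Compatibility of a family of morphisms `g ⊗ xⁿ ⟶ yⁿ ⊗ g` with the structure of powers. -/
structure IsTrans (p q : IntPow G) (g : G) (S : ∀ n, g ⊗ p.pow n ⟶ q.pow n ⊗ g) : Prop where
  unit : S 0 ≫ q.unit ▷ g = g ◁ p.unit ≫ (ρ_ g).hom ≫ (λ_ g).inv
  mul : ∀ {m n k : ℤ} (h : m + n = k), S k ≫ q.mul h ▷ g =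
    g ◁ p.mul h ≫ (α_ _ _ _).inv ≫ S n ▷ p.pow m ≫ (α_ _ _ _).hom ≫ q.pow n ◁ S m ≫
      (α_ _ _ _).inv

variable {p q : IntPow G} {g : G}

/-- Multiplicativity for a last exponent `1` implies it for all: associativity of both families of
powers allows induction on the last exponent. -/
lemma isTrans_of_rec [TwoGroup G] {S : ∀ n, g ⊗ p.pow n ⟶ q.pow n ⊗ g}
    (unit : S 0 ≫ q.unit ▷ g = g ◁ p.unit ≫ (ρ_ g).hom ≫ (λ_ g).inv)
    (mul : ∀ n, S (n + 1) ≫ q.mul rfl ▷ g =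
      g ◁ p.mul rfl ≫ (α_ _ _ _).inv ≫ S 1 ▷ p.pow n ≫ (α_ _ _ _).hom ≫ q.pow 1 ◁ S n ≫
        (α_ _ _ _).inv) : IsTrans p q g S where
  unit := unit
  mul := by
    intro m n k h
    induction n using int_induction generalizing k with
    | zero =>
      obtain rfl : m = k := by omega
      rw [← cancel_mono ((q.unit ▷ q.pow m) ▷ g)]
      have hq := q.mul_zero m
      have hp := p.mul_zero m
      calc
        _ = S m ≫ (q.mul h ≫ q.unit ▷ q.pow m) ▷ g := by monoidal
        _ = (g ◁ (p.mul h ≫ p.unit ▷ p.pow m)) ≫ 𝟙 _ ⊗≫ (𝟙_ G) ◁ S m ⊗≫ 𝟙 _ := by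
          rw [hq, hp]; monoidal
        _ = g ◁ p.mul h ⊗≫ (g ◁ p.unit ≫ (ρ_ g).hom ≫ (λ_ g).inv) ▷ p.pow m ⊗≫
          (𝟙_ G) ◁ S m ⊗≫ 𝟙 _ := by monoidal
        _ = g ◁ p.mul h ⊗≫ S 0 ▷ p.pow m ⊗≫ (q.unit ▷ (g ⊗ p.pow m) ≫
          (𝟙_ G) ◁ S m) ⊗≫ 𝟙 _ := by rw [← unit]; monoidal
        _ = _ := by rw [← whisker_exchange]; monoidal
    | step n =>
      -- After composing with the invertible comparison for `n + 1`, associativity turns both sides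
      -- into one sandwich around the equation for `n`.
      have key : ∀ {k : ℤ} (h : m + n = k) (h' : m + (n + 1) = k + 1),
          (S k ≫ q.mul h ▷ g =
            g ◁ p.mul h ≫ (α_ _ _ _).inv ≫ S n ▷ p.pow m ≫ (α_ _ _ _).hom ≫ q.pow n ◁ S m ≫
            (α_ _ _ _).inv) ↔
          (S (k + 1) ≫ q.mul h' ▷ g =
            g ◁ p.mul h' ≫ (α_ _ _ _).inv ≫ S (n + 1) ▷ p.pow m ≫ (α_ _ _ _).hom ≫
              q.pow (n + 1) ◁ S m ≫ (α_ _ _ _).inv) := by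
        intro k h h'
        have hq := q.mul_mul h (rfl : n + 1 = n + 1) (rfl : k + 1 = k + 1) h'
        have hp := p.mul_mul h (rfl : n + 1 = n + 1) (rfl : k + 1 = k + 1) h'
        have e₁ : (S (k + 1) ≫ q.mul h' ▷ g) ≫
            (q.mul (rfl : n + 1 = n + 1) ▷ q.pow m ≫ (α_ _ _ _).hom) ▷ g =
            (g ◁ p.mul (rfl : k + 1 = k + 1) ≫ (α_ _ _ _).inv ≫ S 1 ▷ p.pow k ≫
              (α_ _ _ _).hom) ≫ q.pow 1 ◁ (S k ≫ q.mul h ▷ g) ≫ (α_ _ _ _).inv := by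
          calc
            _ = S (k + 1) ≫ (q.mul h' ≫ q.mul (rfl : n + 1 = n + 1) ▷ q.pow m ≫
              (α_ _ _ _).hom) ▷ g := by monoidal
            _ = (S (k + 1) ≫ q.mul (rfl : k + 1 = k + 1) ▷ g) ⊗≫
              (q.pow 1 ◁ q.mul h) ▷ g ⊗≫ 𝟙 _ := by rw [← hq]; monoidal
            _ = _ := by rw [mul]; monoidal
        have e₂ : (g ◁ p.mul h' ≫ (α_ _ _ _).inv ≫ S (n + 1) ▷ p.pow m ≫ (α_ _ _ _).hom ≫
              q.pow (n + 1) ◁ S m ≫ (α_ _ _ _).inv) ≫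
            (q.mul (rfl : n + 1 = n + 1) ▷ q.pow m ≫ (α_ _ _ _).hom) ▷ g =
            (g ◁ p.mul (rfl : k + 1 = k + 1) ≫ (α_ _ _ _).inv ≫ S 1 ▷ p.pow k ≫
              (α_ _ _ _).hom) ≫ q.pow 1 ◁ (g ◁ p.mul h ≫ (α_ _ _ _).inv ≫ S n ▷ p.pow m ≫
              (α_ _ _ _).hom ≫ q.pow n ◁ S m ≫ (α_ _ _ _).inv) ≫ (α_ _ _ _).inv := by
          calc
            _ = g ◁ p.mul h' ⊗≫ S (n + 1) ▷ p.pow m ⊗≫ (q.pow (n + 1) ◁ S m ≫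
              q.mul (rfl : n + 1 = n + 1) ▷ (q.pow m ⊗ g)) ⊗≫ 𝟙 _ := by monoidal
            _ = g ◁ p.mul h' ⊗≫ (S (n + 1) ≫ q.mul (rfl : n + 1 = n + 1) ▷ g) ▷ p.pow m ⊗≫
              (q.pow 1 ⊗ q.pow n) ◁ S m ⊗≫ 𝟙 _ := by rw [whisker_exchange]; monoidal
            _ = g ◁ (p.mul h' ≫ p.mul (rfl : n + 1 = n + 1) ▷ p.pow m ≫ (α_ _ _ _).hom) ⊗≫
              S 1 ▷ p.pow n ▷ p.pow m ⊗≫ q.pow 1 ◁ S n ▷ p.pow m ⊗≫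
              (q.pow 1 ⊗ q.pow n) ◁ S m ⊗≫ 𝟙 _ := by rw [mul]; monoidal
            _ = g ◁ p.mul (rfl : k + 1 = k + 1) ⊗≫ ((g ⊗ p.pow 1) ◁ p.mul h ≫
              S 1 ▷ (p.pow n ⊗ p.pow m)) ⊗≫ q.pow 1 ◁ S n ▷ p.pow m ⊗≫
              (q.pow 1 ⊗ q.pow n) ◁ S m ⊗≫ 𝟙 _ := by rw [← hp]; monoidal
            _ = _ := by rw [whisker_exchange]; monoidal
        rw [← cancel_mono ((q.mul (rfl : n + 1 = n + 1) ▷ q.pow m ≫ (α_ _ _ _).hom) ▷ g),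
          e₁, e₂, conj_whiskerLeft_inj]
      constructor
      · intro ih k h'
        obtain ⟨k, rfl⟩ : ∃ t, k = t + 1 := ⟨k - 1, by ring⟩
        have h : m + n = k := by omega
        exact (key h h').1 (ih h)
      · intro ih k h
        have h' : m + (n + 1) = k + 1 := by omega
        exact (key h h').2 (ih h')

/-- Multiplicativity prescribes `S (n + 1)` from `S n` and `s`, so the family is built by recursion
from the value at `0` forced by the unit condition. -/
lemma exists_isTrans [TwoGroup G] (p q : IntPow G) (g : G) (s : g ⊗ p.pow 1 ⟶ q.pow 1 ⊗ g) :
    ∃ S : ∀ n, g ⊗ p.pow n ⟶ q.pow n ⊗ g, S 1 = s ∧ IsTrans p q g S := by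
  obtain ⟨S, h₀, h₁⟩ := exists_int_rec (H := fun n => g ⊗ p.pow n ⟶ q.pow n ⊗ g)
    (fun n f => (g ◁ p.mul (rfl : n + 1 = n + 1) ≫ (α_ _ _ _).inv ≫ s ▷ p.pow n ≫
      (α_ _ _ _).hom) ≫ q.pow 1 ◁ f ≫ (α_ _ _ _).inv ≫ inv (q.mul (rfl : n + 1 = n + 1)) ▷ g)
    (fun n => conj_whiskerLeft_bijective _ _)
    (g ◁ p.unit ≫ (ρ_ g).hom ≫ (λ_ g).inv ≫ inv q.unit ▷ g)
  have unit : S 0 ≫ q.unit ▷ g = g ◁ p.unit ≫ (ρ_ g).hom ≫ (λ_ g).inv := by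
    rw [h₀]
    simp only [Category.assoc, ← comp_whiskerRight, IsIso.inv_hom_id]
    simp
  have mul : ∀ n, S (n + 1) ≫ q.mul rfl ▷ g =
      g ◁ p.mul rfl ≫ (α_ _ _ _).inv ≫ s ▷ p.pow n ≫ (α_ _ _ _).hom ≫ q.pow 1 ◁ S n ≫
        (α_ _ _ _).inv := by
    intro n
    rw [h₁]
    simp only [Category.assoc, ← comp_whiskerRight, IsIso.inv_hom_id]
    simp
  -- The recursion starts at `0`, so the value at `1` must be computed: it is the step from `0` to
  -- `0 + 1`, simplified by the unit laws of both powers.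
  have one : S 1 = s := by
    have h := congrArg (· ≫ (q.pow 1 ◁ q.unit) ▷ g) (mul 0)
    rw [← cancel_mono ((ρ_ (q.pow 1)).inv ▷ g), ← q.zero_mul 1]
    have hp := p.zero_mul 1
    calc
      _ = (S (0 + 1) ≫ q.mul (zero_add 1) ▷ g) ≫ (q.pow 1 ◁ q.unit) ▷ g := by simp
      _ = g ◁ p.mul (zero_add 1) ⊗≫ s ▷ p.pow 0 ⊗≫ q.pow 1 ◁ (S 0 ≫ q.unit ▷ g) ⊗≫ 𝟙 _ := by
        rw [mul 0]; monoidal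
      _ = g ◁ p.mul (zero_add 1) ⊗≫ (s ▷ p.pow 0 ≫ (q.pow 1 ⊗ g) ◁ p.unit) ⊗≫ 𝟙 _ := by
        rw [unit]; monoidal
      _ = g ◁ (p.mul (zero_add 1) ≫ p.pow 1 ◁ p.unit) ⊗≫ s ⊗≫ 𝟙 _ := by
        rw [← whisker_exchange]; monoidal
      _ = _ := by rw [hp, q.zero_mul 1]; monoidal
  exact ⟨S, one, isTrans_of_rec unit (by rwa [one])⟩

/-- By multiplicativity of `S` and `T` and the relation at `1`, both sides at `n + 1` are the same
sandwich of the sides at `n`. -/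
lemma IsTrans.naturality [TwoGroup G] {h : G} {S : ∀ n, g ⊗ p.pow n ⟶ q.pow n ⊗ g}
    {T : ∀ n, h ⊗ p.pow n ⟶ q.pow n ⊗ h} (hS : IsTrans p q g S) (hT : IsTrans p q h T)
    {a : g ⟶ h} (w : a ▷ p.pow 1 ≫ T 1 = S 1 ≫ q.pow 1 ◁ a) (n : ℤ) :
    a ▷ p.pow n ≫ T n = S n ≫ q.pow n ◁ a := by
  induction n using int_induction with
  | zero =>
    rw [← cancel_mono (q.unit ▷ h)]
    calc
      _ = a ▷ p.pow 0 ≫ (T 0 ≫ q.unit ▷ h) := by simp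
      _ = (S 0 ≫ q.unit ▷ g) ≫ 𝟙_ G ◁ a := by
        rw [hT.unit, hS.unit, ← whisker_exchange_assoc]; monoidal
      _ = _ := by rw [Category.assoc, Category.assoc, whisker_exchange]
  | step n =>
    have e₁ : (a ▷ p.pow (n + 1) ≫ T (n + 1)) ≫ q.mul (rfl : n + 1 = n + 1) ▷ h =
        (g ◁ p.mul (rfl : n + 1 = n + 1) ≫ (α_ _ _ _).inv ≫ S 1 ▷ p.pow n ≫ (α_ _ _ _).hom) ≫
          q.pow 1 ◁ (a ▷ p.pow n ≫ T n) ≫ (α_ _ _ _).inv := by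
      calc
        _ = (a ▷ p.pow (n + 1) ≫ h ◁ p.mul (rfl : n + 1 = n + 1)) ⊗≫ T 1 ▷ p.pow n ⊗≫
            q.pow 1 ◁ T n ⊗≫ 𝟙 _ := by
          rw [Category.assoc, hT.mul]; monoidal
        _ = g ◁ p.mul (rfl : n + 1 = n + 1) ⊗≫ (a ▷ p.pow 1 ≫ T 1) ▷ p.pow n ⊗≫
            q.pow 1 ◁ T n ⊗≫ 𝟙 _ := by rw [← whisker_exchange]; monoidal
        _ = _ := by rw [w]; monoidal
    have e₂ : (S (n + 1) ≫ q.pow (n + 1) ◁ a) ≫ q.mul (rfl : n + 1 = n + 1) ▷ h =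
        (g ◁ p.mul (rfl : n + 1 = n + 1) ≫ (α_ _ _ _).inv ≫ S 1 ▷ p.pow n ≫ (α_ _ _ _).hom) ≫
          q.pow 1 ◁ (S n ≫ q.pow n ◁ a) ≫ (α_ _ _ _).inv := by
      calc
        _ = (S (n + 1) ≫ q.mul (rfl : n + 1 = n + 1) ▷ g) ≫ (q.pow 1 ⊗ q.pow n) ◁ a := by
          rw [Category.assoc, Category.assoc, whisker_exchange]
        _ = _ := by rw [hS.mul]; monoidal
    rw [← cancel_mono (q.mul (rfl : n + 1 = n + 1) ▷ h), e₁, e₂, conj_whiskerLeft_inj]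

end IntPow

end

end TwoGroupFourier

namespace TwoGroupFourier

open TwoGroup

/-! ### Loops and the inertia category -/

section

variable {B C : Type*} [Bicategory B] [Bicategory C] (F : Pseudofunctor B C)

/-- The 2-morphisms `p`, `q`, `r`, `s` stand for equalities between sums of exponents. In `Bℤ` the
hypothesis `w` is automatic, and the conclusion becomes the associativity law of `Loop.intPow`. -/
lemma mapComp_assoc_of_eq {a b c d : B} {l : a ⟶ b} {m : b ⟶ c} {n : c ⟶ d} {lm : a ⟶ c}
    {mn : b ⟶ d} {k : a ⟶ d} (p : k ⟶ lm ≫ n) (q : lm ⟶ l ≫ m) (r : k ⟶ l ≫ mn) (s : mn ⟶ m ≫ n)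
    (w : p ≫ Bicategory.whiskerRight q n ≫ (Bicategory.associator l m n).hom =
      r ≫ Bicategory.whiskerLeft l s) :
    (F.map₂ p ≫ (F.mapComp lm n).hom) ≫
        Bicategory.whiskerRight (F.map₂ q ≫ (F.mapComp l m).hom) (F.map n) =
      (F.map₂ r ≫ (F.mapComp l mn).hom) ≫
        Bicategory.whiskerLeft (F.map l) (F.map₂ s ≫ (F.mapComp m n).hom) ≫
          (Bicategory.associator _ _ _).inv := by
  have h := congrArg F.map₂ w
  rw [F.map₂_comp, F.map₂_comp, F.map₂_comp, F.map₂_whisker_left, F.map₂_whisker_right,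
    F.map₂_associator] at h
  rw [← cancel_mono ((Bicategory.associator _ _ _).hom ≫
    Bicategory.whiskerLeft (F.map l) (F.mapComp m n).inv ≫ (F.mapComp l (m ≫ n)).inv)]
  simpa using h

lemma map₂_comp_of_eq_id {a b : B} {f : a ⟶ b} (p : f ⟶ f) (w : p = 𝟙 f) {g : F.obj a ⟶ F.obj b}
    (q : F.map f ⟶ g) : F.map₂ p ≫ q = q := by
  rw [w, F.map₂_id, Category.id_comp]

lemma naturality_of_eq_id {F F' : Pseudofunctor B C} {a b : B} {f : a ⟶ b} (p : f ⟶ f)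
    (w : p = 𝟙 f) {x : F.obj a ⟶ F'.obj a} {y : F.obj b ⟶ F'.obj b}
    (q : F.map f ≫ y ⟶ x ≫ F'.map f) :
    Bicategory.whiskerRight (F.map₂ p) y ≫ q = q ≫ Bicategory.whiskerLeft x (F'.map₂ p) := by
  rw [w, F.map₂_id, F'.map₂_id, Bicategory.id_whiskerRight, Bicategory.whiskerLeft_id,
    Category.id_comp, Category.comp_id]

lemma mapComp_id_of_eq {a b : B} {m : a ⟶ b} (p : m ⟶ m ≫ 𝟙 b)
    (w : p ≫ (Bicategory.rightUnitor m).hom = 𝟙 _) :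
    (F.map₂ p ≫ (F.mapComp m (𝟙 b)).hom) ≫ Bicategory.whiskerLeft (F.map m) (F.mapId b).hom =
      (Bicategory.rightUnitor _).inv := by
  have h := congrArg F.map₂ w
  rw [F.map₂_comp, F.map₂_right_unitor, F.map₂_id] at h
  rw [← cancel_mono (Bicategory.rightUnitor _).hom]
  simpa using h

lemma id_mapComp_of_eq {a b : B} {m : a ⟶ b} (p : m ⟶ 𝟙 a ≫ m)
    (w : p ≫ (Bicategory.leftUnitor m).hom = 𝟙 _) :
    (F.map₂ p ≫ (F.mapComp (𝟙 a) m).hom) ≫ Bicategory.whiskerRight (F.mapId a).hom (F.map m) =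
      (Bicategory.leftUnitor _).inv := by
  have h := congrArg F.map₂ w
  rw [F.map₂_comp, F.map₂_left_unitor, F.map₂_id] at h
  rw [← cancel_mono (Bicategory.leftUnitor _).hom]
  simpa using h

end

section

variable {G : Type u} [Groupoid.{v} G] [MonoidalCategory G]

namespace IntPow

variable (p : IntPow G)

lemma eqToHom_mul {m n k k' : ℤ} (h : m + n = k) (h' : k' = k) :
    eqToHom (congrArg p.pow h') ≫ p.mul h = p.mul (h.trans h'.symm) := by
  subst h'
  exact Category.id_comp _

/-- The next five lemmas are the pseudofunctor axioms needed in `Loop.ofIntPow`. Left and right are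
exchanged because composition in `BG` is the reversed tensor product. -/
lemma eqToHom_whiskerRight (m : ℤ) {n n' : ℤ} (h : n = n') :
    eqToHom (congrArg p.pow (congrArg (m + ·) h)) = p.mul (rfl : m + n = m + n) ≫
      eqToHom (congrArg p.pow h) ▷ p.pow m ≫ inv (p.mul (rfl : m + n' = m + n')) := by
  subst h
  simp

lemma whiskerLeft_eqToHom (n : ℤ) {m m' : ℤ} (h : m = m') :
    eqToHom (congrArg p.pow (congrArg (· + n) h)) = p.mul (rfl : m + n = m + n) ≫
      p.pow n ◁ eqToHom (congrArg p.pow h) ≫ inv (p.mul (rfl : m' + n = m' + n)) := by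
  subst h
  simp

lemma eqToHom_assoc (l m n : ℤ) : eqToHom (congrArg p.pow (add_assoc l m n)) =
    p.mul rfl ≫ p.pow n ◁ p.mul rfl ≫ (α_ _ _ _).inv ≫ inv (p.mul rfl) ▷ p.pow l ≫
      inv (p.mul (rfl : l + (m + n) = l + (m + n))) := by
  have e := p.eqToHom_mul (rfl : l + (m + n) = l + (m + n)) (add_assoc l m n)
  have w := p.mul_mul (rfl : l + m = l + m) (rfl : m + n = m + n) (rfl : l + m + n = l + m + n)
    (add_assoc l m n).symm
  rw [← cancel_mono (p.mul (rfl : l + (m + n) = l + (m + n))),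
    ← cancel_mono (p.mul (rfl : m + n = m + n) ▷ p.pow l ≫ (α_ _ _ _).hom), e, ← w]
  simp only [Category.assoc, IsIso.inv_hom_id_assoc]
  rw [← comp_whiskerRight_assoc, IsIso.inv_hom_id, id_whiskerRight, Category.id_comp,
    Iso.inv_hom_id, Category.comp_id]

lemma eqToHom_zero_add (n : ℤ) : eqToHom (congrArg p.pow (zero_add n)) =
    p.mul rfl ≫ p.pow n ◁ p.unit ≫ (ρ_ _).hom := by
  have e := p.eqToHom_mul (zero_add n) (zero_add n)
  have w := p.zero_mul n
  calc
    _ = eqToHom (congrArg p.pow (zero_add n)) ≫ (ρ_ _).inv ≫ (ρ_ _).hom := by simp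
    _ = (eqToHom (congrArg p.pow (zero_add n)) ≫ p.mul (zero_add n)) ≫ p.pow n ◁ p.unit ≫
        (ρ_ _).hom := by rw [← w]; simp only [Category.assoc]
    _ = _ := by rw [e]

lemma eqToHom_add_zero (n : ℤ) : eqToHom (congrArg p.pow (add_zero n)) =
    p.mul rfl ≫ p.unit ▷ p.pow n ≫ (λ_ _).hom := by
  have e := p.eqToHom_mul (add_zero n) (add_zero n)
  have w := p.mul_zero n
  calc
    _ = eqToHom (congrArg p.pow (add_zero n)) ≫ (λ_ _).inv ≫ (λ_ _).hom := by simp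
    _ = (eqToHom (congrArg p.pow (add_zero n)) ≫ p.mul (add_zero n)) ≫ p.unit ▷ p.pow n ≫
        (λ_ _).hom := by rw [← w]; simp only [Category.assoc]
    _ = _ := by rw [e]

end IntPow

/-- An integer as a 1-morphism of `Bℤ`. -/
abbrev intHom (n : ℤ) :
    (MonoidalSingleObj.star (Discrete ℤ)) ⟶ (MonoidalSingleObj.star (Discrete ℤ)) :=
  (Discrete.mk n : Discrete ℤ)

lemma intHom₂_subsingleton {a b : MonoidalSingleObj (Discrete ℤ)} {f g : a ⟶ b} (η θ : f ⟶ g) :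
    η = θ :=
  Subsingleton.elim (α := (show Discrete ℤ from f) ⟶ (show Discrete ℤ from g)) η θ

/-- An equality of integers as a 2-morphism of `Bℤ`. -/
abbrev intHomEq {m n k : ℤ} (h : m + n = k) : intHom k ⟶ intHom m ≫ intHom n :=
  Discrete.eqToHom h.symm

/-- The coherent powers of a loop. -/
def Loop.intPow (φ : Loop G) : IntPow G where
  pow n := MonoidalOpposite.unmop (C := G) (φ.toPseudofunctor.map (intHom n))
  unit := ((φ.toPseudofunctor.mapId (MonoidalSingleObj.star (Discrete ℤ))).hom :
    (φ.toPseudofunctor.map (intHom 0) : Gᴹᵒᵖ) ⟶ 𝟙_ Gᴹᵒᵖ).unmop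
  mul {m n _} h := ((φ.toPseudofunctor.map₂ (intHomEq h) ≫
    (φ.toPseudofunctor.mapComp (intHom m) (intHom n)).hom :
      _ ⟶ (φ.toPseudofunctor.map (intHom m) ⊗ φ.toPseudofunctor.map (intHom n) : Gᴹᵒᵖ))).unmop
  mul_mul h₁ h₂ h₃ h₄ := congrArg Quiver.Hom.unmop (mapComp_assoc_of_eq φ.toPseudofunctor
    (intHomEq h₃) (intHomEq h₁) (intHomEq h₄) (intHomEq h₂) (intHom₂_subsingleton _ _))
  mul_zero m := congrArg Quiver.Hom.unmop (mapComp_id_of_eq φ.toPseudofunctor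
    (intHomEq (add_zero m)) (intHom₂_subsingleton _ _))
  zero_mul m := congrArg Quiver.Hom.unmop (id_mapComp_of_eq φ.toPseudofunctor
    (intHomEq (zero_add m)) (intHom₂_subsingleton _ _))

/-- The structure morphisms of a 1-morphism of loops. -/
def Loop.transHom {φ ψ : Loop G} (α : φ ⟶ ψ) (n : ℤ) :
    Loop.component α ⊗ φ.intPow.pow n ⟶ ψ.intPow.pow n ⊗ Loop.component α :=
  MonoidalOpposite.unmop ((toStrongTrans α).naturality (intHom n)).hom

lemma Loop.intPow_mul_rfl (φ : Loop G) (m n : ℤ) : φ.intPow.mul (rfl : m + n = m + n) =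
    (φ.toPseudofunctor.mapComp (intHom m) (intHom n)).hom.unmop :=
  congrArg Quiver.Hom.unmop (map₂_comp_of_eq_id φ.toPseudofunctor
    (intHomEq (rfl : m + n = m + n)) (intHom₂_subsingleton _ _) _)

lemma Loop.transHom_isTrans {φ ψ : Loop G} (α : φ ⟶ ψ) :
    φ.intPow.IsTrans ψ.intPow (Loop.component α) (Loop.transHom α) where
  unit := congrArg Quiver.Hom.unmop
    ((toStrongTrans α).naturality_id (MonoidalSingleObj.star (Discrete ℤ)))
  mul {m n k} h := by
    obtain rfl := h
    rw [Loop.intPow_mul_rfl, Loop.intPow_mul_rfl]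
    exact congrArg Quiver.Hom.unmop
      ((toStrongTrans α).naturality_comp (intHom m) (intHom n))

/-- A 1-morphism of loops from its structure morphisms. -/
noncomputable def Loop.homMk {φ ψ : Loop G} {g : G}
    {S : ∀ n, g ⊗ φ.intPow.pow n ⟶ ψ.intPow.pow n ⊗ g}
    (hS : φ.intPow.IsTrans ψ.intPow g S) : φ ⟶ ψ :=
  show Pseudofunctor.StrongTrans φ.toPseudofunctor ψ.toPseudofunctor from
  { app := fun _ => MonoidalOpposite.mop g
    naturality := fun f => (asIso (S (Discrete.as f))).mop
    naturality_naturality := by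
      intro a b f g η
      obtain rfl : f = g := Discrete.ext (Discrete.eq_of_hom η)
      exact naturality_of_eq_id η (intHom₂_subsingleton _ _) _
    naturality_id := fun _ => congrArg Quiver.Hom.mop hS.unit
    naturality_comp := fun {_ _ _} m n => by
      have h := hS.mul (rfl : Discrete.as m + Discrete.as n = Discrete.as m + Discrete.as n)
      rw [Loop.intPow_mul_rfl, Loop.intPow_mul_rfl] at h
      exact congrArg Quiver.Hom.mop h }

/-- A 2-morphism of loops. -/
def Loop.hom₂Mk {φ ψ : Loop G} {α β : φ ⟶ ψ} (a : Loop.component α ⟶ Loop.component β)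
    (w : ∀ n, a ▷ φ.intPow.pow n ≫ Loop.transHom β n =
      Loop.transHom α n ≫ ψ.intPow.pow n ◁ a) : α ⟶ β :=
  ⟨{ app := fun _ => a.mop
     naturality := fun f => congrArg Quiver.Hom.mop (w (Discrete.as f)) }⟩

/-- A loop from coherent powers. -/
noncomputable def Loop.ofIntPow (p : IntPow G) : Loop G :=
  show Pseudofunctor (MonoidalSingleObj (Discrete ℤ)) (Deloop G) from
  { obj := fun _ => MonoidalSingleObj.star _
    map := fun f => MonoidalOpposite.mop (p.pow (Discrete.as f))
    map₂ := fun η => (eqToHom (congrArg p.pow (Discrete.eq_of_hom η))).mop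
    mapId := fun _ => (asIso p.unit).mop
    mapComp := fun f g => (asIso (p.mul (rfl : Discrete.as f + Discrete.as g = _))).mop
    map₂_id := fun _ => rfl
    map₂_comp := fun η θ => congrArg Quiver.Hom.mop
      (eqToHom_trans (congrArg p.pow (Discrete.eq_of_hom η))
        (congrArg p.pow (Discrete.eq_of_hom θ))).symm
    map₂_whisker_left := fun f _ _ η => congrArg Quiver.Hom.mop
      (p.eqToHom_whiskerRight (Discrete.as f) (Discrete.eq_of_hom η))
    map₂_whisker_right := fun η f => congrArg Quiver.Hom.mop
      (p.whiskerLeft_eqToHom (Discrete.as f) (Discrete.eq_of_hom η))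
    map₂_associator := fun f g h => congrArg Quiver.Hom.mop
      (p.eqToHom_assoc (Discrete.as f) (Discrete.as g) (Discrete.as h))
    map₂_left_unitor := fun f => congrArg Quiver.Hom.mop (p.eqToHom_zero_add (Discrete.as f))
    map₂_right_unitor := fun f => congrArg Quiver.Hom.mop (p.eqToHom_add_zero (Discrete.as f)) }

variable (G) in
/-- The 2-functor from loops to the inertia category, evaluation at `1`. -/
def loopToInertia : TwoFun (Loop G) (Inertia G) :=
  TwoFun.mk' (fun φ => ⟨φ.base⟩)
    (fun α => Inertia.homMk (Loop.component α) (Loop.structureHom α))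
    (fun a => Inertia.homMk_eq (a.as.app (MonoidalSingleObj.star _)).unmop
      (congrArg Quiver.Hom.unmop (a.as.naturality (intHom 1))))
    (fun φ => by
      rw [← Inertia.homMk_id]
      rfl)
    (fun α β => by
      rw [Inertia.homMk_comp]
      rfl)

-- This is the freeness of `ℤ` on one generator, one categorical level up: coherent powers give
-- essential surjectivity, extension from exponent one gives fullness, and propagation of
-- intertwiners gives faithfulness.
variable (G) in
lemma loopToInertia_isHomotopyEquivalence [TwoGroup G] :
    (loopToInertia G).IsHomotopyEquivalence where
  essSurj h := by
    obtain ⟨p, ⟨e⟩⟩ := exists_intPow h.as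
    exact ⟨Loop.ofIntPow p, Inertia.exists_iso (G := G) (x := p.pow 1) e.hom⟩
  full {φ ψ} m := by
    obtain ⟨g, c, rfl⟩ := Inertia.homMk_surjective (A := G) m
    obtain ⟨S, rfl, hS⟩ := IntPow.exists_isTrans φ.intPow ψ.intPow g c
    exact ⟨Loop.homMk hS, rfl⟩
  faithful {φ ψ} α β w := by
    obtain ⟨a, ha⟩ := Inertia.exists_of_homMk_eq w
    exact ⟨Loop.hom₂Mk a
      ((Loop.transHom_isTrans α).naturality (Loop.transHom_isTrans β) ha)⟩

end
end TwoGroupFourier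

namespace TwoGroupFourier

open TwoGroup

/-! ### Restriction to the 2-group and evaluation of loops, via the inertia category -/

section

variable (G : Type u) [Groupoid.{v} G] [MonoidalCategory G]

/-- The functor from a monoidal groupoid to its inertia category. -/
def Inertia.inclusion : G ⥤ Inertia G where
  obj x := ⟨x⟩
  map f := Inertia.homMk (𝟙_ G) ((λ_ _).hom ≫ f ≫ (ρ_ _).inv)
  map_id x := by
    rw [Category.id_comp]
    exact Inertia.homMk_id x
  map_comp {x y z} f g := by
    rw [Inertia.homMk_comp]
    refine (Inertia.homMk_eq (λ_ (𝟙_ G)).hom ?_).symm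
    calc
      _ = 𝟙 _ ⊗≫ f ⊗≫ g ⊗≫ 𝟙 _ := by monoidal
      _ = _ := by monoidal

variable [TwoGroup G]

-- This identifies the map from `G` to `G // G` with `Inertia.inclusion`; after applying the
-- injective `toConjHom`, `f` slides past the cancellation of the unit.
variable {G} in
lemma ofConjHom_conjUnit_comp {x y : G} (f : x ⟶ y) :
    ofConjHom ((conjUnit x).hom ≫ f) = (λ_ x).hom ≫ f ≫ (ρ_ y).inv := by
  apply (toConjHom_bijective _ _ _).1
  rw [toConjHom_ofConjHom, ← toConjHom_id, toConjHom, toConjHom]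
  calc
    _ = ((λ_ x).hom ≫ (ρ_ x).inv) ▷ dual (𝟙_ G) ⊗≫ (x ◁ coevInv (𝟙_ G) ≫ f ▷ 𝟙_ G) ⊗≫ 𝟙 _ := by
      monoidal
    _ = _ := by rw [whisker_exchange]; monoidal

lemma conjToInertia_map_ofHom {x y : G} (f : x ⟶ y) : (conjToInertia G).map
    (HomotopyQuotient.ofHom (M := G) (C := Conj G) f) = (Inertia.inclusion G).map f :=
  congrArg (Inertia.homMk (𝟙_ G)) (ofConjHom_conjUnit_comp f)

/-- `Loop.toConj α` is by definition `conjMk` of the structure morphism of `α`. The compatibility of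
`E₂` with 1-morphisms reduces to this. -/
lemma conjToInertia_map_toConj {φ ψ : Loop G} (α : φ ⟶ ψ) :
    (conjToInertia G).map (Loop.toConj α) = (loopToInertia G).map α :=
  conjToInertia_map_conjMk (Loop.structureHom α)

/-- The restriction of functors along `G ⟶ G // G` in terms of the inertia category. -/
noncomputable def precompRestrictIso (D : Type*) [Category D] :
    ((conjToInertia_isHomotopyEquivalence G).precomp D).functor ⋙
        HomotopyQuotient.restrict G (Conj G) D ≅
      (Functor.whiskeringLeft _ _ D).obj (Inertia.inclusion G) :=
  NatIso.ofComponents (fun L => NatIso.ofComponents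
      (F := (HomotopyQuotient.restrict G (Conj G) D).obj
        (((conjToInertia_isHomotopyEquivalence G).precomp D).functor.obj L))
      (G := Inertia.inclusion G ⋙ L)
      (fun x => Iso.refl (L.obj ⟨x⟩))
      (fun f => by
        refine (Category.comp_id _).trans (Eq.trans ?_ (Category.id_comp _).symm)
        exact congrArg L.map (conjToInertia_map_ofHom G f)))
    (fun a => by
      ext x
      exact (Category.comp_id _).trans (Category.id_comp _).symm)

/-- The equivalence between functors on `G // G` and on loops. -/
noncomputable def conjEquivLoop (D : Type*) [Category D] :
    TwoFun (HomotopyQuotient G (Conj G)) D ≌ TwoFun (Loop G) D :=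
  ((conjToInertia_isHomotopyEquivalence G).precomp D).symm.trans
    ((loopToInertia_isHomotopyEquivalence G).precomp D)

/-- The equivalence `conjEquivLoop` is given by evaluation of loops at `1`. -/
noncomputable def conjEquivLoopEval (D : Type*) [Category D] (φ : Loop G) :
    (conjEquivLoop G D).functor ⋙ TwoFun.evalAt D φ ≅
      TwoFun.evalAt D (⟨φ.base⟩ : HomotopyQuotient G (Conj G)) :=
  NatIso.ofComponents
    -- The value of the left side at `F` is definitionally that of the inverse of `precomp` at
    -- `φ(1)`, so the counit component there is the required isomorphism.
    (fun F => (TwoFun.evalAt D (⟨φ.base⟩ : HomotopyQuotient G (Conj G))).mapIso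
      (((conjToInertia_isHomotopyEquivalence G).precomp D).counitIso.app F))
    (fun {F F'} a => by
      refine Eq.trans ?_ ((TwoFun.evalAt D (⟨φ.base⟩ : HomotopyQuotient G (Conj G))).congr_map
        (((conjToInertia_isHomotopyEquivalence G).precomp D).counitIso.hom.naturality a))
      rfl)

/-- This is naturality of the counit component along `Loop.toConj α`, combined with the agreement of
both 2-functors to the inertia category on `α`. -/
lemma conjEquivLoopEval_naturality (D : Type*) [Category D] {φ ψ : Loop G} (α : φ ⟶ ψ) :
    (conjEquivLoopEval G D φ).hom ≫ TwoFun.evalMap D (Loop.toConj α) =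
      Functor.whiskerLeft (conjEquivLoop G D).functor (TwoFun.evalMap D α) ≫
        (conjEquivLoopEval G D ψ).hom := by
  ext F
  have h := TwoFun.naturality
    (((conjToInertia_isHomotopyEquivalence G).precomp D).counitIso.hom.app F) (Loop.toConj α)
  refine h.symm.trans ?_
  refine congrArg (· ≫ TwoFun.app
    (((conjToInertia_isHomotopyEquivalence G).precomp D).counitIso.hom.app F) ⟨ψ.base⟩) ?_
  exact congrArg (((conjToInertia_isHomotopyEquivalence G).precomp D).inverse.obj F).map
    (conjToInertia_map_toConj G α)

/-- A formal reduction: the Fourier compatibility may be checked on functors on the inertia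
category, because the inverses of the two equivalences cancel through their counits. -/
lemma nonempty_restrict_iso (D D' : Type*) [Category D] [Category D'] (T : D ⥤ D')
    {A : Type*} [Category A] (K : A ≌ (Inertia G ⥤ D)) (N : A ⥤ G ⥤ D')
    (h : Nonempty (K.functor ⋙ (Functor.whiskeringLeft _ _ D).obj (Inertia.inclusion G) ⋙
      (Functor.whiskeringRight _ _ _).obj T ≅ N)) :
    Nonempty (HomotopyQuotient.restrict G (Conj G) D ⋙ (Functor.whiskeringRight _ _ _).obj T ≅
      (((conjToInertia_isHomotopyEquivalence G).precomp D).symm.trans K.symm).functor ⋙ N) := by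
  obtain ⟨e⟩ := h
  let P := (conjToInertia_isHomotopyEquivalence G).precomp D
  let R := HomotopyQuotient.restrict G (Conj G) D
  let W := (Functor.whiskeringRight G D D').obj T
  let S := (Functor.whiskeringLeft _ _ D).obj (Inertia.inclusion G)
  exact ⟨calc
    R ⋙ W ≅ 𝟭 _ ⋙ R ⋙ W := (Functor.leftUnitor _).symm
    _ ≅ (P.inverse ⋙ P.functor) ⋙ R ⋙ W := Functor.isoWhiskerRight P.counitIso.symm _
    _ ≅ P.inverse ⋙ (P.functor ⋙ R) ⋙ W := Iso.refl _
    _ ≅ P.inverse ⋙ S ⋙ W := Functor.isoWhiskerLeft _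
      (Functor.isoWhiskerRight (precompRestrictIso G D) W)
    _ ≅ P.inverse ⋙ 𝟭 _ ⋙ S ⋙ W := Iso.refl _
    _ ≅ P.inverse ⋙ (K.inverse ⋙ K.functor) ⋙ S ⋙ W := Functor.isoWhiskerLeft _
      (Functor.isoWhiskerRight K.counitIso.symm _)
    _ ≅ (P.inverse ⋙ K.inverse) ⋙ (K.functor ⋙ S ⋙ W) := Iso.refl _
    _ ≅ (P.inverse ⋙ K.inverse) ⋙ N := Functor.isoWhiskerLeft _ e⟩

end
end TwoGroupFourier

namespace TwoGroupFourier

/-! ### Linearizations of groupoids -/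

section

variable {𝕜 : Type w} [Field 𝕜] {G : Type*} [Groupoid G] {A : Type*} [Category A]
  [Preadditive A] [Linear 𝕜 A]

variable (𝕜) in
/-- A functor `J` to a linear category is a linearization if the images of morphisms form bases
and every object is a retract of a finite direct sum of objects in the image of `J`. -/
structure IsLinearization (J : G ⥤ A) : Prop where
  linearIndependent (x y : G) : LinearIndependent 𝕜 (fun a : x ⟶ y => J.map a)
  span_eq_top (x y : G) : Submodule.span 𝕜 (Set.range fun a : x ⟶ y => J.map a) = ⊤
  exists_retract (V : A) : ∃ (n : ℕ) (x : Fin n → G) (i : ∀ k, J.obj (x k) ⟶ V)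
    (p : ∀ k, V ⟶ J.obj (x k)), ∑ k, p k ≫ i k = 𝟙 V

namespace IsLinearization

variable {J : G ⥤ A} (hJ : IsLinearization 𝕜 J) {B : Type*} [Category B] [Preadditive B]

include hJ

lemma hom_induction {x y : G} {P : (J.obj x ⟶ J.obj y) → Prop} (u : J.obj x ⟶ J.obj y)
    (map : ∀ a : x ⟶ y, P (J.map a)) (zero : P 0) (add : ∀ u u', P u → P u' → P (u + u'))
    (smul : ∀ (r : 𝕜) u, P u → P (r • u)) : P u := by
  have hu : u ∈ Submodule.span 𝕜 (Set.range fun a : x ⟶ y => J.map a) := by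
    rw [hJ.span_eq_top]; trivial
  induction hu using Submodule.span_induction with
  | mem u h =>
    obtain ⟨a, rfl⟩ := h
    exact map a
  | zero => exact zero
  | add u u' _ _ h h' => exact add u u' h h'
  | smul r u _ h => exact smul r u h

/-- The object `V` is a retract of a finite sum of objects `J x`, and the additive functor `M`
preserves this. `M` is kept general so that it can also be tensoring with a fixed object. -/
lemma hom_ext (M : A ⥤ B) [M.Additive] {V : A} {W : B} {t t' : M.obj V ⟶ W}
    (h : ∀ (x : G) (f : J.obj x ⟶ V), M.map f ≫ t = M.map f ≫ t') : t = t' := by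
  obtain ⟨n, x, i, p, e⟩ := hJ.exists_retract V
  rw [← Category.id_comp t, ← Category.id_comp t', ← M.map_id, ← e, M.map_sum,
    Preadditive.sum_comp, Preadditive.sum_comp]
  exact Finset.sum_congr rfl fun k _ => by
    rw [M.map_comp, Category.assoc, Category.assoc, h]

/-- The retraction forces the formula: `t` is the sum of the `M.map (p k) ≫ T (x k) (i k)`.
Linearity upgrades compatibility with morphisms of `G` to compatibility with all morphisms between
the `J x`, which makes this sum restrict to `T`. -/
lemma exists_extension [Linear 𝕜 B] (M : A ⥤ B) [M.Additive] [M.Linear 𝕜] {V : A} {W : B}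
    (T : ∀ x, (J.obj x ⟶ V) →ₗ[𝕜] (M.obj (J.obj x) ⟶ W))
    (hT : ∀ {x y : G} (a : x ⟶ y) (f : J.obj y ⟶ V),
      T x (J.map a ≫ f) = M.map (J.map a) ≫ T y f) :
    ∃ t : M.obj V ⟶ W, ∀ (x : G) (f : J.obj x ⟶ V), M.map f ≫ t = T x f := by
  have key : ∀ {x y : G} (u : J.obj x ⟶ J.obj y) (f : J.obj y ⟶ V),
      T x (u ≫ f) = M.map u ≫ T y f := by
    intro x y u f
    refine hJ.hom_induction (P := fun u => T x (u ≫ f) = M.map u ≫ T y f) u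
      (fun a => hT a f) ?_ ?_ ?_
    · rw [Limits.zero_comp, map_zero, M.map_zero, Limits.zero_comp]
    · intro u u' h h'
      rw [Preadditive.add_comp, map_add, M.map_add, Preadditive.add_comp, h, h']
    · intro r u h
      rw [Linear.smul_comp, map_smul, M.map_smul, Linear.smul_comp, h]
  obtain ⟨n, x, i, p, e⟩ := hJ.exists_retract V
  refine ⟨∑ k, M.map (p k) ≫ T (x k) (i k), fun y f => ?_⟩
  rw [Preadditive.comp_sum]
  calc
    _ = ∑ k, T y ((f ≫ p k) ≫ i k) := Finset.sum_congr rfl fun k _ => by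
      rw [key, M.map_comp, Category.assoc]
    _ = T y (f ≫ ∑ k, p k ≫ i k) := by
      rw [← map_sum, Preadditive.comp_sum]
      simp only [Category.assoc]
    _ = _ := by rw [e, Category.comp_id]

lemma finite_hom [∀ x y : G, Finite (x ⟶ y)] (x : G) (V : A) : Module.Finite 𝕜 (J.obj x ⟶ V) := by
  obtain ⟨n, y, i, p, e⟩ := hJ.exists_retract V
  have h : ∀ k, Module.Finite 𝕜 (J.obj x ⟶ J.obj (y k)) := fun k =>
    ⟨Submodule.fg_def.2 ⟨_, Set.finite_range _, hJ.span_eq_top x (y k)⟩⟩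
  refine Module.Finite.of_surjective
    (∑ k, (Linear.rightComp 𝕜 (J.obj x) (i k)).comp (LinearMap.proj k) :
      (∀ k, J.obj x ⟶ J.obj (y k)) →ₗ[𝕜] (J.obj x ⟶ V)) fun f => ⟨fun k => f ≫ p k, ?_⟩
  rw [LinearMap.sum_apply]
  calc
    _ = ∑ k, f ≫ p k ≫ i k := Finset.sum_congr rfl fun k _ => Category.assoc _ _ _
    _ = f := by rw [← Preadditive.comp_sum, e, Category.comp_id]

end IsLinearization

/-- A retract of a finite direct sum of objects in the image of a fully faithful additive functor
is in the image of the functor, up to isomorphism. -/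
lemma exists_preimage_of_retract {A B : Type*} [Category A] [Preadditive A] [Category B]
    [Preadditive B] [Limits.HasFiniteBiproducts A] [IsIdempotentComplete A] (R : A ⥤ B)
    [R.Additive] [R.Full] [R.Faithful] {ι : Type*} [Fintype ι] (X : ι → A) {F : B}
    (i : ∀ k, R.obj (X k) ⟶ F) (p : ∀ k, F ⟶ R.obj (X k))
    (e : ∑ k, p k ≫ i k = 𝟙 F) : ∃ V, Nonempty (R.obj V ≅ F) := by
  let j : F ⟶ R.obj (⨁ X) := ∑ k, p k ≫ R.map (Limits.biproduct.ι X k)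
  let q : R.obj (⨁ X) ⟶ F := ∑ k, R.map (Limits.biproduct.π X k) ≫ i k
  have hjq : j ≫ q = 𝟙 F := by
    classical
    rw [← e]
    simp only [j, q, Preadditive.comp_sum, Preadditive.sum_comp, Category.assoc]
    refine Finset.sum_congr rfl fun k _ => ?_
    rw [Finset.sum_eq_single k]
    · rw [← R.map_comp_assoc, Limits.biproduct.ι_π_self, R.map_id, Category.id_comp]
    · intro l _ hl
      rw [← R.map_comp_assoc, Limits.biproduct.ι_π_ne _ hl, R.map_zero, Limits.zero_comp,
        Limits.comp_zero]
    · simp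
  -- The idempotent cutting `F` out of `R.obj (⨁ X)` lifts by fullness, stays idempotent by
  -- faithfulness, and splits in `A`.
  obtain ⟨d, hd⟩ := R.map_surjective (q ≫ j)
  have hdd : d ≫ d = d := R.map_injective (by
    rw [R.map_comp, hd, Category.assoc, reassoc_of% hjq])
  obtain ⟨V, a, b, hab, hba⟩ := IsIdempotentComplete.idempotents_split _ d hdd
  refine ⟨V, ⟨⟨R.map a ≫ q, j ≫ R.map b, ?_, ?_⟩⟩⟩
  · rw [Category.assoc, ← reassoc_of% hd, ← R.map_comp, ← R.map_comp, ← hba]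
    simp only [Category.assoc, reassoc_of% hab, hab, R.map_id]
  · rw [Category.assoc, ← R.map_comp_assoc, hba, hd, Category.assoc, hjq, Category.comp_id, hjq]

end

section

variable {𝕜 : Type w} [Field 𝕜] {G : Type u} [Groupoid.{v} G] {A : Type*} [Category.{max v w} A]
  [Preadditive A] [Linear 𝕜 A] (J : G ⥤ A)

variable (𝕜) in
/-- The functor `V ↦ (x ↦ Hom(J x, V))`. -/
noncomputable def homFunctor : A ⥤ G ⥤ ModuleCat.{max v w} 𝕜 :=
  linearYoneda 𝕜 A ⋙ (Functor.whiskeringLeft _ _ _).obj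
    ((Groupoid.invEquivalence (C := G)).functor ⋙ J.op)

lemma homFunctor_map_apply (V : A) {x y : G} (a : x ⟶ y) (f : J.obj x ⟶ V) :
    (((homFunctor 𝕜 J).obj V).map a).hom f = J.map (inv a) ≫ f := by
  have h : ∀ b : y ⟶ x, b = inv a → J.map b ≫ f = J.map (inv a) ≫ f := by
    rintro _ rfl; rfl
  exact h _ (Groupoid.inv_eq_inv a)

instance : (homFunctor 𝕜 J).Additive where
  map_add := by
    intros
    ext x f
    exact Preadditive.comp_add _ _ _ f _ _

variable {J} (hJ : IsLinearization 𝕜 J)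

-- Full faithfulness of the restricted Yoneda functor is density of the image of `J`: this lemma and
-- the next are `hom_ext` and `exists_extension` for the identity functor.
include hJ in
lemma IsLinearization.homFunctor_faithful : (homFunctor 𝕜 J).Faithful where
  map_injective {V W _ _} h := hJ.hom_ext (𝟭 A) fun x f =>
    congrArg (fun s : (homFunctor 𝕜 J).obj V ⟶ (homFunctor 𝕜 J).obj W => (s.app x).hom f) h

include hJ in
lemma IsLinearization.homFunctor_full : (homFunctor 𝕜 J).Full where
  map_surjective := by
    intro V W s
    obtain ⟨t, ht⟩ := hJ.exists_extension (𝟭 A) (V := V) (W := W) (fun x => (s.app x).hom) (by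
      intro x y a f
      have h := congrArg (fun u => u.hom f) (s.naturality (inv a))
      have h' : (s.app x).hom ((((homFunctor 𝕜 J).obj V).map (inv a)).hom f) =
        (((homFunctor 𝕜 J).obj W).map (inv a)).hom ((s.app y).hom f) := h
      rw [homFunctor_map_apply] at h'
      have h'' := h'.trans (homFunctor_map_apply J W (inv a) ((s.app y).hom f))
      rw [IsIso.inv_inv] at h''
      exact h'')
    refine ⟨t, ?_⟩
    ext x f
    exact ht x f

end
end TwoGroupFourier

namespace TwoGroupFourier

/-! ### Realizing representations of a finite groupoid by averaging -/

section

variable {𝕜 : Type w} [Field 𝕜] {G : Type u} [Groupoid.{v} G] {A : Type*} [Category.{max v w} A]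
  [Preadditive A] [Linear 𝕜 A] {J : G ⥤ A} (hJ : IsLinearization 𝕜 J)
  (F : G ⥤ ModuleCat.{max v w} 𝕜)

namespace IsLinearization

/-- The basis of `Hom(J x, J y)` given by the morphisms `x ⟶ y`. -/
noncomputable def basis (x y : G) : Module.Basis (x ⟶ y) 𝕜 (J.obj x ⟶ J.obj y) :=
  Module.Basis.mk (hJ.linearIndependent x y) (hJ.span_eq_top x y).ge

lemma basis_apply {x y : G} (a : x ⟶ y) : hJ.basis x y a = J.map a :=
  Module.Basis.mk_apply _ _ a

/-- The transformation `Hom(J -, J x) ⟶ F` given by an element of `F x`. -/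
noncomputable def evalHom (x : G) (m : F.obj x) : (homFunctor 𝕜 J).obj (J.obj x) ⟶ F where
  app y := ModuleCat.ofHom ((hJ.basis y x).constr 𝕜 fun a => (F.map (inv a)).hom m)
  naturality y z b := by
    refine ModuleCat.hom_ext ((hJ.basis y x).ext fun a => ?_)
    have e : (((homFunctor 𝕜 J).obj (J.obj x)).map b).hom (hJ.basis y x a) =
        hJ.basis z x (inv b ≫ a) := by
      rw [basis_apply, basis_apply, J.map_comp]
      exact homFunctor_map_apply J _ b _
    calc
      _ = (hJ.basis z x).constr 𝕜 (fun a => (F.map (inv a)).hom m)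
          ((((homFunctor 𝕜 J).obj (J.obj x)).map b).hom (hJ.basis y x a)) := rfl
      _ = (F.map (inv a ≫ b)).hom m := by
        rw [e, Module.Basis.constr_basis, IsIso.inv_comp, IsIso.inv_inv]
      _ = (F.map b).hom ((F.map (inv a)).hom m) := by rw [F.map_comp]; rfl
      _ = (F.map b).hom ((hJ.basis y x).constr 𝕜 (fun a => (F.map (inv a)).hom m)
          (hJ.basis y x a)) := by rw [Module.Basis.constr_basis]
      _ = _ := rfl

lemma evalHom_app_apply (x : G) (m : F.obj x) {y : G} (a : y ⟶ x) :
    ((hJ.evalHom F x m).app y).hom (J.map a) = (F.map (inv a)).hom m := by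
  have h : (hJ.basis y x).constr 𝕜 (fun a => (F.map (inv a)).hom m) (J.map a) =
      (F.map (inv a)).hom m := by
    rw [← hJ.basis_apply, Module.Basis.constr_basis]
  exact h

variable [∀ x y : G, Fintype (x ⟶ y)]

variable (J) in
/-- The averaged matrix coefficient of a linear form on `F x`. -/
noncomputable def _root_.TwoGroupFourier.coordMap (x : G) (ξ : F.obj x →ₗ[𝕜] 𝕜) (y : G) :
    F.obj y →ₗ[𝕜] (J.obj y ⟶ J.obj x) :=
  ∑ a : y ⟶ x, (ξ.comp (F.map a).hom).smulRight (J.map a)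

omit hJ in
lemma _root_.TwoGroupFourier.coordMap_apply (x : G) (ξ : F.obj x →ₗ[𝕜] 𝕜) (y : G)
    (m : F.obj y) : coordMap J F x ξ y m = ∑ a : y ⟶ x, ξ ((F.map a).hom m) • J.map a := by
  rw [coordMap, LinearMap.sum_apply]
  rfl

-- Equivariance comes from reindexing the sum by `a ↦ b ≫ a`.
omit hJ in
lemma _root_.TwoGroupFourier.coordMap_map (x : G) (ξ : F.obj x →ₗ[𝕜] 𝕜) {y z : G} (b : y ⟶ z)
    (m : F.obj y) :
    coordMap J F x ξ z ((F.map b).hom m) = J.map (inv b) ≫ coordMap J F x ξ y m := by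
  rw [coordMap_apply, coordMap_apply]
  calc
    _ = ∑ a : z ⟶ x, ξ ((F.map (b ≫ a)).hom m) • (J.map (inv b) ≫ J.map (b ≫ a)) :=
      Finset.sum_congr rfl fun a _ => by
        rw [← J.map_comp, IsIso.inv_hom_id_assoc, F.map_comp]; rfl
    _ = ∑ a : y ⟶ x, ξ ((F.map a).hom m) • (J.map (inv b) ≫ J.map a) :=
      Fintype.sum_equiv (asIso b).symm.homFromEquiv _ _ fun _ => rfl
    _ = _ := by
      rw [Preadditive.comp_sum]
      exact Finset.sum_congr rfl fun a _ => (Linear.comp_smul _ _ _ _ _ _).symm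

variable (J) in
/-- The transformation `F ⟶ Hom(J -, J x)` given by a linear form on `F x`. -/
noncomputable def _root_.TwoGroupFourier.coordHom (x : G) (ξ : F.obj x →ₗ[𝕜] 𝕜) :
    F ⟶ (homFunctor 𝕜 J).obj (J.obj x) where
  app y := ModuleCat.ofHom (coordMap J F x ξ y)
  naturality y _ b := ModuleCat.hom_ext (LinearMap.ext fun m =>
    (coordMap_map F x ξ b m).trans
      (homFunctor_map_apply (𝕜 := 𝕜) J (J.obj x) b (coordMap J F x ξ y m)).symm)

lemma evalHom_coordHom (x : G) (ξ : F.obj x →ₗ[𝕜] 𝕜) (m : F.obj x) (y : G) (n : F.obj y) :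
    ((coordHom J F x ξ ≫ hJ.evalHom F x m).app y).hom n =
      ∑ a : y ⟶ x, ξ ((F.map a).hom n) • (F.map (inv a)).hom m := by
  have h : ((hJ.evalHom F x m).app y).hom (coordMap J F x ξ y n) =
      ∑ a : y ⟶ x, ξ ((F.map a).hom n) • (F.map (inv a)).hom m := by
    rw [coordMap_apply]
    refine (map_sum ((hJ.evalHom F x m).app y).hom _ _).trans (Finset.sum_congr rfl fun a _ => ?_)
    refine (map_smul ((hJ.evalHom F x m).app y).hom _ _).trans ?_
    exact congrArg (ξ ((F.map a).hom n) • ·) (hJ.evalHom_app_apply F x m a)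
  exact h

/-- Summing over a basis and its dual leaves, for each `a : y ⟶ x`, the vector `F(a⁻¹)(F(a) n) = n`.
The total is thus a scalar multiple of `n`. -/
lemma sum_evalHom_coordHom (x : G) [Module.Finite 𝕜 (F.obj x)] (y : G) (n : F.obj y) :
    ∑ j, ((coordHom J F x ((Module.finBasis 𝕜 (F.obj x)).coord j) ≫
      hJ.evalHom F x (Module.finBasis 𝕜 (F.obj x) j)).app y).hom n =
      (Fintype.card (y ⟶ x) : 𝕜) • n := by
  simp only [evalHom_coordHom]
  rw [Finset.sum_comm]
  calc
    _ = ∑ a : y ⟶ x, n := Finset.sum_congr rfl fun a _ => by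
      calc
        _ = (F.map (inv a)).hom (∑ j, (Module.finBasis 𝕜 (F.obj x)).coord j ((F.map a).hom n) •
            Module.finBasis 𝕜 (F.obj x) j) := by
          rw [map_sum]
          exact Finset.sum_congr rfl fun j _ => (map_smul _ _ _).symm
        _ = (F.map a ≫ F.map (inv a)).hom n :=
          congrArg (F.map (inv a)).hom ((Module.finBasis 𝕜 (F.obj x)).sum_repr _)
        _ = n := by rw [← F.map_comp, IsIso.hom_inv_id, F.map_id]; rfl
    _ = _ := by rw [Finset.sum_const, Finset.card_univ, Nat.cast_smul_eq_nsmul]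

include hJ in
/-- Every finite-dimensional representation of a finite groupoid is of the form `Hom(J -, V)`. -/
lemma exists_homFunctor_iso [CharZero 𝕜] [Limits.HasFiniteBiproducts A] [IsIdempotentComplete A]
    [Finite (Quotient (isIsomorphicSetoid G))] [∀ x, Module.Finite 𝕜 (F.obj x)] :
    ∃ V : A, Nonempty ((homFunctor 𝕜 J).obj V ≅ F) := by
  classical
  have := hJ.homFunctor_faithful
  have := hJ.homFunctor_full
  let Q := Quotient (isIsomorphicSetoid G)
  have := Fintype.ofFinite Q
  -- The weights normalize the sum over classes to the identity. At `y` only the class of `y`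
  -- contributes, and there the number of morphisms to the representative is the order of its
  -- automorphism group, which is invertible in characteristic zero.
  let c (q : Q) : 𝕜 := (Fintype.card (q.out ⟶ q.out) : 𝕜)⁻¹
  let b (q : Q) := Module.finBasis 𝕜 (F.obj q.out)
  refine exists_preimage_of_retract (homFunctor 𝕜 J)
    (ι := Σ q : Q, Fin (Module.finrank 𝕜 (F.obj q.out))) (fun k => J.obj k.1.out)
    (fun k => hJ.evalHom F k.1.out (b k.1 k.2))
    (fun k => c k.1 • coordHom J F k.1.out ((b k.1).coord k.2)) ?_
  ext y n
  have key : ∑ k : Σ q : Q, Fin (Module.finrank 𝕜 (F.obj q.out)), c k.1 •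
      ((coordHom J F k.1.out ((b k.1).coord k.2) ≫ hJ.evalHom F k.1.out (b k.1 k.2)).app y).hom n
        = n := by
    rw [Fintype.sum_sigma]
    calc
      _ = ∑ q : Q, c q • (Fintype.card (y ⟶ q.out) : 𝕜) • n :=
        Finset.sum_congr rfl fun q _ => Finset.smul_sum.symm.trans
          (congrArg (c q • ·) (hJ.sum_evalHom_coordHom F q.out y n))
      _ = n := by
        rw [Finset.sum_eq_single (Quotient.mk _ y)]
        · obtain ⟨e⟩ : IsIsomorphic (Quotient.mk (isIsomorphicSetoid G) y).out y :=
            Quotient.mk_out (s := isIsomorphicSetoid G) y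
          rw [Fintype.card_congr e.symm.homFromEquiv, smul_smul, inv_mul_cancel₀, one_smul]
          have : Nonempty ((Quotient.mk (isIsomorphicSetoid G) y).out ⟶
            (Quotient.mk (isIsomorphicSetoid G) y).out) := ⟨𝟙 _⟩
          exact Nat.cast_ne_zero.2 Fintype.card_ne_zero
        · intro q _ hq
          have : IsEmpty (y ⟶ q.out) := ⟨fun a => hq (by
            rw [← Quotient.out_eq q]
            exact (Quotient.sound (s := isIsomorphicSetoid G) ⟨asIso a⟩).symm)⟩
          rw [Fintype.card_eq_zero, Nat.cast_zero, zero_smul, smul_zero]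
        · simp
  refine Eq.trans ?_ key
  rw [NatTrans.app_sum, ModuleCat.hom_sum, LinearMap.sum_apply]
  exact Finset.sum_congr rfl fun k _ => map_smul
    ((hJ.evalHom F k.1.out (b k.1 k.2)).app y).hom (c k.1) _

end IsLinearization
end
end TwoGroupFourier

namespace TwoGroupFourier

open Functor.LaxMonoidal Functor.OplaxMonoidal Functor.Monoidal

/-! ### Half-braidings relative to a monoidal functor -/

section

variable {G : Type u} [Category.{v} G] [MonoidalCategory G] {A : Type*} [Category A]
  [MonoidalCategory A] (J : G ⥤ A) [J.Monoidal]

/-- The image `J g ⊗ J x ⟶ J y ⊗ J g` of a morphism `g ⊗ x ⟶ y ⊗ g`. -/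
def tensorMap {x y g : G} (c : g ⊗ x ⟶ y ⊗ g) : J.obj g ⊗ J.obj x ⟶ J.obj y ⊗ J.obj g :=
  μ J g x ≫ J.map c ≫ δ J y g

instance {x y g : G} (c : g ⊗ x ⟶ y ⊗ g) [IsIso c] : IsIso (tensorMap J c) := by
  rw [tensorMap]; infer_instance

lemma tensorMap_naturality {x y g h : G} {c : g ⊗ x ⟶ y ⊗ g} {d : h ⊗ x ⟶ y ⊗ h} {a : g ⟶ h}
    (w : a ▷ x ≫ d = c ≫ y ◁ a) :
    J.map a ▷ J.obj x ≫ tensorMap J d = tensorMap J c ≫ J.obj y ◁ J.map a := by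
  have h' := congrArg J.map w
  rw [J.map_comp, J.map_comp] at h'
  simp only [tensorMap, Category.assoc, Functor.LaxMonoidal.μ_natural_left_assoc,
    ← Functor.OplaxMonoidal.δ_natural_right, reassoc_of% h']

lemma tensorMap_comp_right {x y z g : G} (c : g ⊗ x ⟶ y ⊗ g) (b : y ⟶ z) :
    tensorMap J (c ≫ b ▷ g) = tensorMap J c ≫ J.map b ▷ J.obj g := by
  simp [tensorMap]

lemma tensorMap_comp_left {x y z g : G} (c : g ⊗ x ⟶ y ⊗ g) (b : z ⟶ x) :
    tensorMap J (g ◁ b ≫ c) = J.obj g ◁ J.map b ≫ tensorMap J c := by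
  simp [tensorMap]

lemma tensorMap_unit {x y : G} (b : x ⟶ y) :
    ε J ▷ J.obj x ≫ tensorMap J ((λ_ x).hom ≫ b ≫ (ρ_ y).inv) =
      (λ_ _).hom ≫ J.map b ≫ (ρ_ _).inv ≫ J.obj y ◁ ε J := by
  rw [tensorMap]
  simp

/-- Up to the tensor comparison, `J` carries composition of representatives to the analogous
composite in `A`; with `tensorMap_unit`, this makes the action on multiplicity spaces functorial. -/
lemma tensorMap_compHom {x y z g h : G} (c : g ⊗ x ⟶ y ⊗ g) (d : h ⊗ y ⟶ z ⊗ h) :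
    μ J h g ▷ J.obj x ≫ tensorMap J (Inertia.compHom c d) =
      (α_ _ _ _).hom ≫ J.obj h ◁ tensorMap J c ≫ (α_ _ _ _).inv ≫ tensorMap J d ▷ J.obj g ≫
        (α_ _ _ _).hom ≫ J.obj z ◁ μ J h g := by
  simp only [tensorMap, Inertia.compHom, J.map_comp, map_whiskerLeft, map_whiskerRight,
    map_associator, map_associator_inv, comp_whiskerRight, MonoidalCategory.whiskerLeft_comp,
    Category.assoc, μ_δ_assoc, μ_δ, Category.comp_id, whiskerRight_μ_δ_assoc]

/-- A half-braiding of `V` with the objects in the image of `J`. -/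
structure RelHalfBraiding (V : A) where
  hom (g : G) : J.obj g ⊗ V ⟶ V ⊗ J.obj g
  naturality {g h : G} (a : g ⟶ h) : J.map a ▷ V ≫ hom h = hom g ≫ V ◁ J.map a
  unit : ε J ▷ V ≫ hom (𝟙_ G) = (λ_ V).hom ≫ (ρ_ V).inv ≫ V ◁ ε J
  mul (g h : G) : μ J g h ▷ V ≫ hom (g ⊗ h) = (α_ _ _ _).hom ≫ J.obj g ◁ hom h ≫
    (α_ _ _ _).inv ≫ hom g ▷ J.obj h ≫ (α_ _ _ _).hom ≫ V ◁ μ J g h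

/-- The unit condition is a consequence of the other axioms: compare monoidality at the tensor
square of the unit with naturality along its unitor, and cancel one copy of the invertible
half-braiding. -/
lemma halfBraiding_unit {V : A} (β : HalfBraiding V) :
    (β.β (𝟙_ A)).hom = (ρ_ V).hom ≫ (λ_ V).inv := by
  have h := β.naturality (λ_ (𝟙_ A)).hom
  rw [β.monoidal] at h
  have h' : V ◁ (λ_ (𝟙_ A)).hom ≫ (β.β (𝟙_ A)).hom = (𝟙 _ ⊗≫ (β.β (𝟙_ A)).hom ▷ 𝟙_ A ⊗≫
      𝟙 (V ⊗ 𝟙_ A)) ≫ (β.β (𝟙_ A)).hom := by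
    rw [h]; monoidal
  rw [cancel_mono] at h'
  calc
    _ = (ρ_ _).inv ≫ ((α_ _ _ _).hom ≫ 𝟙 _ ⊗≫ (β.β (𝟙_ A)).hom ▷ 𝟙_ A ⊗≫ 𝟙 (V ⊗ 𝟙_ A)) ⊗≫
        𝟙 _ := by monoidal
    _ = (ρ_ _).inv ≫ ((α_ _ _ _).hom ≫ V ◁ (λ_ (𝟙_ A)).hom) ⊗≫ 𝟙 _ := by rw [h']
    _ = _ := by monoidal

/-- The restriction of a half-braiding along a monoidal functor. -/
def RelHalfBraiding.ofHalfBraiding {V : A} (β : HalfBraiding V) : RelHalfBraiding J V where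
  -- `HalfBraiding` moves `V` to the right of other objects and `RelHalfBraiding` moves it to the
  -- left, hence the inverse.
  hom g := (β.β (J.obj g)).inv
  naturality a := by
    rw [Iso.comp_inv_eq, Category.assoc, Iso.eq_inv_comp, β.naturality]
  unit := by
    rw [Iso.comp_inv_eq, Category.assoc, Category.assoc, β.naturality, halfBraiding_unit]
    simp
  mul g h := by
    rw [Iso.comp_inv_eq]
    simp only [Category.assoc]
    rw [β.naturality, β.monoidal]
    simp

end
end TwoGroupFourier

namespace TwoGroupFourier

open Functor.LaxMonoidal Functor.OplaxMonoidal Functor.Monoidal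

/-! ### Half-braidings as actions on multiplicity spaces -/

section

variable {G : Type*} [Groupoid G] [MonoidalCategory G] [TwoGroup G]
  {A : Type*} [Category A] [MonoidalCategory A] (J : G ⥤ A) [J.Monoidal]

lemma map_whiskerRight_bijective (g : G) (X Y : A) :
    Function.Bijective fun f : X ⟶ Y => f ▷ J.obj g := by
  obtain ⟨h, ⟨e⟩, ⟨e'⟩⟩ := TwoGroup.exists_inverse g
  exact whiskerRight_bijective (μIso J _ _ ≪≫ J.mapIso e ≪≫ (εIso J).symm)
    (μIso J _ _ ≪≫ J.mapIso e' ≪≫ (εIso J).symm) X Y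

lemma map_whiskerLeft_bijective (g : G) (X Y : A) :
    Function.Bijective fun f : X ⟶ Y => J.obj g ◁ f := by
  obtain ⟨h, ⟨e⟩, ⟨e'⟩⟩ := TwoGroup.exists_inverse g
  exact whiskerLeft_bijective (μIso J _ _ ≪≫ J.mapIso e' ≪≫ (εIso J).symm)
    (μIso J _ _ ≪≫ J.mapIso e ≪≫ (εIso J).symm) X Y

end

section

variable {𝕜 : Type w} [Field 𝕜] {G : Type u} [Groupoid.{v} G] [MonoidalCategory G] [TwoGroup G]
  {A : Type*} [Category.{max v w} A] [Preadditive A] [Linear 𝕜 A] [MonoidalCategory A]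
  [MonoidalPreadditive A] [MonoidalLinear 𝕜 A] {J : G ⥤ A} [J.Monoidal]

namespace RelHalfBraiding

variable {V V' : A} (γ : RelHalfBraiding J V) (γ' : RelHalfBraiding J V')

-- Whiskering with the invertible object `J g` is bijective and `tensorMap J c` is invertible, so
-- the equation has exactly one solution. This solution defines `act`.
omit [Preadditive A] [MonoidalPreadditive A] in
lemma existsUnique_act {x y g : G} (c : g ⊗ x ⟶ y ⊗ g) (f : J.obj x ⟶ V) :
    ∃! f' : J.obj y ⟶ V, J.obj g ◁ f ≫ γ.hom g = tensorMap J c ≫ f' ▷ J.obj g := by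
  obtain ⟨f', hf'⟩ := (map_whiskerRight_bijective J g (J.obj y) V).2
    (inv (tensorMap J c) ≫ J.obj g ◁ f ≫ γ.hom g)
  refine ⟨f', ?_, fun f'' h => (map_whiskerRight_bijective J g (J.obj y) V).1 ?_⟩
  · dsimp only at hf' ⊢
    rw [hf', IsIso.hom_inv_id_assoc]
  · dsimp only at hf' h ⊢
    rw [hf', h, IsIso.inv_hom_id_assoc]

omit [Preadditive A] [MonoidalPreadditive A] in
lemma act_unique {x y g : G} {c : g ⊗ x ⟶ y ⊗ g} {f : J.obj x ⟶ V} {f₁ f₂ : J.obj y ⟶ V}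
    (h₁ : J.obj g ◁ f ≫ γ.hom g = tensorMap J c ≫ f₁ ▷ J.obj g)
    (h₂ : J.obj g ◁ f ≫ γ.hom g = tensorMap J c ≫ f₂ ▷ J.obj g) : f₁ = f₂ :=
  (γ.existsUnique_act c f).unique h₁ h₂

omit [TwoGroup G] in
lemma act_add {x y g : G} {c : g ⊗ x ⟶ y ⊗ g} {f f' : J.obj x ⟶ V} {k k' : J.obj y ⟶ V}
    (h : J.obj g ◁ f ≫ γ.hom g = tensorMap J c ≫ k ▷ J.obj g)
    (h' : J.obj g ◁ f' ≫ γ.hom g = tensorMap J c ≫ k' ▷ J.obj g) :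
    J.obj g ◁ (f + f') ≫ γ.hom g = tensorMap J c ≫ (k + k') ▷ J.obj g := by
  rw [MonoidalPreadditive.whiskerLeft_add, Preadditive.add_comp, h, h',
    MonoidalPreadditive.add_whiskerRight, Preadditive.comp_add]

omit [TwoGroup G] in
lemma act_smul {x y g : G} {c : g ⊗ x ⟶ y ⊗ g} (r : 𝕜) {f : J.obj x ⟶ V} {k : J.obj y ⟶ V}
    (h : J.obj g ◁ f ≫ γ.hom g = tensorMap J c ≫ k ▷ J.obj g) :
    J.obj g ◁ (r • f) ≫ γ.hom g = tensorMap J c ≫ (r • k) ▷ J.obj g := by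
  rw [MonoidalLinear.whiskerLeft_smul, Linear.smul_comp, h, MonoidalLinear.smul_whiskerRight,
    Linear.comp_smul]

variable (𝕜) in
/-- The action of a morphism `g ⊗ x ⟶ y ⊗ g` on the multiplicity spaces of `V`. -/
noncomputable def act {x y g : G} (c : g ⊗ x ⟶ y ⊗ g) : (J.obj x ⟶ V) →ₗ[𝕜] (J.obj y ⟶ V) where
  toFun f := (γ.existsUnique_act c f).choose
  map_add' f f' := γ.act_unique (γ.existsUnique_act c (f + f')).choose_spec.1
    (γ.act_add (γ.existsUnique_act c f).choose_spec.1 (γ.existsUnique_act c f').choose_spec.1)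
  map_smul' r f := γ.act_unique (γ.existsUnique_act c (r • f)).choose_spec.1
    (γ.act_smul r (γ.existsUnique_act c f).choose_spec.1)

lemma act_spec {x y g : G} (c : g ⊗ x ⟶ y ⊗ g) (f : J.obj x ⟶ V) :
    J.obj g ◁ f ≫ γ.hom g = tensorMap J c ≫ γ.act 𝕜 c f ▷ J.obj g :=
  (γ.existsUnique_act c f).choose_spec.1

lemma act_eq {x y g : G} {c : g ⊗ x ⟶ y ⊗ g} {f : J.obj x ⟶ V} {f' : J.obj y ⟶ V}
    (h : J.obj g ◁ f ≫ γ.hom g = tensorMap J c ≫ f' ▷ J.obj g) : γ.act 𝕜 c f = f' :=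
  γ.act_unique (γ.act_spec c f) h

/-- The axioms of a relative half-braiding translate one by one: the unit axiom gives this lemma,
naturality gives `act_congr`, and multiplicativity gives `act_compHom`. Each follows from uniqueness
of the solution defining `act`. -/
lemma act_unit {x y : G} (b : x ⟶ y) (f : J.obj x ⟶ V) :
    γ.act 𝕜 ((λ_ x).hom ≫ b ≫ (ρ_ y).inv) f = J.map (inv b) ≫ f := by
  apply γ.act_eq
  rw [← cancel_epi (ε J ▷ J.obj x), ← whisker_exchange_assoc, γ.unit,
    reassoc_of% tensorMap_unit J b, whisker_exchange, J.map_inv]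
  simp

lemma act_congr {x y g h : G} {c : g ⊗ x ⟶ y ⊗ g} {d : h ⊗ x ⟶ y ⊗ h} (a : g ⟶ h)
    (w : a ▷ x ≫ d = c ≫ y ◁ a) : γ.act 𝕜 c = γ.act 𝕜 d := by
  ext f
  apply γ.act_eq
  rw [← cancel_mono (V ◁ J.map a), Category.assoc, Category.assoc, ← γ.naturality,
    whisker_exchange_assoc, γ.act_spec (𝕜 := 𝕜) d, ← whisker_exchange,
    ← reassoc_of% tensorMap_naturality J w]

lemma act_compHom {x y z g h : G} (c : g ⊗ x ⟶ y ⊗ g) (d : h ⊗ y ⟶ z ⊗ h) (f : J.obj x ⟶ V) :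
    γ.act 𝕜 (Inertia.compHom c d) f = γ.act 𝕜 d (γ.act 𝕜 c f) := by
  apply γ.act_eq
  rw [← cancel_epi (μ J h g ▷ J.obj x), ← whisker_exchange_assoc, γ.mul,
    reassoc_of% tensorMap_compHom J c d]
  have hc := γ.act_spec (𝕜 := 𝕜) c f
  have hd := γ.act_spec (𝕜 := 𝕜) d (γ.act 𝕜 c f)
  calc
    _ = (α_ _ _ _).hom ≫ J.obj h ◁ (J.obj g ◁ f ≫ γ.hom g) ≫ (α_ _ _ _).inv ≫
        γ.hom h ▷ J.obj g ≫ (α_ _ _ _).hom ≫ V ◁ μ J h g := by monoidal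
    _ = (α_ _ _ _).hom ≫ J.obj h ◁ tensorMap J c ⊗≫ (J.obj h ◁ γ.act 𝕜 c f ≫
        γ.hom h) ▷ J.obj g ≫ (α_ _ _ _).hom ≫ V ◁ μ J h g := by rw [hc]; monoidal
    _ = (α_ _ _ _).hom ≫ J.obj h ◁ tensorMap J c ⊗≫ tensorMap J d ▷ J.obj g ⊗≫
        (γ.act 𝕜 d (γ.act 𝕜 c f) ▷ (J.obj h ⊗ J.obj g) ≫ V ◁ μ J h g) := by
      rw [hd]; monoidal
    _ = _ := by rw [← whisker_exchange]; monoidal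

lemma act_comp {x y g : G} (c : g ⊗ x ⟶ y ⊗ g) (f : J.obj x ⟶ V) (t : V ⟶ V')
    (h : J.obj g ◁ t ≫ γ'.hom g = γ.hom g ≫ t ▷ J.obj g) :
    γ'.act 𝕜 c (f ≫ t) = γ.act 𝕜 c f ≫ t := by
  apply γ'.act_eq
  rw [MonoidalCategory.whiskerLeft_comp, Category.assoc, h, reassoc_of% γ.act_spec (𝕜 := 𝕜) c f,
    comp_whiskerRight]

variable [∀ (x : G) (V : A), Module.Finite 𝕜 (J.obj x ⟶ V)]

variable (𝕜) in
/-- The representation of the inertia category on the multiplicity spaces of `V`. -/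
noncomputable def rep : Inertia G ⥤ FGModuleCat.{max v w} 𝕜 :=
  Inertia.lift (fun x => FGModuleCat.of 𝕜 (J.obj x ⟶ V)) (fun _ c => FGModuleCat.ofHom (γ.act 𝕜 c))
    (fun a w => congrArg FGModuleCat.ofHom (γ.act_congr a w))
    (fun x => congrArg FGModuleCat.ofHom (LinearMap.ext fun f => by
      have h := γ.act_unit (𝕜 := 𝕜) (𝟙 x) f
      rwa [Category.id_comp, IsIso.inv_id, J.map_id, Category.id_comp] at h))
    (fun c d => congrArg FGModuleCat.ofHom (LinearMap.ext fun f => γ.act_compHom c d f))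

end RelHalfBraiding
end
end TwoGroupFourier

namespace TwoGroupFourier

/-- For every `g` and `x` there is thus a `c` through which a half-braiding with `J g` can be
computed on maps out of `J x`. -/
lemma TwoGroup.exists_twist {G : Type*} [Groupoid G] [MonoidalCategory G] [TwoGroup G] (g x : G) :
    ∃ y : G, Nonempty (g ⊗ x ⟶ y ⊗ g) := by
  obtain ⟨h, -, ⟨e⟩⟩ := TwoGroup.exists_inverse g
  exact ⟨(g ⊗ x) ⊗ h, ⟨𝟙 _ ⊗≫ (g ⊗ x) ◁ e.inv ⊗≫ 𝟙 _⟩⟩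

section

variable {A : Type*} [Category A] [MonoidalCategory A] {V V' U : A} {t : V ⟶ V'}
  {b : V ⊗ U ≅ U ⊗ V} {b' : V' ⊗ U ≅ U ⊗ V'}

lemma inv_comm_of_comm (h : t ▷ U ≫ b'.hom = b.hom ≫ U ◁ t) :
    U ◁ t ≫ b'.inv = b.inv ≫ t ▷ U := by
  rw [Iso.comp_inv_eq, Category.assoc, h, Iso.inv_hom_id_assoc]

lemma comm_of_inv_comm (h : U ◁ t ≫ b'.inv = b.inv ≫ t ▷ U) :
    t ▷ U ≫ b'.hom = b.hom ≫ U ◁ t := by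
  rw [← Iso.inv_comp_eq, ← Category.assoc, ← h, Category.assoc, Iso.inv_hom_id, Category.comp_id]

end

/-! ### The functor from the center to representations of the inertia category -/

section

variable {𝕜 : Type w} [Field 𝕜] {G : Type u} [Groupoid.{v} G] [MonoidalCategory G] [TwoGroup G]
  {A : Type*} [Category.{max v w} A] [Preadditive A] [Linear 𝕜 A] [MonoidalCategory A]
  [MonoidalPreadditive A] [MonoidalLinear 𝕜 A] (J : G ⥤ A) [J.Monoidal]

variable [∀ (x : G) (V : A), Module.Finite 𝕜 (J.obj x ⟶ V)]

variable (𝕜) in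
/-- The representation of the inertia category on the multiplicity spaces of an object of the
center. -/
noncomputable def centerRep : Center A ⥤ Inertia G ⥤ FGModuleCat.{max v w} 𝕜 where
  obj X := (RelHalfBraiding.ofHalfBraiding J X.2).rep 𝕜
  map {X Y} t :=
    { app := fun x => FGModuleCat.ofHom (Linear.rightComp 𝕜 (J.obj x.as) t.f)
      naturality := by
        rintro ⟨x⟩ ⟨y⟩ m
        obtain ⟨g, c, rfl⟩ := Inertia.homMk_surjective m
        refine FGModuleCat.hom_ext (LinearMap.ext fun f => ?_)
        exact (RelHalfBraiding.ofHalfBraiding J X.2).act_comp (𝕜 := 𝕜)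
          (RelHalfBraiding.ofHalfBraiding J Y.2) c f t.f
          (inv_comm_of_comm (t.comm (J.obj g))) |>.symm }
  map_id X := by
    ext x f
    exact Category.comp_id (f : J.obj x.as ⟶ X.1)
  map_comp t t' := by
    ext x f
    exact (Category.assoc (f : J.obj x.as ⟶ _) t.f t'.f).symm

variable {J} (hJ : IsLinearization 𝕜 J)

include hJ in
lemma centerRep_faithful : (centerRep 𝕜 J).Faithful where
  map_injective := by
    intro X Y t t' h
    refine Center.ext _ _ (hJ.hom_ext (𝟭 A) fun x f => ?_)
    exact congrArg (fun s : (centerRep 𝕜 J).obj X ⟶ (centerRep 𝕜 J).obj Y =>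
      (s.app ⟨x⟩).hom.hom f) h

-- Equivariance under the unit-type morphisms `(λ_ y).hom ≫ inv a ≫ (ρ_ x).inv` makes the
-- transformation come from some `t`. Equivariance under all `c` makes `t` commute with the
-- half-braidings at the objects `J g`, and by density at every object.
include hJ in
lemma centerRep_full : (centerRep 𝕜 J).Full where
  map_surjective := by
    intro X Y s
    let γ := RelHalfBraiding.ofHalfBraiding J X.2
    let γ' := RelHalfBraiding.ofHalfBraiding J Y.2
    let T (x : G) : (J.obj x ⟶ X.1) →ₗ[𝕜] (J.obj x ⟶ Y.1) := (s.app ⟨x⟩).hom.hom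
    have hs : ∀ {x y g : G} (c : g ⊗ x ⟶ y ⊗ g) (f : J.obj x ⟶ X.1),
        T y (γ.act 𝕜 c f) = γ'.act 𝕜 c (T x f) := fun {x y g} c f =>
      congrArg (fun u : ((centerRep 𝕜 J).obj X).obj ⟨x⟩ ⟶ ((centerRep 𝕜 J).obj Y).obj ⟨y⟩ =>
        u.hom.hom f) (s.naturality (Inertia.homMk g c))
    obtain ⟨(t : X.1 ⟶ Y.1), (ht : ∀ (x : G) (f : J.obj x ⟶ X.1), f ≫ t = T x f)⟩ :=
        hJ.exists_extension (𝟭 A) T (by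
      intro x y a f
      have h := hs ((λ_ y).hom ≫ inv a ≫ (ρ_ x).inv) f
      rwa [γ.act_unit, γ'.act_unit, IsIso.inv_inv] at h)
    have key₁ : ∀ g, J.obj g ◁ t ≫ γ'.hom g = γ.hom g ≫ t ▷ J.obj g := by
      intro g
      refine hJ.hom_ext (tensorLeft (J.obj g)) fun x f => ?_
      obtain ⟨y, ⟨c⟩⟩ := TwoGroup.exists_twist g x
      calc
        _ = J.obj g ◁ (f ≫ t) ≫ γ'.hom g := by
          rw [MonoidalCategory.whiskerLeft_comp, Category.assoc]; rfl
        _ = tensorMap J c ≫ T y (γ.act 𝕜 c f) ▷ J.obj g := by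
          rw [ht x f, γ'.act_spec (𝕜 := 𝕜) c, hs]
        _ = (tensorMap J c ≫ γ.act 𝕜 c f ▷ J.obj g) ≫ t ▷ J.obj g := by
          rw [← ht]
          simp
        _ = _ := by
          rw [← γ.act_spec, Category.assoc]; rfl
    -- Naturality of both half-braidings along `f : J x ⟶ U` reduces the claim for `U` to `key₁`.
    have key₂ : ∀ U, U ◁ t ≫ (Y.2.β U).inv = (X.2.β U).inv ≫ t ▷ U := by
      intro U
      refine hJ.hom_ext (tensorRight X.1) fun x f => ?_
      have hX : f ▷ X.1 ≫ (X.2.β U).inv = (X.2.β (J.obj x)).inv ≫ X.1 ◁ f := by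
        rw [Iso.comp_inv_eq, Category.assoc, X.2.naturality, Iso.inv_hom_id_assoc]
      have hY : f ▷ Y.1 ≫ (Y.2.β U).inv = (Y.2.β (J.obj x)).inv ≫ Y.1 ◁ f := by
        rw [Iso.comp_inv_eq, Category.assoc, Y.2.naturality, Iso.inv_hom_id_assoc]
      calc
        _ = J.obj x ◁ t ≫ f ▷ Y.1 ≫ (Y.2.β U).inv := by
          rw [whisker_exchange_assoc]; rfl
        _ = (J.obj x ◁ t ≫ γ'.hom x) ≫ Y.1 ◁ f := by
          rw [hY]; exact (Category.assoc _ _ _).symm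
        _ = (γ.hom x ≫ X.1 ◁ f) ≫ t ▷ U := by
          rw [key₁, Category.assoc, Category.assoc, whisker_exchange]
        _ = (f ▷ X.1 ≫ (X.2.β U).inv) ≫ t ▷ U := by rw [hX]; rfl
        _ = _ := Category.assoc _ _ _
    refine ⟨⟨t, fun U => comm_of_inv_comm (key₂ U)⟩, ?_⟩
    ext x f
    exact ht x.as f

end
end TwoGroupFourier

namespace TwoGroupFourier

open Functor.LaxMonoidal Functor.OplaxMonoidal Functor.Monoidal

/-! ### From actions of the inertia category back to half-braidings -/

section

variable {G : Type u} [Groupoid.{v} G] [MonoidalCategory G]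

lemma Inertia.homMk_comp_inclusion {x y z g : G} (c : g ⊗ x ⟶ y ⊗ g) (b : y ⟶ z) :
    homMk g c ≫ (inclusion G).map b = homMk g (c ≫ b ▷ g) := by
  refine (homMk_comp _ _).trans (homMk_eq (λ_ g).hom ?_)
  calc
    _ = 𝟙 _ ⊗≫ c ⊗≫ b ▷ g := by monoidal
    _ = _ := by rw [compHom]; monoidal

lemma Inertia.inclusion_comp_homMk {x y z g : G} (c : g ⊗ x ⟶ y ⊗ g) (b : z ⟶ x) :
    (inclusion G).map b ≫ homMk g c = homMk g (g ◁ b ≫ c) := by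
  refine (homMk_comp _ _).trans (homMk_eq (ρ_ g).hom ?_)
  calc
    _ = 𝟙 _ ⊗≫ g ◁ b ⊗≫ c := by monoidal
    _ = _ := by rw [compHom]; monoidal

end

section

variable {𝕜 : Type w} [Field 𝕜] {G : Type u} [Groupoid.{v} G] [MonoidalCategory G]
  {A : Type*} [Category.{max v w} A] [Preadditive A] [Linear 𝕜 A] [MonoidalCategory A]
  (J : G ⥤ A)

variable (𝕜) in
/-- An action of the morphisms of the inertia category on the multiplicity spaces of `V`. -/
structure InertiaAction (V : A) where
  act {x y g : G} (c : g ⊗ x ⟶ y ⊗ g) : (J.obj x ⟶ V) →ₗ[𝕜] (J.obj y ⟶ V)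
  congr {x y g h : G} {c : g ⊗ x ⟶ y ⊗ g} {d : h ⊗ x ⟶ y ⊗ h} :
    Inertia.homMk g c = Inertia.homMk h d → act c = act d
  unit {x y : G} (b : x ⟶ y) (f : J.obj x ⟶ V) :
    act ((λ_ x).hom ≫ b ≫ (ρ_ y).inv) f = J.map (inv b) ≫ f
  comp {x y z g h : G} (c : g ⊗ x ⟶ y ⊗ g) (d : h ⊗ y ⟶ z ⊗ h) (f : J.obj x ⟶ V) :
    act (Inertia.compHom c d) f = act d (act c f)

namespace InertiaAction

variable {J} {V : A} (P : InertiaAction 𝕜 J V)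

omit [MonoidalCategory A] in
lemma act_comp_right {x y z g : G} (c : g ⊗ x ⟶ y ⊗ g) (b : y ⟶ z) (f : J.obj x ⟶ V) :
    P.act (c ≫ b ▷ g) f = J.map (inv b) ≫ P.act c f := by
  rw [← P.unit, ← P.comp, P.congr (c := Inertia.compHom c ((λ_ y).hom ≫ b ≫ (ρ_ z).inv))
    (d := c ≫ b ▷ g) (Inertia.homMk_comp_inclusion c b)]

omit [MonoidalCategory A] in
lemma act_comp_left {x y z g : G} (c : g ⊗ x ⟶ y ⊗ g) (b : z ⟶ x) (f : J.obj z ⟶ V) :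
    P.act (g ◁ b ≫ c) f = P.act c (J.map (inv b) ≫ f) := by
  rw [← P.unit, ← P.comp, P.congr (c := Inertia.compHom ((λ_ z).hom ≫ b ≫ (ρ_ x).inv) c)
    (d := g ◁ b ≫ c) (Inertia.inclusion_comp_homMk c b)]

variable [J.Monoidal] [TwoGroup G]

/-- Two morphisms out of `g ⊗ x` to `y ⊗ g` and `y' ⊗ g` differ by a unique `b : y ⟶ y'`, whose
contributions to `tensorMap` and to the action cancel. The half-braiding can therefore be defined
with any chosen `c`. -/
lemma tensorMap_act {x y y' g : G} (c : g ⊗ x ⟶ y ⊗ g) (c' : g ⊗ x ⟶ y' ⊗ g) (f : J.obj x ⟶ V) :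
    tensorMap J c' ≫ P.act c' f ▷ J.obj g = tensorMap J c ≫ P.act c f ▷ J.obj g := by
  obtain ⟨b, hb⟩ := (TwoGroup.whiskerRight_bijective g y y').2 (inv c ≫ c')
  obtain rfl : c' = c ≫ b ▷ g := by
    dsimp only at hb
    rw [hb, IsIso.hom_inv_id_assoc]
  rw [tensorMap_comp_right, P.act_comp_right, Category.assoc, ← comp_whiskerRight,
    ← J.map_comp_assoc, IsIso.hom_inv_id, J.map_id, Category.id_comp]

variable [MonoidalPreadditive A] [MonoidalLinear 𝕜 A] (hJ : IsLinearization 𝕜 J)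

include hJ

lemma exists_hom (g : G) : ∃ t : J.obj g ⊗ V ⟶ V ⊗ J.obj g,
    ∀ {x y : G} (c : g ⊗ x ⟶ y ⊗ g) (f : J.obj x ⟶ V),
      J.obj g ◁ f ≫ t = tensorMap J c ≫ P.act c f ▷ J.obj g := by
  have h := fun x => (TwoGroup.exists_twist g x)
  choose y hy using h
  have c := fun x => (hy x).some
  obtain ⟨t, ht⟩ := hJ.exists_extension (tensorLeft (J.obj g)) (V := V) (W := V ⊗ J.obj g)
    (fun x => (Linear.leftComp 𝕜 (V ⊗ J.obj g) (tensorMap J (c x))).comp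
      (((tensorRight (J.obj g)).mapLinearMap 𝕜).comp (P.act (c x)))) (by
    intro x x' a f
    -- The choices of `c` need not be natural in `x`, but `g ◁ a ≫ c x'` is another admissible
    -- choice at `x`.
    have h₁ := P.tensorMap_act (g ◁ a ≫ c x') (c x) (J.map a ≫ f)
    rw [tensorMap_comp_left, P.act_comp_left, ← J.map_comp_assoc, IsIso.inv_hom_id, J.map_id,
      Category.id_comp, Category.assoc] at h₁
    exact h₁)
  exact ⟨t, fun {x y} c' f => (ht x f).trans (P.tensorMap_act c' (c x) f)⟩

/-- The half-braiding determined by an action on multiplicity spaces. -/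
lemma exists_relHalfBraiding : ∃ γ : RelHalfBraiding J V,
    ∀ {x y g : G} (c : g ⊗ x ⟶ y ⊗ g) (f : J.obj x ⟶ V),
      J.obj g ◁ f ≫ γ.hom g = tensorMap J c ≫ P.act c f ▷ J.obj g := by
  choose γ hγ using P.exists_hom hJ
  refine ⟨⟨γ, fun {g h} a => ?_, ?_, fun g h => ?_⟩, fun c f => hγ _ c f⟩
  · refine hJ.hom_ext (tensorLeft (J.obj g)) fun x f => ?_
    obtain ⟨y, ⟨d⟩⟩ := TwoGroup.exists_twist h x
    -- Carrying `d` along `a` gives a representative with conjugating object `g` in the same class,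
    -- hence with the same action.
    have w : a ▷ x ≫ d = (a ▷ x ≫ d ≫ y ◁ inv a) ≫ y ◁ a := by
      simp [← MonoidalCategory.whiskerLeft_comp]
    calc
      _ = J.map a ▷ J.obj x ≫ J.obj h ◁ f ≫ γ h := whisker_exchange_assoc _ _ _
      _ = (J.map a ▷ J.obj x ≫ tensorMap J d) ≫ P.act d f ▷ J.obj h := by
        rw [hγ h d f, Category.assoc]
      _ = (tensorMap J (a ▷ x ≫ d ≫ y ◁ inv a) ≫
          P.act (a ▷ x ≫ d ≫ y ◁ inv a) f ▷ J.obj g) ≫ V ◁ J.map a := by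
        rw [tensorMap_naturality J w, P.congr (Inertia.homMk_eq a w), Category.assoc,
          Category.assoc, whisker_exchange]
      _ = _ := by rw [← hγ g _ f, Category.assoc]; rfl
  · refine hJ.hom_ext (tensorLeft (𝟙_ A)) fun x f => ?_
    have h₁ := tensorMap_unit J (𝟙 x)
    have h₂ : P.act ((λ_ x).hom ≫ 𝟙 x ≫ (ρ_ x).inv) f = f := by
      rw [P.unit, IsIso.inv_id, J.map_id, Category.id_comp]
    calc
      _ = ε J ▷ J.obj x ≫ J.obj (𝟙_ G) ◁ f ≫ γ (𝟙_ G) := whisker_exchange_assoc _ _ _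
      _ = (ε J ▷ J.obj x ≫ tensorMap J ((λ_ x).hom ≫ 𝟙 x ≫ (ρ_ x).inv)) ≫ f ▷ J.obj (𝟙_ G) := by
        rw [hγ _ ((λ_ x).hom ≫ 𝟙 x ≫ (ρ_ x).inv) f, h₂, Category.assoc]
      _ = (λ_ _).hom ≫ (ρ_ _).inv ≫ J.obj x ◁ ε J ≫ f ▷ J.obj (𝟙_ G) := by
        rw [h₁, J.map_id]
        simp only [Category.assoc, Category.id_comp]
      _ = (λ_ _).hom ≫ (ρ_ _).inv ≫ f ▷ 𝟙_ A ≫ V ◁ ε J := by rw [whisker_exchange]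
      _ = (𝟙_ A ◁ f) ≫ (λ_ V).hom ≫ (ρ_ V).inv ≫ V ◁ ε J := by simp
  · refine hJ.hom_ext (tensorLeft (J.obj g ⊗ J.obj h)) fun x f => ?_
    -- Choosing `c` for `h` and `d` for `g` makes `Inertia.compHom c d` an admissible choice for `g
    -- ⊗ h`, to which functoriality of the action applies.
    obtain ⟨y, ⟨c⟩⟩ := TwoGroup.exists_twist h x
    obtain ⟨z, ⟨d⟩⟩ := TwoGroup.exists_twist g y
    calc
      _ = μ J g h ▷ J.obj x ≫ J.obj (g ⊗ h) ◁ f ≫ γ (g ⊗ h) := whisker_exchange_assoc _ _ _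
      _ = (μ J g h ▷ J.obj x ≫ tensorMap J (Inertia.compHom c d)) ≫
          P.act d (P.act c f) ▷ J.obj (g ⊗ h) := by
        rw [hγ _ (Inertia.compHom c d) f, P.comp, Category.assoc]
      _ = (α_ _ _ _).hom ≫ J.obj g ◁ tensorMap J c ≫ (α_ _ _ _).inv ≫ tensorMap J d ▷ J.obj h ≫
          (α_ _ _ _).hom ≫ (J.obj z ◁ μ J g h ≫ P.act d (P.act c f) ▷ J.obj (g ⊗ h)) := by
        rw [tensorMap_compHom]
        simp only [Category.assoc]
      _ = (α_ _ _ _).hom ≫ J.obj g ◁ tensorMap J c ⊗≫ (tensorMap J d ≫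
          P.act d (P.act c f) ▷ J.obj g) ▷ J.obj h ⊗≫ V ◁ μ J g h := by
        rw [whisker_exchange]; monoidal
      _ = (α_ _ _ _).hom ≫ J.obj g ◁ (tensorMap J c ≫ P.act c f ▷ J.obj h) ⊗≫
          γ g ▷ J.obj h ⊗≫ V ◁ μ J g h := by
        rw [← hγ g d]; monoidal
      _ = (J.obj g ⊗ J.obj h) ◁ f ≫ (α_ _ _ _).hom ≫ J.obj g ◁ γ h ≫
          (α_ _ _ _).inv ≫ γ g ▷ J.obj h ≫ (α_ _ _ _).hom ≫ V ◁ μ J g h := by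
        rw [← hγ h c]; monoidal

end InertiaAction
end
end TwoGroupFourier

namespace TwoGroupFourier

open Functor.LaxMonoidal Functor.OplaxMonoidal Functor.Monoidal

/-! ### Extending relative half-braidings to all objects -/

namespace RelHalfBraiding

section

variable {G : Type*} [Groupoid G] [MonoidalCategory G]
  {A : Type*} [Category A] [MonoidalCategory A] {J : G ⥤ A} [J.Monoidal] {V : A}
  (γ : RelHalfBraiding J V)

lemma isIso_hom_of_iso {g h : G} (a : g ≅ h) [IsIso (γ.hom h)] : IsIso (γ.hom g) := by
  have e : γ.hom g = J.map a.hom ▷ V ≫ γ.hom h ≫ inv (V ◁ J.map a.hom) := by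
    rw [← Category.assoc, IsIso.eq_comp_inv, γ.naturality]
  rw [e]
  infer_instance

lemma isIso_hom_unit : IsIso (γ.hom (𝟙_ G)) := by
  have e : γ.hom (𝟙_ G) = inv (ε J ▷ V) ≫ (λ_ V).hom ≫ (ρ_ V).inv ≫ V ◁ ε J := by
    rw [IsIso.eq_inv_comp, γ.unit]
  rw [e]
  infer_instance

lemma isIso_hom_mul {g h : G} (e : g ⊗ h ≅ 𝟙_ G) :
    IsIso (J.obj g ◁ γ.hom h ≫ (α_ _ _ _).inv ≫ γ.hom g ▷ J.obj h) := by
  have := γ.isIso_hom_unit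
  have := γ.isIso_hom_of_iso e
  have e : J.obj g ◁ γ.hom h ≫ (α_ _ _ _).inv ≫ γ.hom g ▷ J.obj h = (α_ _ _ _).inv ≫
      μ J g h ▷ V ≫ γ.hom (g ⊗ h) ≫ inv (V ◁ μ J g h) ≫ (α_ _ _ _).inv := by
    rw [reassoc_of% γ.mul g h]
    simp
  rw [e]
  infer_instance

/-- Let `h` be inverse to `g`. By multiplicativity, the composites of whiskered half-braidings for
`g ⊗ h` and `h ⊗ g` are invertible, as at the unit. They provide a left inverse and a right inverse
of whiskered copies of `γ.hom g`; both descend, since whiskering with `J h` is bijective, and then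
coincide. -/
lemma isIso_hom [TwoGroup G] (g : G) : IsIso (γ.hom g) := by
  obtain ⟨h, ⟨e⟩, ⟨e'⟩⟩ := TwoGroup.exists_inverse g
  have := γ.isIso_hom_mul e
  have := γ.isIso_hom_mul e'
  obtain ⟨r, hr⟩ := (map_whiskerLeft_bijective J h (V ⊗ J.obj g) (J.obj g ⊗ V)).2
    ((α_ _ _ _).inv ≫ γ.hom h ▷ J.obj g ≫
      inv (J.obj h ◁ γ.hom g ≫ (α_ _ _ _).inv ≫ γ.hom h ▷ J.obj g))
  obtain ⟨s, hs⟩ := (map_whiskerRight_bijective J h (V ⊗ J.obj g) (J.obj g ⊗ V)).2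
    (inv (J.obj g ◁ γ.hom h ≫ (α_ _ _ _).inv ≫ γ.hom g ▷ J.obj h) ≫ J.obj g ◁ γ.hom h ≫
      (α_ _ _ _).inv)
  have hr' : γ.hom g ≫ r = 𝟙 _ := (map_whiskerLeft_bijective J h _ _).1 (by
    dsimp only at hr ⊢
    rw [MonoidalCategory.whiskerLeft_comp, hr, MonoidalCategory.whiskerLeft_id]
    simpa only [Category.assoc] using IsIso.hom_inv_id
      (J.obj h ◁ γ.hom g ≫ (α_ _ _ _).inv ≫ γ.hom h ▷ J.obj g))
  have hs' : s ≫ γ.hom g = 𝟙 _ := (map_whiskerRight_bijective J h _ _).1 (by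
    dsimp only at hs ⊢
    rw [comp_whiskerRight, hs, id_whiskerRight, Category.assoc, Category.assoc]
    exact IsIso.inv_hom_id (J.obj g ◁ γ.hom h ≫ (α_ _ _ _).inv ≫ γ.hom g ▷ J.obj h))
  have : s = r := by rw [← Category.comp_id s, ← hr', reassoc_of% hs']
  exact ⟨r, hr', this ▸ hs'⟩

end

section

variable {𝕜 : Type w} [Field 𝕜] {G : Type*} [Groupoid G] [MonoidalCategory G] [TwoGroup G]
  {A : Type*} [Category A] [Preadditive A] [Linear 𝕜 A] [MonoidalCategory A]
  [MonoidalPreadditive A] [MonoidalLinear 𝕜 A] {J : G ⥤ A} [J.Monoidal] {V : A}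
  (hJ : IsLinearization 𝕜 J) (γ : RelHalfBraiding J V)

include hJ

-- Naturality prescribes the half-braiding with `U` along every `J x ⟶ U`. The candidate inverse is
-- built likewise in `exists_extension_inv`, which needs the `γ.hom x` to be invertible.
omit [TwoGroup G] in
lemma exists_extension (U : A) : ∃ t : U ⊗ V ⟶ V ⊗ U,
    ∀ (x : G) (f : J.obj x ⟶ U), f ▷ V ≫ t = γ.hom x ≫ V ◁ f :=
  hJ.exists_extension (tensorRight V) (V := U) (W := V ⊗ U)
    (fun x => (Linear.leftComp 𝕜 (V ⊗ U) (γ.hom x)).comp ((tensorLeft V).mapLinearMap 𝕜))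
    (fun {x y} a f => by
      change γ.hom x ≫ V ◁ (J.map a ≫ f) = J.map a ▷ V ≫ γ.hom y ≫ V ◁ f
      rw [reassoc_of% γ.naturality a, MonoidalCategory.whiskerLeft_comp])

lemma exists_extension_inv (U : A) : ∃ t : V ⊗ U ⟶ U ⊗ V,
    ∀ (x : G) (f : J.obj x ⟶ U), γ.hom x ≫ V ◁ f ≫ t = f ▷ V := by
  have := γ.isIso_hom
  obtain ⟨t, ht⟩ := hJ.exists_extension (tensorLeft V) (V := U) (W := U ⊗ V)
    (fun x => (Linear.leftComp 𝕜 (U ⊗ V) (inv (γ.hom x))).comp ((tensorRight V).mapLinearMap 𝕜))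
    (fun {x y} a f => by
      change inv (γ.hom x) ≫ (J.map a ≫ f) ▷ V = V ◁ J.map a ≫ inv (γ.hom y) ≫ f ▷ V
      rw [IsIso.inv_comp_eq, ← reassoc_of% γ.naturality a, IsIso.hom_inv_id_assoc,
        comp_whiskerRight])
  refine ⟨t, fun x f => ?_⟩
  rw [← IsIso.eq_inv_comp]
  exact ht x f

/-- Half-braidings with the objects in the image of a linearization extend. -/
lemma exists_halfBraiding : ∃ β : HalfBraiding V, ofHalfBraiding J β = γ := by
  choose t ht using γ.exists_extension hJ
  choose s hs using γ.exists_extension_inv hJ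
  have nat : ∀ {U U' : A} (f : U ⟶ U'), f ▷ V ≫ t U' = t U ≫ V ◁ f := by
    intro U U' f
    refine hJ.hom_ext (tensorRight V) fun x u => ?_
    calc
      _ = (u ≫ f) ▷ V ≫ t U' := by rw [comp_whiskerRight, Category.assoc]; rfl
      _ = γ.hom x ≫ V ◁ u ≫ V ◁ f := by rw [ht, MonoidalCategory.whiskerLeft_comp]
      _ = _ := by rw [← reassoc_of% ht U x u]; rfl
  have ht' : ∀ g, t (J.obj g) = γ.hom g := by
    intro g
    have h := ht (J.obj g) g (𝟙 _)
    rwa [id_whiskerRight, Category.id_comp, MonoidalCategory.whiskerLeft_id,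
      Category.comp_id] at h
  -- Multiplicativity extends one tensor factor at a time: both factors from `G`, then an arbitrary
  -- second factor, then an arbitrary first one.
  have mul₀ : ∀ g h, t (J.obj g ⊗ J.obj h) = (α_ _ _ _).hom ≫ J.obj g ◁ t (J.obj h) ≫
      (α_ _ _ _).inv ≫ t (J.obj g) ▷ J.obj h ≫ (α_ _ _ _).hom := by
    intro g h
    rw [← cancel_mono (V ◁ μ J g h), ← nat, ht', ht', ht', γ.mul]
    simp only [Category.assoc]
  have mul₁ : ∀ g U, t (J.obj g ⊗ U) = (α_ _ _ _).hom ≫ J.obj g ◁ t U ≫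
      (α_ _ _ _).inv ≫ t (J.obj g) ▷ U ≫ (α_ _ _ _).hom := by
    intro g U
    refine hJ.hom_ext (tensorLeft (J.obj g) ⋙ tensorRight V) fun x u => ?_
    calc
      _ = (J.obj g ◁ u) ▷ V ≫ t (J.obj g ⊗ U) := rfl
      _ = (α_ _ _ _).hom ≫ J.obj g ◁ t (J.obj x) ⊗≫ (t (J.obj g) ▷ J.obj x ≫
          (V ⊗ J.obj g) ◁ u) ⊗≫ 𝟙 _ := by rw [nat, mul₀]; monoidal
      _ = (α_ _ _ _).hom ≫ J.obj g ◁ (t (J.obj x) ≫ V ◁ u) ⊗≫ t (J.obj g) ▷ U ⊗≫ 𝟙 _ := by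
        rw [← whisker_exchange]; monoidal
      _ = (J.obj g ◁ u) ▷ V ≫ (α_ _ _ _).hom ≫ J.obj g ◁ t U ≫
          (α_ _ _ _).inv ≫ t (J.obj g) ▷ U ≫ (α_ _ _ _).hom := by
        rw [← nat]; monoidal
  have mul₂ : ∀ U U', t (U ⊗ U') = (α_ _ _ _).hom ≫ U ◁ t U' ≫
      (α_ _ _ _).inv ≫ t U ▷ U' ≫ (α_ _ _ _).hom := by
    intro U U'
    refine hJ.hom_ext (tensorRight U' ⋙ tensorRight V) fun x u => ?_
    calc
      _ = (u ▷ U') ▷ V ≫ t (U ⊗ U') := rfl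
      _ = (α_ _ _ _).hom ≫ J.obj x ◁ t U' ⊗≫ (t (J.obj x) ≫ V ◁ u) ▷ U' ⊗≫ 𝟙 _ := by
        rw [nat, mul₁]; monoidal
      _ = (α_ _ _ _).hom ≫ (J.obj x ◁ t U' ≫ u ▷ (V ⊗ U')) ⊗≫ t U ▷ U' ⊗≫ 𝟙 _ := by
        rw [← nat]; monoidal
      _ = (u ▷ U') ▷ V ≫ (α_ _ _ _).hom ≫ U ◁ t U' ≫
          (α_ _ _ _).inv ≫ t U ▷ U' ≫ (α_ _ _ _).hom := by
        rw [whisker_exchange]; monoidal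
  have hts : ∀ U, t U ≫ s U = 𝟙 _ := by
    intro U
    refine hJ.hom_ext (tensorRight V) fun x u => ?_
    calc
      _ = (u ▷ V ≫ t U) ≫ s U := (Category.assoc _ _ _).symm
      _ = u ▷ V := by rw [ht, Category.assoc, hs]
      _ = _ := (Category.comp_id _).symm
  have hst : ∀ U, s U ≫ t U = 𝟙 _ := by
    intro U
    have := γ.isIso_hom
    refine hJ.hom_ext (tensorLeft V) fun x u => (cancel_epi (γ.hom x)).1 ?_
    calc
      _ = (γ.hom x ≫ V ◁ u ≫ s U) ≫ t U := by simp only [Category.assoc]; rfl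
      _ = γ.hom x ≫ V ◁ u := by rw [hs, ht]
      _ = _ := congrArg (γ.hom x ≫ ·) (Category.comp_id _).symm
  let b (U : A) : U ⊗ V ≅ V ⊗ U := ⟨t U, s U, hts U, hst U⟩
  refine ⟨⟨fun U => (b U).symm, fun U U' => ?_, fun {U U'} f => ?_⟩, ?_⟩
  · have e : b (U ⊗ U') = α_ _ _ _ ≪≫ whiskerLeftIso U (b U') ≪≫ (α_ _ _ _).symm ≪≫
        whiskerRightIso (b U) U' ≪≫ α_ _ _ _ := Iso.ext (mul₂ U U')
    refine (congrArg Iso.inv e).trans ?_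
    simp
  · have h := nat f
    change V ◁ f ≫ (b U').inv = (b U).inv ≫ f ▷ V
    rw [Iso.comp_inv_eq, Category.assoc, Iso.eq_inv_comp]
    exact h.symm
  -- The other fields are propositions, so it suffices that the underlying families agree, which is
  -- `ht'`.
  · obtain ⟨γ, _, _, _⟩ := γ
    have h : (fun g => t (J.obj g)) = γ := funext ht'
    subst h
    rfl

end

end RelHalfBraiding
end TwoGroupFourier

/-! ### Essential surjectivity and restriction to the 2-group -/

namespace TwoGroupFourier

/-- Dividing by a fixed `a : x ⟶ y` turns morphisms into automorphisms of `x`, and tensoring with an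
inverse of `x` embeds these in the endomorphisms of the unit. -/
lemma TwoGroup.finite_hom {G : Type*} [Groupoid G] [MonoidalCategory G] [TwoGroup G]
    [TwoGroup.IsFinite G] (x y : G) : Finite (x ⟶ y) := by
  rcases isEmpty_or_nonempty (x ⟶ y) with h | ⟨⟨a⟩⟩
  · infer_instance
  · obtain ⟨h, ⟨e⟩, ⟨e'⟩⟩ := TwoGroup.exists_inverse x
    have := TwoGroup.IsFinite.finite_pi₂ (G := G)
    exact Finite.of_injective (fun b : x ⟶ y => e.inv ≫ (b ≫ inv a) ▷ h ≫ e.hom) fun b b' hb => by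
      have hb' : (b ≫ inv a) ▷ h = (b' ≫ inv a) ▷ h := by
        simpa only [cancel_epi, ← Category.assoc, cancel_mono] using hb
      simpa only [cancel_mono] using (TwoGroup.whiskerRight_bijective h x x).1 hb'

section

variable {𝕜 : Type w} [Field 𝕜] {G : Type u} [Groupoid.{v} G] [MonoidalCategory G]
  {A : Type*} [Category.{max v w} A] [Preadditive A] [Linear 𝕜 A] (J : G ⥤ A)

/-- The action of the inertia category on multiplicity spaces that are identified with the
values of a functor. -/
noncomputable def InertiaAction.ofIso (F : Inertia G ⥤ ModuleCat.{max v w} 𝕜) {V : A}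
    (Φ : (homFunctor 𝕜 J).obj V ≅ Inertia.inclusion G ⋙ F) : InertiaAction 𝕜 J V where
  act {x y g} c := (Φ.inv.app y).hom.comp
    ((F.map (Inertia.homMk g c)).hom.comp (Φ.hom.app x).hom)
  congr h := by rw [h]
  unit {x y} b f := by
    refine Eq.trans ?_ (homFunctor_map_apply (𝕜 := 𝕜) J V b f)
    have h' : ((homFunctor 𝕜 J).obj V).map b =
        Φ.hom.app x ≫ F.map ((Inertia.inclusion G).map b) ≫ Φ.inv.app y := by
      rw [← Category.assoc]
      exact (Iso.eq_comp_inv (Φ.app y)).2 (Φ.hom.naturality b)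
    exact (congrArg (fun t : ((homFunctor 𝕜 J).obj V).obj x ⟶ ((homFunctor 𝕜 J).obj V).obj y =>
      t.hom f) h').symm
  comp {x y z g h} c d f := by
    have hy : ∀ n : F.obj ⟨y⟩, (Φ.hom.app y).hom ((Φ.inv.app y).hom n) = n := fun n =>
      congrArg (fun t => t.hom n) (Φ.inv_hom_id_app y)
    refine Eq.trans (congrArg (fun t : F.obj ⟨x⟩ ⟶ F.obj ⟨z⟩ => (Φ.inv.app z).hom
      (t.hom ((Φ.hom.app x).hom f))) (F.map_comp (Inertia.homMk g c) (Inertia.homMk h d))) ?_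
    exact congrArg (fun n => (Φ.inv.app z).hom ((F.map (Inertia.homMk h d)).hom n)) (hy _).symm

end

section

variable {𝕜 : Type w} [Field 𝕜] {G : Type u} [Groupoid.{v} G] [MonoidalCategory G] [TwoGroup G]
  {A : Type*} [Category.{max v w} A] [Preadditive A] [Linear 𝕜 A] [MonoidalCategory A]
  [MonoidalPreadditive A] [MonoidalLinear 𝕜 A] (J : G ⥤ A) [J.Monoidal]
  [∀ (x : G) (V : A), Module.Finite 𝕜 (J.obj x ⟶ V)]

variable (𝕜) in
/-- The restriction of `centerRep` to `G` is given by multiplicity spaces. -/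
noncomputable def centerRepRestrictIso :
    centerRep 𝕜 J ⋙ (Functor.whiskeringLeft _ _ _).obj (Inertia.inclusion G) ⋙
        (Functor.whiskeringRight _ _ _).obj
          (forget₂ (FGModuleCat.{max v w} 𝕜) (ModuleCat.{max v w} 𝕜)) ≅
      Center.forget A ⋙ homFunctor 𝕜 J :=
  NatIso.ofComponents (fun X => NatIso.ofComponents
      (F := Inertia.inclusion G ⋙ (centerRep 𝕜 J).obj X ⋙
        forget₂ (FGModuleCat.{max v w} 𝕜) (ModuleCat.{max v w} 𝕜))
      (G := (homFunctor 𝕜 J).obj X.1)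
      (fun x => Iso.refl (ModuleCat.of 𝕜 (J.obj x ⟶ X.1)))
      (fun {x y} b => by
        refine (Category.comp_id _).trans (Eq.trans ?_ (Category.id_comp _).symm)
        refine ModuleCat.hom_ext (LinearMap.ext fun f => ?_)
        exact ((RelHalfBraiding.ofHalfBraiding J X.2).act_unit b f).trans
          (homFunctor_map_apply (𝕜 := 𝕜) J X.1 b f).symm))
    (fun {X Y} t => by
      ext x : 2
      exact (Category.comp_id _).trans (Category.id_comp _).symm)

variable {J} (hJ : IsLinearization 𝕜 J)

-- The restriction of `F` to `G` is realized by some `V`; the action of the inertia category is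
-- moved to the multiplicity spaces of `V`, turned into a relative half-braiding and extended to a
-- half-braiding.
include hJ in
lemma centerRep_essSurj [CharZero 𝕜] [Limits.HasFiniteBiproducts A] [IsIdempotentComplete A]
    [TwoGroup.IsFinite G] : (centerRep 𝕜 J).EssSurj where
  mem_essImage F := by
    have := TwoGroup.finite_hom (G := G)
    have := fun x y : G => Fintype.ofFinite (x ⟶ y)
    have := TwoGroup.IsFinite.finite_pi₁ (G := G)
    let F' := F ⋙ forget₂ (FGModuleCat.{max v w} 𝕜) (ModuleCat.{max v w} 𝕜)
    have : ∀ x, Module.Finite 𝕜 ((Inertia.inclusion G ⋙ F').obj x) := fun x =>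
      (F.obj ⟨x⟩).property
    obtain ⟨V, ⟨Φ⟩⟩ := hJ.exists_homFunctor_iso (Inertia.inclusion G ⋙ F')
    let P := InertiaAction.ofIso J F' Φ
    obtain ⟨γ, hγ⟩ := P.exists_relHalfBraiding hJ
    obtain ⟨β, rfl⟩ := γ.exists_halfBraiding hJ
    have key : ∀ {x y g : G} (c : g ⊗ x ⟶ y ⊗ g) (f : J.obj x ⟶ V),
        (Φ.hom.app y).hom ((RelHalfBraiding.ofHalfBraiding J β).act 𝕜 c f) =
          (F'.map (Inertia.homMk g c)).hom ((Φ.hom.app x).hom f) := by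
      intro x y g c f
      -- The action defined by the new half-braiding solves the same equation as the transported
      -- one, so uniqueness identifies them.
      rw [RelHalfBraiding.act_eq _ (hγ c f)]
      exact congrArg (fun t => t.hom ((F'.map (Inertia.homMk g c)).hom ((Φ.hom.app x).hom f)))
        (Φ.inv_hom_id_app y)
    refine ⟨⟨V, β⟩, ⟨NatIso.ofComponents
      (fun x => ObjectProperty.isoMk _ (X := FGModuleCat.of 𝕜 (J.obj x.as ⟶ V)) (Y := F.obj x)
        (Φ.app x.as)) ?_⟩⟩
    rintro ⟨x⟩ ⟨y⟩ m
    obtain ⟨g, c, rfl⟩ := Inertia.homMk_surjective m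
    exact FGModuleCat.hom_ext (LinearMap.ext fun f => key c f)

end
end TwoGroupFourier

namespace TwoGroupFourier

/-! ### The 2-group algebra as a linearization -/

section Linearization

variable (R : Type w) [CommRing R] (C : Type u) [Category.{v} C] [MonoidalCategory C]

instance freeMonoidalLinear : MonoidalLinear R (Free R C) where
  whiskerLeft_smul X Y Z r f := map_smul (freeTensor (R := R) (C := C) X X Y Z _) r f
  smul_whiskerRight r {Y Z} f X :=
    LinearMap.congr_fun (map_smul (freeTensor (R := R) (C := C) Y Z X X) r f) _

/-- The inclusion of a monoidal category in its linearization is monoidal. -/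
noncomputable def freeEmbeddingCoreMonoidal : (Free.embedding R C).CoreMonoidal where
  εIso := Iso.refl _
  -- On objects, the tensor product of the linearization is that of `C`.
  μIso _ _ := Iso.refl _
  μIso_hom_natural_left {X Y} f X' := by
    refine (Category.comp_id _).trans (Eq.trans ?_ (Category.id_comp _).symm)
    refine (freeTensorHom_single f (𝟙 X') (1 : R) 1).trans ?_
    rw [mul_one, tensorHom_id]
    rfl
  μIso_hom_natural_right {X Y} X' f := by
    refine (Category.comp_id _).trans (Eq.trans ?_ (Category.id_comp _).symm)
    refine (freeTensorHom_single (𝟙 X') f (1 : R) 1).trans ?_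
    rw [mul_one, id_tensorHom]
    rfl
  associativity X Y Z := by
    rw [Iso.refl_hom, Iso.refl_hom, Iso.refl_hom, Iso.refl_hom]
    refine Eq.trans (b := (α_ _ _ _).hom) ?_ ?_
    · refine (congrArg (· ≫ _) (id_whiskerRight _ _)).trans ?_
      exact (Category.id_comp _).trans (Category.id_comp _)
    · refine Eq.trans ?_ (congrArg (fun t => _ ≫ t ≫ _)
        (MonoidalCategory.whiskerLeft_id _ _).symm)
      exact ((congrArg (_ ≫ ·) (Category.id_comp _)).trans (Category.comp_id _)).symm
  left_unitality X := by
    refine Eq.trans ?_ (congrArg (· ≫ _) (id_whiskerRight _ _)).symm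
    exact ((Category.id_comp _).trans (Category.id_comp _)).symm
  right_unitality X := by
    refine Eq.trans ?_ (congrArg (· ≫ _) (MonoidalCategory.whiskerLeft_id _ _)).symm
    exact ((Category.id_comp _).trans (Category.id_comp _)).symm

end Linearization

section AdditiveCompletion

variable (C : Type u) [Category.{v} C] [Preadditive C] [MonoidalCategory C] [MonoidalPreadditive C]

instance matMonoidalPreadditive : MonoidalPreadditive (Mat_ C) where
  whiskerLeft_zero {M N K} := by
    ext ⟨i, j⟩ ⟨k, l⟩
    exact MonoidalPreadditive.tensor_zero ((𝟙 M : M ⟶ M) i k)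
  zero_whiskerRight {M N K} := by
    ext ⟨i, j⟩ ⟨k, l⟩
    exact MonoidalPreadditive.zero_tensor ((𝟙 M : M ⟶ M) j l)
  whiskerLeft_add {M N K} f g := by
    ext ⟨i, j⟩ ⟨k, l⟩
    exact MonoidalPreadditive.tensor_add ((𝟙 M : M ⟶ M) i k) (f j l) (g j l)
  add_whiskerRight {M N K} f g := by
    ext ⟨i, j⟩ ⟨k, l⟩
    exact MonoidalPreadditive.add_tensor (f i k) (g i k) ((𝟙 M : M ⟶ M) j l)

instance matMonoidalLinear (R : Type w) [CommRing R] [Linear R C] [MonoidalLinear R C] :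
    MonoidalLinear R (Mat_ C) where
  whiskerLeft_smul M {N K} r f := by
    ext ⟨i, j⟩ ⟨k, l⟩
    change (𝟙 M : M ⟶ M) i k ⊗ₘ (r • f j l) = r • ((𝟙 M : M ⟶ M) i k ⊗ₘ f j l)
    rw [MonoidalCategory.tensorHom_def, MonoidalCategory.tensorHom_def,
      MonoidalLinear.whiskerLeft_smul, Linear.comp_smul]
  smul_whiskerRight r {N K} f M := by
    ext ⟨i, j⟩ ⟨k, l⟩
    change (r • f i k) ⊗ₘ (𝟙 M : M ⟶ M) j l = r • (f i k ⊗ₘ (𝟙 M : M ⟶ M) j l)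
    rw [MonoidalCategory.tensorHom_def, MonoidalCategory.tensorHom_def,
      MonoidalLinear.smul_whiskerRight, Linear.smul_comp]

variable {C}

omit [MonoidalCategory C] [MonoidalPreadditive C] in
lemma mat_comp_apply_of_unique {M N K : Mat_ C} (A : M ⟶ N) (B : N ⟶ K) (i : M.ι) (k : K.ι)
    (j : N.ι) (h : ∀ j', j' = j) : (A ≫ B) i k = A i j ≫ B j k := by
  rw [Mat_.comp_apply, Finset.sum_eq_single j (fun j' _ hj => absurd (h j') hj) (by simp)]

/-- The comparison of the tensor product of one-by-one matrices. -/
noncomputable def matEmbeddingμ (X Y : C) :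
    matTensorObj ((Mat_.embedding C).obj X) ((Mat_.embedding C).obj Y) ≅
      (Mat_.embedding C).obj (X ⊗ Y) :=
  matIso (M := matTensorObj ((Mat_.embedding C).obj X) ((Mat_.embedding C).obj Y))
    (N := (Mat_.embedding C).obj (X ⊗ Y)) (Equiv.punitProd PUnit) fun _ => Iso.refl _

omit [MonoidalPreadditive C] in
lemma matEmbeddingμ_apply (X Y : C) (p : PUnit × PUnit) (q : PUnit) :
    (matEmbeddingμ X Y).hom p q = 𝟙 (X ⊗ Y) :=
  matDiag_apply_self (M := matTensorObj ((Mat_.embedding C).obj X) ((Mat_.embedding C).obj Y))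
    (N := (Mat_.embedding C).obj (X ⊗ Y)) (Equiv.punitProd PUnit) (fun _ => 𝟙 _) p

omit [MonoidalCategory C] [MonoidalPreadditive C] in
lemma embedding_id_apply (X : C) (p q : PUnit) :
    (𝟙 ((Mat_.embedding C).obj X) : (Mat_.embedding C).obj X ⟶ _) p q = 𝟙 X :=
  Mat_.id_apply_self ((Mat_.embedding C).obj X) p

variable (C)

/-- The inclusion of a preadditive monoidal category in its additive completion is monoidal. -/
noncomputable def matEmbeddingCoreMonoidal : (Mat_.embedding C).CoreMonoidal where
  εIso := Iso.refl _
  -- Two one-element tuples have a tensor product indexed by `PUnit × PUnit`, so this comparison is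
  -- a reindexing.
  μIso X Y := matEmbeddingμ X Y
  μIso_hom_natural_left {X Y} f X' := by
    ext ⟨⟨⟩, ⟨⟩⟩ ⟨⟩
    refine (mat_comp_apply_of_unique _ _ _ _ (PUnit.unit, PUnit.unit) (fun _ => rfl)).trans ?_
    refine Eq.trans ?_ (mat_comp_apply_of_unique _ _ _ _ PUnit.unit (fun _ => rfl)).symm
    refine (congrArg (_ ≫ ·) (matEmbeddingμ_apply Y X' _ _)).trans ?_
    refine (Category.comp_id _).trans ?_
    refine Eq.trans ?_ (congrArg (· ≫ _) (matEmbeddingμ_apply X X' _ _)).symm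
    refine Eq.trans ?_ (Category.id_comp _).symm
    exact (congrArg (f ⊗ₘ ·) (embedding_id_apply X' _ _)).trans (tensorHom_id _ _)
  μIso_hom_natural_right {X Y} X' f := by
    ext ⟨⟨⟩, ⟨⟩⟩ ⟨⟩
    refine (mat_comp_apply_of_unique _ _ _ _ (PUnit.unit, PUnit.unit) (fun _ => rfl)).trans ?_
    refine Eq.trans ?_ (mat_comp_apply_of_unique _ _ _ _ PUnit.unit (fun _ => rfl)).symm
    refine (congrArg (_ ≫ ·) (matEmbeddingμ_apply X' Y _ _)).trans ?_
    refine (Category.comp_id _).trans ?_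
    refine Eq.trans ?_ (congrArg (· ≫ _) (matEmbeddingμ_apply X' X _ _)).symm
    refine Eq.trans ?_ (Category.id_comp _).symm
    exact (congrArg (· ⊗ₘ f) (embedding_id_apply X' _ _)).trans (id_tensorHom _ _)
  associativity X Y Z := by
    ext ⟨⟨⟨⟩, ⟨⟩⟩, ⟨⟩⟩ ⟨⟩
    have e₁ : (matEmbeddingμ X Y).hom (PUnit.unit, PUnit.unit) PUnit.unit ⊗ₘ
        (𝟙 ((Mat_.embedding C).obj Z) : (Mat_.embedding C).obj Z ⟶ _) PUnit.unit PUnit.unit =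
          𝟙 ((X ⊗ Y) ⊗ Z) :=
      (congrArg₂ (· ⊗ₘ ·) (matEmbeddingμ_apply X Y _ _) (embedding_id_apply Z _ _)).trans
        (id_tensorHom_id _ _)
    have e₂ : (𝟙 ((Mat_.embedding C).obj X) : (Mat_.embedding C).obj X ⟶ _)
        PUnit.unit PUnit.unit ⊗ₘ (matEmbeddingμ Y Z).hom (PUnit.unit, PUnit.unit) PUnit.unit =
          𝟙 (X ⊗ (Y ⊗ Z)) :=
      (congrArg₂ (· ⊗ₘ ·) (embedding_id_apply X _ _) (matEmbeddingμ_apply Y Z _ _)).trans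
        (id_tensorHom_id _ _)
    have e₃ : (matAssociator ((Mat_.embedding C).obj X) ((Mat_.embedding C).obj Y)
        ((Mat_.embedding C).obj Z)).hom ((PUnit.unit, PUnit.unit), PUnit.unit)
          (PUnit.unit, (PUnit.unit, PUnit.unit)) = (α_ X Y Z).hom :=
      matDiag_apply_self (M := matTensorObj (matTensorObj ((Mat_.embedding C).obj X)
        ((Mat_.embedding C).obj Y)) ((Mat_.embedding C).obj Z))
        (N := matTensorObj ((Mat_.embedding C).obj X) (matTensorObj ((Mat_.embedding C).obj Y)
        ((Mat_.embedding C).obj Z))) (Equiv.prodAssoc PUnit PUnit PUnit)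
        (fun _ => (α_ X Y Z).hom) ((PUnit.unit, PUnit.unit), PUnit.unit)
    refine (mat_comp_apply_of_unique _ _ _ _ (PUnit.unit, PUnit.unit) (fun _ => rfl)).trans ?_
    refine (congrArg₂ (· ≫ ·) e₁ ((mat_comp_apply_of_unique _ _ _ _ PUnit.unit
      (fun _ => rfl)).trans (congrArg (· ≫ _) (matEmbeddingμ_apply (X ⊗ Y) Z _ _)))).trans ?_
    refine Eq.trans ?_ (mat_comp_apply_of_unique (α_ ((Mat_.embedding C).obj X)
      ((Mat_.embedding C).obj Y) ((Mat_.embedding C).obj Z)).hom ((Mat_.embedding C).obj X ◁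
      (matEmbeddingμ Y Z).hom ≫ (matEmbeddingμ X (Y ⊗ Z)).hom) _ _
      (PUnit.unit, (PUnit.unit, PUnit.unit)) (fun _ => rfl)).symm
    refine Eq.trans ?_ (congrArg₂ (· ≫ ·) e₃ ((mat_comp_apply_of_unique _ _ _ _
      (PUnit.unit, PUnit.unit) (fun _ => rfl)).trans (congrArg₂ (· ≫ ·) e₂
        (matEmbeddingμ_apply X (Y ⊗ Z) _ _)))).symm
    refine (Category.id_comp _).trans ((Category.id_comp _).trans ?_)
    exact ((congrArg (_ ≫ ·) (Category.comp_id _)).trans (Category.comp_id _)).symm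
  left_unitality X := by
    refine Eq.trans ?_ (congrArg (· ≫ _) (id_whiskerRight _ _)).symm
    refine Eq.trans ?_ (Category.id_comp _).symm
    ext ⟨⟨⟩, ⟨⟩⟩ ⟨⟩
    refine (matDiag_apply_self (M := matTensorObj ((Mat_.embedding C).obj (𝟙_ C))
      ((Mat_.embedding C).obj X)) (N := (Mat_.embedding C).obj X) (Equiv.punitProd PUnit)
      (fun _ => (λ_ X).hom) (PUnit.unit, PUnit.unit)).trans ?_
    refine Eq.trans ?_ (mat_comp_apply_of_unique _ _ _ _ PUnit.unit (fun _ => rfl)).symm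
    exact ((congrArg (· ≫ (λ_ X).hom) (matEmbeddingμ_apply (𝟙_ C) X _ _)).trans
      (Category.id_comp _)).symm
  right_unitality X := by
    refine Eq.trans ?_ (congrArg (· ≫ _) (MonoidalCategory.whiskerLeft_id _ _)).symm
    refine Eq.trans ?_ (Category.id_comp _).symm
    ext ⟨⟨⟩, ⟨⟩⟩ ⟨⟩
    refine (matDiag_apply_self (M := matTensorObj ((Mat_.embedding C).obj X)
      ((Mat_.embedding C).obj (𝟙_ C))) (N := (Mat_.embedding C).obj X) (Equiv.prodPUnit PUnit)
      (fun _ => (ρ_ X).hom) (PUnit.unit, PUnit.unit)).trans ?_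
    refine Eq.trans ?_ (mat_comp_apply_of_unique _ _ _ _ PUnit.unit (fun _ => rfl)).symm
    exact ((congrArg (· ≫ (ρ_ X).hom) (matEmbeddingμ_apply X (𝟙_ C) _ _)).trans
      (Category.id_comp _)).symm

end AdditiveCompletion

section IdempotentCompletion

open Idempotents

variable (C : Type u) [Category.{v} C] [Preadditive C] [MonoidalCategory C] [MonoidalPreadditive C]

instance karMonoidalPreadditive : MonoidalPreadditive (Karoubi C) where
  whiskerLeft_zero := Karoubi.hom_ext _ _ (MonoidalPreadditive.tensor_zero _)
  zero_whiskerRight := Karoubi.hom_ext _ _ (MonoidalPreadditive.zero_tensor _)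
  whiskerLeft_add _ _ := Karoubi.hom_ext _ _ (MonoidalPreadditive.tensor_add _ _ _)
  add_whiskerRight _ _ := Karoubi.hom_ext _ _ (MonoidalPreadditive.add_tensor _ _ _)

instance karMonoidalLinear (R : Type w) [CommRing R] [Linear R C] [MonoidalLinear R C] :
    MonoidalLinear R (Karoubi C) where
  whiskerLeft_smul P {Q S} r f := by
    refine Karoubi.hom_ext _ _ ?_
    change P.p ⊗ₘ (r • f.f) = r • (P.p ⊗ₘ f.f)
    rw [MonoidalCategory.tensorHom_def, MonoidalCategory.tensorHom_def,
      MonoidalLinear.whiskerLeft_smul, Linear.comp_smul]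
  smul_whiskerRight r {Q S} f P := by
    refine Karoubi.hom_ext _ _ ?_
    change (r • f.f) ⊗ₘ P.p = r • (f.f ⊗ₘ P.p)
    rw [MonoidalCategory.tensorHom_def, MonoidalCategory.tensorHom_def,
      MonoidalLinear.smul_whiskerRight, Linear.smul_comp]

end IdempotentCompletion

section

open Idempotents

variable (C : Type u) [Category.{v} C] [MonoidalCategory C]

/-- The inclusion of a monoidal category in its idempotent completion is monoidal. -/
noncomputable def toKaroubiCoreMonoidal : (toKaroubi C).CoreMonoidal where
  εIso := Iso.refl _
  -- The idempotent of the tensor product is `𝟙 X ⊗ₘ 𝟙 Y`, equal to the identity only by a lemma;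
  -- hence `karIso`.
  μIso X Y := karIso (P := karTensorObj ((toKaroubi C).obj X) ((toKaroubi C).obj Y))
    (Q := (toKaroubi C).obj (X ⊗ Y)) (Iso.refl (X ⊗ Y))
    ((Category.comp_id _).trans ((id_tensorHom_id X Y).trans (Category.id_comp _).symm))
  μIso_hom_natural_left {X Y} f X' := by
    refine Karoubi.hom_ext _ _ ?_
    change (f ⊗ₘ 𝟙 X') ≫ (𝟙 Y ⊗ₘ 𝟙 X') ≫ 𝟙 (Y ⊗ X') = ((𝟙 X ⊗ₘ 𝟙 X') ≫ 𝟙 (X ⊗ X')) ≫ f ▷ X'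
    simp
  μIso_hom_natural_right {X Y} X' f := by
    refine Karoubi.hom_ext _ _ ?_
    change (𝟙 X' ⊗ₘ f) ≫ (𝟙 X' ⊗ₘ 𝟙 Y) ≫ 𝟙 (X' ⊗ Y) = ((𝟙 X' ⊗ₘ 𝟙 X) ≫ 𝟙 (X' ⊗ X)) ≫ X' ◁ f
    simp
  associativity X Y Z := by
    refine Karoubi.hom_ext _ _ ?_
    change (((𝟙 X ⊗ₘ 𝟙 Y) ≫ 𝟙 (X ⊗ Y)) ⊗ₘ 𝟙 Z) ≫ ((𝟙 (X ⊗ Y) ⊗ₘ 𝟙 Z) ≫ 𝟙 ((X ⊗ Y) ⊗ Z)) ≫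
      (α_ X Y Z).hom = (((𝟙 X ⊗ₘ 𝟙 Y) ⊗ₘ 𝟙 Z) ≫ (α_ X Y Z).hom) ≫
        (𝟙 X ⊗ₘ ((𝟙 Y ⊗ₘ 𝟙 Z) ≫ 𝟙 (Y ⊗ Z))) ≫ (𝟙 X ⊗ₘ 𝟙 (Y ⊗ Z)) ≫ 𝟙 (X ⊗ (Y ⊗ Z))
    simp
  left_unitality X := by
    refine Karoubi.hom_ext _ _ ?_
    change (𝟙 (𝟙_ C) ⊗ₘ 𝟙 X) ≫ (λ_ X).hom =
      (𝟙 (𝟙_ C) ⊗ₘ 𝟙 X) ≫ ((𝟙 (𝟙_ C) ⊗ₘ 𝟙 X) ≫ 𝟙 (𝟙_ C ⊗ X)) ≫ (λ_ X).hom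
    simp
  right_unitality X := by
    refine Karoubi.hom_ext _ _ ?_
    change (𝟙 X ⊗ₘ 𝟙 (𝟙_ C)) ≫ (ρ_ X).hom =
      (𝟙 X ⊗ₘ 𝟙 (𝟙_ C)) ≫ ((𝟙 X ⊗ₘ 𝟙 (𝟙_ C)) ≫ 𝟙 (X ⊗ 𝟙_ C)) ≫ (ρ_ X).hom
    simp

end

end TwoGroupFourier

/-! ### The 2-group algebra is a monoidal linearization -/

namespace TwoGroupFourier

section

variable (𝕜 : Type w) [Field 𝕜] (G : Type u) [Groupoid.{v} G] [MonoidalCategory G]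

noncomputable instance vectGOfMonoidal : (VectG.of 𝕜 G).Monoidal :=
  letI := (freeEmbeddingCoreMonoidal 𝕜 G).toMonoidal
  letI := (matEmbeddingCoreMonoidal (Free 𝕜 G)).toMonoidal
  letI := (toKaroubiCoreMonoidal (Mat_ (Free 𝕜 G))).toMonoidal
  inferInstance

end

section

open Idempotents

variable {𝕜 : Type w} [Field 𝕜] {G : Type u} [Groupoid.{v} G]

/-- Morphisms between objects of `G` in the 2-group algebra are formal linear combinations. -/
noncomputable def vectGHomEquiv (x y : G) :
    ((VectG.of 𝕜 G).obj x ⟶ (VectG.of 𝕜 G).obj y) ≃ₗ[𝕜] ((x ⟶ y) →₀ 𝕜) where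
  toFun f := f.f PUnit.unit PUnit.unit
  invFun f := (toKaroubi _).map ((Mat_.embedding (Free 𝕜 G)).map
    (X := Free.of 𝕜 x) (Y := Free.of 𝕜 y) f)
  map_add' _ _ := rfl
  map_smul' _ _ := rfl
  left_inv _ := rfl
  right_inv _ := rfl

lemma mat_sum_apply {C : Type*} [Category C] [Preadditive C] {M N : Mat_ C} {κ : Type*}
    (s : Finset κ) (f : κ → (M ⟶ N)) (i : M.ι) (j : N.ι) :
    (∑ k ∈ s, f k) i j = ∑ k ∈ s, f k i j := by
  classical
  induction s using Finset.induction_on with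
  | empty => rfl
  | insert k s hk h =>
    rw [Finset.sum_insert hk, Finset.sum_insert hk, ← h]
    rfl

/-- Every object of the idempotent completion of the additive completion is a retract of a finite
direct sum of objects of the original category. -/
lemma exists_retract_embedding {C : Type*} [Category C] [Preadditive C] (V : Karoubi (Mat_ C)) :
    ∃ (n : ℕ) (x : Fin n → C)
      (i : ∀ k, (toKaroubi _).obj ((Mat_.embedding C).obj (x k)) ⟶ V)
      (p : ∀ k, V ⟶ (toKaroubi _).obj ((Mat_.embedding C).obj (x k))), ∑ k, p k ≫ i k = 𝟙 V := by
  let e := (Fintype.equivFin V.X.ι).symm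
  have hV : ∀ i j, ∑ k, V.p i k ≫ V.p k j = V.p i j := fun i j => by
    rw [← Mat_.comp_apply, V.idem]
  -- The maps into and out of `V` are the rows and columns of its idempotent matrix; all three
  -- remaining goals amount to that matrix being idempotent.
  refine ⟨Fintype.card V.X.ι, fun k => V.X.X (e k), fun k => ⟨fun _ j => V.p (e k) j, ?_⟩,
    fun k => ⟨fun i _ => V.p i (e k), ?_⟩, ?_⟩
  · refine (Category.id_comp _).trans ?_
    ext i j
    exact (Mat_.comp_apply _ _ _ _).trans (hV _ _)
  · refine (congrArg (V.p ≫ ·) (Category.comp_id _)).trans ?_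
    ext i j
    exact (Mat_.comp_apply _ _ _ _).trans (hV _ _)
  · refine Karoubi.hom_ext _ _ ?_
    rw [Karoubi.sum_hom]
    ext i j
    rw [mat_sum_apply]
    refine Eq.trans ?_ (hV i j)
    refine Fintype.sum_equiv e _ _ fun k => ?_
    exact mat_comp_apply_of_unique _ _ _ _ PUnit.unit fun _ => rfl

variable (𝕜 G) in
lemma vectG_isLinearization : IsLinearization 𝕜 (VectG.of 𝕜 G) where
  linearIndependent x y := (Module.Basis.ofRepr (vectGHomEquiv (𝕜 := 𝕜) x y)).linearIndependent
  span_eq_top x y := (Module.Basis.ofRepr (vectGHomEquiv (𝕜 := 𝕜) x y)).span_eq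
  exists_retract V := exists_retract_embedding V

end

end TwoGroupFourier

open TwoGroupFourier in
theorem mainTheorem3 (𝕜 : Type w) [Field 𝕜] [IsAlgClosed 𝕜] [CharZero 𝕜]
    (G : Type u) [Groupoid.{v} G] [MonoidalCategory G] [TwoGroup G] [TwoGroup.IsFinite G] :
    ∃ (E₁ : TwoFun (HomotopyQuotient G (Conj G)) (FGModuleCat.{max v w} 𝕜) ≌
        DrinfeldCenter (VectG 𝕜 G))
      (E₂ : TwoFun (HomotopyQuotient G (Conj G)) (FGModuleCat.{max v w} 𝕜) ≌
        TwoFun (Loop G) (FGModuleCat.{max v w} 𝕜)),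
      Nonempty (HomotopyQuotient.restrict G (Conj G) (FGModuleCat.{max v w} 𝕜) ⋙
          (Functor.whiskeringRight _ _ _).obj
            (forget₂ (FGModuleCat.{max v w} 𝕜) (ModuleCat.{max v w} 𝕜)) ≅
        E₁.functor ⋙ DrinfeldCenter.forget (VectG 𝕜 G) ⋙ fourier 𝕜 G) ∧
      (∃ θ : ∀ φ : Loop G, E₂.functor ⋙ TwoFun.evalAt _ φ ≅
          TwoFun.evalAt (FGModuleCat.{max v w} 𝕜) (⟨φ.base⟩ : HomotopyQuotient G (Conj G)),
        ∀ (φ ψ : Loop G) (α : φ ⟶ ψ),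
          (θ φ).hom ≫ TwoFun.evalMap (FGModuleCat.{max v w} 𝕜) (Loop.toConj α) =
            Functor.whiskerLeft E₂.functor (TwoFun.evalMap (FGModuleCat.{max v w} 𝕜) α) ≫
              (θ ψ).hom) ∧
      (∃ (_ : MonoidalCategory (TwoFun (Loop G) (FGModuleCat.{max v w} 𝕜)))
        (_ : BraidedCategory (TwoFun (Loop G) (FGModuleCat.{max v w} 𝕜))),
        Nonempty ((E₂.symm.trans E₁).functor.Braided)) := by
  have hJ := vectG_isLinearization 𝕜 G
  have := TwoGroup.finite_hom (G := G)
  have : ∀ (x : G) (V : VectG 𝕜 G), Module.Finite 𝕜 ((VectG.of 𝕜 G).obj x ⟶ V) := hJ.finite_hom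
  have := Idempotents.Karoubi.karoubi_hasFiniteBiproducts (C := Mat_ (Free 𝕜 G))
  have := centerRep_faithful hJ
  have := centerRep_full hJ
  have := centerRep_essSurj hJ
  have : (centerRep 𝕜 (VectG.of 𝕜 G)).IsEquivalence := {}
  -- The underlying category of `DrinfeldCenter` is `Center`; its reversed braiding matters only for
  -- the last claim.
  let K : DrinfeldCenter (VectG 𝕜 G) ≌ (Inertia G ⥤ FGModuleCat.{max v w} 𝕜) :=
    (centerRep 𝕜 (VectG.of 𝕜 G)).asEquivalence
  let E₁ := ((conjToInertia_isHomotopyEquivalence G).precomp (FGModuleCat.{max v w} 𝕜)).symm.trans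
    K.symm
  let E₂ := conjEquivLoop G (FGModuleCat.{max v w} 𝕜)
  exact ⟨E₁, E₂, nonempty_restrict_iso G _ _ (forget₂ (FGModuleCat.{max v w} 𝕜)
      (ModuleCat.{max v w} 𝕜)) K (DrinfeldCenter.forget (VectG 𝕜 G) ⋙ fourier 𝕜 G)
      -- `fourier 𝕜 G` unfolds to `homFunctor 𝕜 (VectG.of 𝕜 G)`.
      ⟨centerRepRestrictIso 𝕜 (VectG.of 𝕜 G)⟩,
    ⟨conjEquivLoopEval G _, fun _ _ α => conjEquivLoopEval_naturality G _ α⟩,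
    exists_braided_of_equivalence (E₂.symm.trans E₁)⟩
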